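/- Let $k$ be a commutative ring and let $H$ be a quasitriangular quasi-Hopf algebra over $k$, with coproduct $\Delta$, counit $\epsilon$, associator $\phi\in H^{\otimes 3}$, quasi-antipode $(S,\alpha,\beta)$ ($S$ an algebra anti-automorphism) and universal $R$-matrix $R=R^{(1)}\otimes R^{(2)}\in H\otimes H$. The category of left $H$-modules is closed monoidal: $H$ acts on $V\otimes W$ via $\Delta$, the associator is given by the action of $\phi$, and the internal hom is $\hom(V,W)=\mathrm{Hom}_k(V,W)$ with $h\triangleright L=h_{(1)}\circ L\circ S(h_{(2)})$, so that $\mathrm{Hom}(V\otimes W,X)\cong\mathrm{Hom}(V,\hom(W,X))$ naturally. It is braided by $\tau_{V,W}(v\otimes w)=R^{(2)}\triangleright w\otimes R^{(1)}\triangleright v$. Let $A$ be an algebra (monoid) in this category, with product $\mu$. The category of $A$-bimodules in the category of $H$-modules is closed monoidal, with tensor product $\otimes_A$, unit object $A$, and internal hom $\hom_A(V,W)\subseteq\hom(V,W)$ (the internal homomorphisms that are right $A$-linear). Suppose that $A$ is braided commutative, $\mu\circ\tau_{A,A}=\mu$. An $A$-bimodule $V$ with left action $l$ and right action $r$ is symmetric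 if $r\circ\tau_{A,V}=l$ and $l\circ\tau_{V,A}=r$. Let $F\in H\otimes H$ be a cochain twist, that is an invertible element with $(\epsilon\otimes\mathrm{id})(F)=1=(\mathrm{id}\otimes\epsilon)(F)$; write $F=F^{(1)}\otimes F^{(2)}$ and $F^{-1}=F^{(-1)}\otimes F^{(-2)}$. Let $H_F$ be the algebra $H$ with $$\Delta_F=F\,\Delta(\cdot)\,F^{-1},\qquad \epsilon_F=\epsilon,\qquad S_F=S,\qquad R_F=F_{21}RF^{-1},$$ $$\phi_F=(1\otimes F)\,(\mathrm{id}\otimes\Delta)(F)\,\phi\,(\Delta\otimes\mathrm{id})(F^{-1})\,(F^{-1}\otimes 1),$$ $$\alpha_F=S(F^{(-1)})\,\alpha\,F^{(-2)},\qquad \beta_F=F^{(1)}\,\beta\,S(F^{(2)}).$$ Let $\mathcal F$ be the functor from $H$-modules to $H_F$-modules that is the identity on modules and morphisms, with coherence maps $\varphi_{V,W}(v\otimes w)=F^{(-1)}\triangleright v\otimes F^{(-2)}\triangleright w$ and $\mathrm{id}_k$. Let $A_F=\mathcal F(A)$ with product $\mu\circ\varphi_{A,A}$, and for an $A$-bimodule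 $V$ let $V_F=\mathcal F(V)$ be the $A_F$-bimodule with actions $l\circ\varphi_{A,V}$ and $r\circ\varphi_{V,A}$. Then: 1. $H_F$ is a quasitriangular quasi-Hopf algebra and $A_F$ is braided commutative. 2. The symmetric $A$-bimodules contain $A$ and are closed under $\otimes_A$ and $\hom_A$, and $\tau$ induces a braiding $\tau^A$ on the closed monoidal category that they form, characterized by $\tau^A_{V,W}\circ\pi_{V,W}=\pi_{W,V}\circ\tau_{V,W}$, where $\pi_{V,W}:V\otimes W\to V\otimes_A W$ is the projection. The same holds for $A_F$ over $H_F$. 3. The functor $V\mapsto V_F$ (identity on morphisms) from $A$-bimodules over $H$ to $A_F$-bimodules over $H_F$ is an equivalence of closed monoidal categories: it is an equivalence of categories, it is strong monoidal with coherence isomorphisms $V_F\otimes_{A_F}W_F\to(V\otimes_A W)_F$ induced by $\varphi_{V,W}$ and the identity $A_F\to A_F$, and there are isomorphisms $\gamma^A_{V,W}:\hom_{A_F}(V_F,W_F)\to(\hom_A(V,W))_F$, $L\mapsto F^{(-1)}\circ L\circ S(F^{(-2)})$ (elements of $H$ standing for their action), natural in $V$ and $W$ and compatible with the evaluation morphisms.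 4. An $A$-bimodule $V$ is symmetric if and only if the $A_F$-bimodule $V_F$ is symmetric, and the functor of part 3, with its coherence isomorphisms and the isomorphisms $\gamma^A$, restricts to an equivalence of braided closed monoidal categories from the symmetric $A$-bimodules over $H$ to the symmetric $A_F$-bimodules over $H_F$; that is, the restriction is an equivalence of categories that is strong monoidal, compatible with the braidings $\tau^A$ and $\tau^{A_F}$, and compatible with the internal homs. -/

import Mathlib

set_option linter.unusedSimpArgs false
set_option linter.unusedSectionVars false
set_option linter.unusedVariables false

open CategoryTheory MonoidalCategory Limits TensorProduct

universe u

namespace QHopf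

noncomputable section

/-! ### Quasitriangular quasi-Hopf algebras -/

section Contractions

variable {k H : Type u} [CommRing k] [Ring H] [Algebra k H]

/-- `a ⊗ b ↦ f a * c * b`. -/
def contrL (f : H →ₗ[k] H) (c : H) : H ⊗[k] H →ₗ[k] H :=
  TensorProduct.lift ((LinearMap.mul k H).comp ((LinearMap.mulRight k c).comp f))

/-- `a ⊗ b ↦ a * c * f b`. -/
def contrR (f : H →ₗ[k] H) (c : H) : H ⊗[k] H →ₗ[k] H :=
  TensorProduct.lift (((LinearMap.mul k H).comp (LinearMap.mulRight k c)).compl₂ f)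

/-- `a ⊗ b ⊗ c ↦ a * x * f b * y * c`. -/
def contrRL (f : H →ₗ[k] H) (x y : H) : H ⊗[k] (H ⊗[k] H) →ₗ[k] H :=
  TensorProduct.lift (((LinearMap.mul k H).comp (LinearMap.mulRight k x)).compl₂ (contrL f y))

/-- `a ⊗ b ⊗ c ↦ f a * x * b * y * f c`. -/
def contrLR (f : H →ₗ[k] H) (x y : H) : H ⊗[k] (H ⊗[k] H) →ₗ[k] H :=
  TensorProduct.lift (((LinearMap.mul k H).comp ((LinearMap.mulRight k x).comp f)).compl₂
    (contrR f y))

@[simp] lemma contrL_tmul (f : H →ₗ[k] H) (c a b : H) :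
    contrL f c (a ⊗ₜ b) = f a * c * b := rfl

@[simp] lemma contrR_tmul (f : H →ₗ[k] H) (c a b : H) :
    contrR f c (a ⊗ₜ b) = a * c * f b := rfl

lemma contrRL_tmul (f : H →ₗ[k] H) (x y a b c : H) :
    contrRL f x y (a ⊗ₜ (b ⊗ₜ c)) = a * x * (f b * y * c) := rfl

lemma contrLR_tmul (f : H →ₗ[k] H) (x y a b c : H) :
    contrLR f x y (a ⊗ₜ (b ⊗ₜ c)) = f a * x * (b * y * f c) := rfl

end Contractions

/-- The structure maps of a quasitriangular quasi-Hopf algebra with underlying algebra `H`: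
coproduct, counit, associator, quasi-antipode `(S, α, β)` and universal `R`-matrix. The antipode
is an algebra anti-automorphism. The axioms are the fields of `IsQuasitriangular`. -/
structure Data (k H : Type u) [CommRing k] [Ring H] [Algebra k H] where
  Δ : H →ₐ[k] H ⊗[k] H
  ε : H →ₐ[k] k
  φ : (H ⊗[k] (H ⊗[k] H))ˣ
  S : H ≃ₐ[k] Hᵐᵒᵖ
  α : H
  β : H
  R : (H ⊗[k] H)ˣ

section Legs

variable (k H : Type u) [CommRing k] [Ring H] [Algebra k H]

/-- `a ⊗ b ⊗ c ↦ b ⊗ a ⊗ c`, that is `X ↦ X₂₁₃`. -/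
def p213 : H ⊗[k] (H ⊗[k] H) ≃ₐ[k] H ⊗[k] (H ⊗[k] H) := Algebra.TensorProduct.leftComm k H H H

/-- `a ⊗ b ⊗ c ↦ a ⊗ c ⊗ b`, that is `X ↦ X₁₃₂`. -/
def p132 : H ⊗[k] (H ⊗[k] H) ≃ₐ[k] H ⊗[k] (H ⊗[k] H) :=
  Algebra.TensorProduct.congr AlgEquiv.refl (Algebra.TensorProduct.comm k H H)

/-- `a ⊗ b ⊗ c ↦ c ⊗ a ⊗ b`, that is `X ↦ X₂₃₁`: the first factor of `X` is put in the second
place, the second factor in the third place, and the third factor in the first place. -/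
def p231 : H ⊗[k] (H ⊗[k] H) ≃ₐ[k] H ⊗[k] (H ⊗[k] H) := (p132 k H).trans (p213 k H)

/-- `a ⊗ b ⊗ c ↦ b ⊗ c ⊗ a`, that is `X ↦ X₃₁₂`: the first factor of `X` is put in the third
place, the second factor in the first place, and the third factor in the second place. -/
def p312 : H ⊗[k] (H ⊗[k] H) ≃ₐ[k] H ⊗[k] (H ⊗[k] H) := (p213 k H).trans (p132 k H)

/-- `a ⊗ b ↦ a ⊗ b ⊗ 1`. -/
def i12 : H ⊗[k] H →ₐ[k] H ⊗[k] (H ⊗[k] H) :=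
  Algebra.TensorProduct.map (AlgHom.id k H) Algebra.TensorProduct.includeLeft

/-- `a ⊗ b ↦ 1 ⊗ a ⊗ b`. -/
def i23 : H ⊗[k] H →ₐ[k] H ⊗[k] (H ⊗[k] H) := Algebra.TensorProduct.includeRight

/-- `a ⊗ b ↦ a ⊗ 1 ⊗ b`. -/
def i13 : H ⊗[k] H →ₐ[k] H ⊗[k] (H ⊗[k] H) :=
  Algebra.TensorProduct.map (AlgHom.id k H) Algebra.TensorProduct.includeRight

/-- `a ⊗ b ⊗ c ↦ a ⊗ b ⊗ c ⊗ 1`. -/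
def i123 : H ⊗[k] (H ⊗[k] H) →ₐ[k] H ⊗[k] (H ⊗[k] (H ⊗[k] H)) :=
  Algebra.TensorProduct.map (AlgHom.id k H) (i12 k H)

/-- `a ⊗ b ⊗ c ↦ 1 ⊗ a ⊗ b ⊗ c`. -/
def i234 : H ⊗[k] (H ⊗[k] H) →ₐ[k] H ⊗[k] (H ⊗[k] (H ⊗[k] H)) :=
  Algebra.TensorProduct.includeRight

@[simp] lemma p213_tmul (a b c : H) : p213 k H (a ⊗ₜ (b ⊗ₜ c)) = b ⊗ₜ (a ⊗ₜ c) := rfl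
@[simp] lemma p132_tmul (a b c : H) : p132 k H (a ⊗ₜ (b ⊗ₜ c)) = a ⊗ₜ (c ⊗ₜ b) := rfl
@[simp] lemma p231_tmul (a b c : H) : p231 k H (a ⊗ₜ (b ⊗ₜ c)) = c ⊗ₜ (a ⊗ₜ b) := rfl
@[simp] lemma p312_tmul (a b c : H) : p312 k H (a ⊗ₜ (b ⊗ₜ c)) = b ⊗ₜ (c ⊗ₜ a) := rfl
@[simp] lemma i12_tmul (a b : H) : i12 k H (a ⊗ₜ b) = a ⊗ₜ (b ⊗ₜ 1) := rfl
@[simp] lemma i23_tmul (a b : H) : i23 k H (a ⊗ₜ b) = 1 ⊗ₜ (a ⊗ₜ b) := rfl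
@[simp] lemma i13_tmul (a b : H) : i13 k H (a ⊗ₜ b) = a ⊗ₜ (1 ⊗ₜ b) := rfl

end Legs

namespace Data

variable {k H : Type u} [CommRing k] [Ring H] [Algebra k H] (D : Data k H)

/-- The antipode as a `k`-linear map `H → H`. -/
def antipode : H →ₗ[k] H :=
  (MulOpposite.opLinearEquiv k).symm.toLinearMap.comp D.S.toLinearMap

lemma antipode_mul (a b : H) : D.antipode (a * b) = D.antipode b * D.antipode a := by
  simp [antipode]

@[simp] lemma antipode_one : D.antipode 1 = 1 := by
  simp [antipode]

/-- `id ⊗ Δ`. -/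
def idΔ : H ⊗[k] H →ₐ[k] H ⊗[k] (H ⊗[k] H) := Algebra.TensorProduct.map (AlgHom.id k H) D.Δ

/-- `Δ ⊗ id`. -/
def Δid : H ⊗[k] H →ₐ[k] H ⊗[k] (H ⊗[k] H) :=
  (Algebra.TensorProduct.assoc k k k H H H).toAlgHom.comp
    (Algebra.TensorProduct.map D.Δ (AlgHom.id k H))

/-- `id ⊗ id ⊗ Δ`. -/
def ididΔ : H ⊗[k] (H ⊗[k] H) →ₐ[k] H ⊗[k] (H ⊗[k] (H ⊗[k] H)) :=
  Algebra.TensorProduct.map (AlgHom.id k H) D.idΔ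

/-- `id ⊗ Δ ⊗ id`. -/
def idΔid : H ⊗[k] (H ⊗[k] H) →ₐ[k] H ⊗[k] (H ⊗[k] (H ⊗[k] H)) :=
  Algebra.TensorProduct.map (AlgHom.id k H) D.Δid

/-- `Δ ⊗ id ⊗ id`. -/
def Δidid : H ⊗[k] (H ⊗[k] H) →ₐ[k] H ⊗[k] (H ⊗[k] (H ⊗[k] H)) :=
  (Algebra.TensorProduct.assoc k k k H H (H ⊗[k] H)).toAlgHom.comp
    (Algebra.TensorProduct.map D.Δ (AlgHom.id k (H ⊗[k] H)))

/-- `id ⊗ ε`. -/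
def idε : H ⊗[k] H →ₐ[k] H :=
  (Algebra.TensorProduct.rid k k H).toAlgHom.comp (Algebra.TensorProduct.map (AlgHom.id k H) D.ε)

/-- `ε ⊗ id`. -/
def εid : H ⊗[k] H →ₐ[k] H :=
  (Algebra.TensorProduct.lid k H).toAlgHom.comp (Algebra.TensorProduct.map D.ε (AlgHom.id k H))

/-- `id ⊗ ε ⊗ id`. -/
def idεid : H ⊗[k] (H ⊗[k] H) →ₐ[k] H ⊗[k] H :=
  Algebra.TensorProduct.map (AlgHom.id k H) D.εid

/-- The axioms of a quasitriangular quasi-Hopf algebra. -/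
class IsQuasitriangular : Prop where
  counit_left (h : H) : D.εid (D.Δ h) = h
  counit_right (h : H) : D.idε (D.Δ h) = h
  coassoc (h : H) : D.idΔ (D.Δ h) * D.φ = D.φ * D.Δid (D.Δ h)
  pentagon : D.ididΔ D.φ * D.Δidid D.φ = i234 k H D.φ * D.idΔid D.φ * i123 k H D.φ
  counit_φ : D.idεid D.φ = 1
  antipode_left (h : H) : contrL D.antipode D.α (D.Δ h) = D.ε h • D.α
  antipode_right (h : H) : contrR D.antipode D.β (D.Δ h) = D.ε h • D.β
  antipode_φ : contrRL D.antipode D.β D.α (D.φ : H ⊗[k] (H ⊗[k] H)) = 1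
  antipode_φ_inv : contrLR D.antipode D.α D.β (↑D.φ⁻¹ : H ⊗[k] (H ⊗[k] H)) = 1
  R_comm (h : H) : Algebra.TensorProduct.comm k H H (D.Δ h) * D.R = D.R * D.Δ h
  idΔ_R : D.idΔ D.R = p231 k H ↑D.φ⁻¹ * i13 k H D.R * p213 k H D.φ * i12 k H D.R * ↑D.φ⁻¹
  Δid_R : D.Δid D.R = p312 k H D.φ * i13 k H D.R * p132 k H ↑D.φ⁻¹ * i23 k H D.R * D.φ

/-- A cochain twist: an invertible, counital element of `H ⊗ H`. -/
class IsCochainTwist (F : (H ⊗[k] H)ˣ) : Prop where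
  counit_left : D.εid F = 1
  counit_right : D.idε F = 1

/-- Conjugation `x ↦ F x F⁻¹` by a unit, as an algebra homomorphism. -/
def conj {B : Type u} [Ring B] [Algebra k B] (F : Bˣ) : B →ₐ[k] B where
  toFun x := F * x * ↑F⁻¹
  map_one' := by simp
  map_mul' x y := by simp [mul_assoc]
  map_zero' := by simp
  map_add' x y := by simp [mul_add, add_mul]
  commutes' r := by rw [← Algebra.commutes, mul_assoc, Units.mul_inv, mul_one]

/-- The twisted structure maps `Δ_F = F Δ(-) F⁻¹`, `ε_F = ε`,
`φ_F = (1 ⊗ F) (id ⊗ Δ)(F) φ (Δ ⊗ id)(F⁻¹) (F⁻¹ ⊗ 1)`, `S_F = S`, `α_F = S(F⁻¹₍₁₎) α F⁻¹₍₂₎`,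
`β_F = F₍₁₎ β S(F₍₂₎)`, `R_F = F₂₁ R F⁻¹`. -/
def twist (F : (H ⊗[k] H)ˣ) : Data k H where
  Δ := (conj F).comp D.Δ
  ε := D.ε
  φ := Units.map (i23 k H).toMonoidHom F * Units.map D.idΔ.toMonoidHom F * D.φ *
    Units.map D.Δid.toMonoidHom F⁻¹ * Units.map (i12 k H).toMonoidHom F⁻¹
  S := D.S
  α := contrL D.antipode D.α (↑F⁻¹ : H ⊗[k] H)
  β := contrR D.antipode D.β (F : H ⊗[k] H)
  R := Units.map (Algebra.TensorProduct.comm k H H).toAlgHom.toMonoidHom F * D.R * F⁻¹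

end Data

end

end QHopf

namespace QHopf

noncomputable section

/-! ### Left modules over a quasi-Hopf algebra and their monoidal structure -/

section TensorAction

variable {k : Type u} [CommRing k]
variable {A B C A' B' : Type u} [Ring A] [Algebra k A] [Ring B] [Algebra k B] [Ring C]
  [Algebra k C] [Ring A'] [Algebra k A'] [Ring B'] [Algebra k B']
variable {M N P : Type u} [AddCommGroup M] [Module k M] [AddCommGroup N] [Module k N]
  [AddCommGroup P] [Module k P]

/-- The action of `A ⊗ B` on `M ⊗ N` induced by actions of `A` on `M` and of `B` on `N`. -/
def tact (f : A →ₐ[k] Module.End k M) (g : B →ₐ[k] Module.End k N) :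
    A ⊗[k] B →ₐ[k] Module.End k (M ⊗[k] N) :=
  Module.endTensorEndAlgHom.comp (Algebra.TensorProduct.map f g)

@[simp] lemma tact_tmul (f : A →ₐ[k] Module.End k M) (g : B →ₐ[k] Module.End k N)
    (a : A) (b : B) (m : M) (n : N) : tact f g (a ⊗ₜ b) (m ⊗ₜ n) = f a m ⊗ₜ g b n := rfl

lemma tact_tmul_eq (f : A →ₐ[k] Module.End k M) (g : B →ₐ[k] Module.End k N)
    (a : A) (b : B) : tact f g (a ⊗ₜ b) = TensorProduct.map (f a) (g b) := rfl

lemma tact_comp (f : A →ₐ[k] Module.End k M) (g : B →ₐ[k] Module.End k N)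
    (p : A' →ₐ[k] A) (q : B' →ₐ[k] B) (t : A' ⊗[k] B') :
    tact (f.comp p) (g.comp q) t = tact f g (Algebra.TensorProduct.map p q t) := by
  induction t with
  | zero => simp
  | tmul a b => rfl
  | add x y hx hy => simp only [map_add, hx, hy]

lemma tact_assoc (f : A →ₐ[k] Module.End k M) (g : B →ₐ[k] Module.End k N)
    (h : C →ₐ[k] Module.End k P) (t : (A ⊗[k] B) ⊗[k] C) :
    (TensorProduct.assoc k M N P).toLinearMap ∘ₗ tact (tact f g) h t =
      tact f (tact g h) (Algebra.TensorProduct.assoc k k k A B C t) ∘ₗ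
        (TensorProduct.assoc k M N P).toLinearMap := by
  induction t with
  | zero => simp
  | add x y hx hy => simp only [map_add, LinearMap.comp_add, LinearMap.add_comp, hx, hy]
  | tmul x c =>
    induction x with
    | zero => simp
    | add x y hx hy =>
      simp only [map_add, TensorProduct.add_tmul, LinearMap.comp_add, LinearMap.add_comp, hx, hy]
    | tmul a b =>
      apply TensorProduct.ext_threefold
      intro x y z
      rfl

lemma tact_map (f : A →ₐ[k] Module.End k M) (g : B →ₐ[k] Module.End k N)
    {M' N' : Type u} [AddCommGroup M'] [Module k M'] [AddCommGroup N'] [Module k N']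
    (f' : A →ₐ[k] Module.End k M') (g' : B →ₐ[k] Module.End k N')
    (p : M →ₗ[k] M') (q : N →ₗ[k] N') (hp : ∀ a, p ∘ₗ f a = f' a ∘ₗ p)
    (hq : ∀ b, q ∘ₗ g b = g' b ∘ₗ q) (t : A ⊗[k] B) :
    TensorProduct.map p q ∘ₗ tact f g t = tact f' g' t ∘ₗ TensorProduct.map p q := by
  induction t with
  | zero => simp
  | add x y hx hy => simp only [map_add, LinearMap.comp_add, LinearMap.add_comp, hx, hy]
  | tmul a b =>
    rw [tact_tmul_eq, tact_tmul_eq, ← TensorProduct.map_comp, ← TensorProduct.map_comp, hp, hq]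

end TensorAction


section Unbundled

variable {k H : Type u} [CommRing k] [Ring H] [Algebra k H] (D : Data k H)
variable {V W X Y : Type u} [AddCommGroup V] [Module k V] [AddCommGroup W] [Module k W]
  [AddCommGroup X] [Module k X] [AddCommGroup Y] [Module k Y]
variable (v : H →ₐ[k] Module.End k V) (w : H →ₐ[k] Module.End k W) (x : H →ₐ[k] Module.End k X)
  (y : H →ₐ[k] Module.End k Y)

/-- The tensor product action `h ▷ (m ⊗ n) = h₍₁₎ ▷ m ⊗ h₍₂₎ ▷ n`. -/
def dact : H →ₐ[k] Module.End k (V ⊗[k] W) := (tact v w).comp D.Δ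

/-- The action `h ▷ c = ε(h) c` on `k`. -/
def uact : H →ₐ[k] Module.End k k := (Algebra.ofId k (Module.End k k)).comp D.ε

lemma uact_apply (h : H) (c : k) : uact D h c = D.ε h * c := rfl

/-- The action of `H ⊗ H ⊗ H` on `V ⊗ (W ⊗ X)`. -/
abbrev act₃ := tact v (tact w x)

/-- The action of `H ⊗ H ⊗ H ⊗ H` on `V ⊗ (W ⊗ (X ⊗ Y))`. -/
abbrev act₄ := tact v (tact w (tact x y))

/-- The linear equivalence `m ⊗ n ⊗ p ↦ φ₍₁₎ ▷ m ⊗ (φ₍₂₎ ▷ n ⊗ φ₍₃₎ ▷ p)`. -/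
def assocLin : (V ⊗[k] W) ⊗[k] X ≃ₗ[k] V ⊗[k] (W ⊗[k] X) :=
  (TensorProduct.assoc k V W X).trans
    (LinearMap.GeneralLinearGroup.generalLinearEquiv k _
      (Units.map (act₃ v w x).toMonoidHom D.φ))

lemma assocLin_eq : (assocLin D v w x).toLinearMap =
    act₃ v w x D.φ ∘ₗ (TensorProduct.assoc k V W X).toLinearMap := rfl

lemma assocLin_symm_eq : (assocLin D v w x).symm.toLinearMap =
    (TensorProduct.assoc k V W X).symm.toLinearMap ∘ₗ
      act₃ v w x (↑D.φ⁻¹ : H ⊗[k] (H ⊗[k] H)) := rfl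

lemma tact_dact_right (t : H ⊗[k] H) : tact v (dact D w x) t = act₃ v w x (D.idΔ t) :=
  tact_comp v (tact w x) (AlgHom.id k H) D.Δ t

lemma tact_dact_left (t : H ⊗[k] H) :
    (TensorProduct.assoc k V W X).toLinearMap ∘ₗ tact (dact D v w) x t =
      act₃ v w x (D.Δid t) ∘ₗ (TensorProduct.assoc k V W X).toLinearMap := by
  have h := tact_comp (tact v w) x D.Δ (AlgHom.id k H) t
  have h2 := tact_assoc v w x (Algebra.TensorProduct.map D.Δ (AlgHom.id k H) t)
  rw [← h] at h2
  exact h2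

lemma lid_tact (t : H ⊗[k] H) :
    (TensorProduct.lid k V).toLinearMap ∘ₗ tact (uact D) v t =
      v (D.εid t) ∘ₗ (TensorProduct.lid k V).toLinearMap := by
  induction t with
  | zero => simp
  | add x y hx hy => simp only [map_add, LinearMap.comp_add, LinearMap.add_comp, hx, hy]
  | tmul a b =>
    apply TensorProduct.ext'
    intro c m
    change (D.ε a * c) • v b m = v (D.ε a • b) (c • m)
    simp [mul_smul, smul_comm c]

lemma rid_tact (t : H ⊗[k] H) :
    (TensorProduct.rid k V).toLinearMap ∘ₗ tact v (uact D) t =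
      v (D.idε t) ∘ₗ (TensorProduct.rid k V).toLinearMap := by
  induction t with
  | zero => simp
  | add x y hx hy => simp only [map_add, LinearMap.comp_add, LinearMap.add_comp, hx, hy]
  | tmul a b =>
    apply TensorProduct.ext'
    intro m c
    change (D.ε b * c) • v a m = v (D.ε b • a) (c • m)
    simp [mul_smul, smul_comm c]

lemma pent₁ (t : H ⊗[k] (H ⊗[k] H)) :
    (TensorProduct.assoc k W X Y).toLinearMap.lTensor V ∘ₗ
      (TensorProduct.assoc k V (W ⊗[k] X) Y).toLinearMap ∘ₗ (act₃ v w x t).rTensor Y =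
    act₄ v w x y (i123 k H t) ∘ₗ (TensorProduct.assoc k W X Y).toLinearMap.lTensor V ∘ₗ
      (TensorProduct.assoc k V (W ⊗[k] X) Y).toLinearMap := by
  induction t with
  | zero => simp
  | add x y hx hy => simp only [map_add, LinearMap.comp_add, LinearMap.add_comp,
      LinearMap.rTensor_add, hx, hy]
  | tmul a t =>
    induction t with
    | zero => simp
    | add x y hx hy => simp only [map_add, TensorProduct.tmul_add, LinearMap.comp_add,
        LinearMap.add_comp, LinearMap.rTensor_add, hx, hy]
    | tmul b c =>
      apply TensorProduct.ext'
      intro p q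
      induction p with
      | zero => simp
      | add p p' hx hx' => simp only [map_add, TensorProduct.add_tmul, hx, hx']
      | tmul m p =>
        induction p with
        | zero => simp
        | add p p' hx hx' => simp only [map_add, TensorProduct.tmul_add, TensorProduct.add_tmul,
            hx, hx']
        | tmul n p =>
          change v a m ⊗ₜ (w b n ⊗ₜ (x c p ⊗ₜ q)) = v a m ⊗ₜ (w b n ⊗ₜ (x c p ⊗ₜ (y 1 q)))
          rw [map_one, Module.End.one_apply]

lemma pent₂ (t : H ⊗[k] (H ⊗[k] H)) :
    (TensorProduct.assoc k W X Y).toLinearMap.lTensor V ∘ₗ act₃ v (dact D w x) y t =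
    act₄ v w x y (D.idΔid t) ∘ₗ (TensorProduct.assoc k W X Y).toLinearMap.lTensor V := by
  induction t with
  | zero => simp
  | add x y hx hy => simp only [map_add, LinearMap.comp_add, LinearMap.add_comp, hx, hy]
  | tmul a t =>
    change LinearMap.lTensor V _ ∘ₗ TensorProduct.map (v a) (tact (dact D w x) y t) =
      TensorProduct.map (v a) (tact w (tact x y) (D.Δid t)) ∘ₗ LinearMap.lTensor V _
    rw [LinearMap.lTensor_comp_map, LinearMap.map_comp_lTensor, tact_dact_left]

lemma pent₃ (t : H ⊗[k] (H ⊗[k] H)) :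
    (act₃ w x y t).lTensor V = act₄ v w x y (i234 k H t) := by
  change _ = tact v (act₃ w x y) (1 ⊗ₜ t)
  rw [tact_tmul_eq, map_one]
  rfl

lemma pent₄ (t : H ⊗[k] (H ⊗[k] H)) :
    (TensorProduct.assoc k V W (X ⊗[k] Y)).toLinearMap ∘ₗ act₃ (dact D v w) x y t =
      act₄ v w x y (D.Δidid t) ∘ₗ (TensorProduct.assoc k V W (X ⊗[k] Y)).toLinearMap := by
  have h := tact_comp (tact v w) (tact x y) D.Δ (AlgHom.id k (H ⊗[k] H)) t
  have h2 := tact_assoc v w (tact x y)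
    (Algebra.TensorProduct.map D.Δ (AlgHom.id k (H ⊗[k] H)) t)
  rw [← h] at h2
  exact h2

lemma pent₅ (t : H ⊗[k] (H ⊗[k] H)) :
    act₃ v w (dact D x y) t = act₄ v w x y (D.ididΔ t) := by
  have h2 : tact w (dact D x y) = (tact w (tact x y)).comp D.idΔ :=
    AlgHom.ext (tact_dact_right D w x y)
  have h := tact_comp v (tact w (tact x y)) (AlgHom.id k H) D.idΔ t
  rw [← h2] at h
  exact h

lemma idε_act (t : H ⊗[k] (H ⊗[k] H)) :
    (TensorProduct.lid k X).toLinearMap.lTensor V ∘ₗ act₃ v (uact D) x t =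
      tact v x (D.idεid t) ∘ₗ (TensorProduct.lid k X).toLinearMap.lTensor V := by
  induction t with
  | zero => simp
  | add x y hx hy => simp only [map_add, LinearMap.comp_add, LinearMap.add_comp, hx, hy]
  | tmul a t =>
    change LinearMap.lTensor V _ ∘ₗ TensorProduct.map (v a) (tact (uact D) x t) =
      TensorProduct.map (v a) (x (D.εid t)) ∘ₗ LinearMap.lTensor V _
    rw [LinearMap.lTensor_comp_map, LinearMap.map_comp_lTensor, lid_tact]

lemma assocLin_map {V' W' X' : Type u} [AddCommGroup V'] [Module k V'] [AddCommGroup W']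
    [Module k W'] [AddCommGroup X'] [Module k X'] (v' : H →ₐ[k] Module.End k V')
    (w' : H →ₐ[k] Module.End k W') (x' : H →ₐ[k] Module.End k X')
    (f : V →ₗ[k] V') (g : W →ₗ[k] W') (h : X →ₗ[k] X')
    (hf : ∀ a, f ∘ₗ v a = v' a ∘ₗ f) (hg : ∀ a, g ∘ₗ w a = w' a ∘ₗ g)
    (hh : ∀ a, h ∘ₗ x a = x' a ∘ₗ h) :
    (assocLin D v' w' x').toLinearMap ∘ₗ TensorProduct.map (TensorProduct.map f g) h =
      TensorProduct.map f (TensorProduct.map g h) ∘ₗ (assocLin D v w x).toLinearMap := by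
  have h1 : (TensorProduct.assoc k V' W' X').toLinearMap ∘ₗ
      TensorProduct.map (TensorProduct.map f g) h =
      TensorProduct.map f (TensorProduct.map g h) ∘ₗ
        (TensorProduct.assoc k V W X).toLinearMap := by
    apply TensorProduct.ext_threefold
    intros
    rfl
  rw [assocLin_eq, assocLin_eq, LinearMap.comp_assoc, h1, ← LinearMap.comp_assoc,
    ← LinearMap.comp_assoc]
  congr 1
  exact (tact_map _ _ _ _ _ _ hf (fun b => tact_map _ _ _ _ _ _ hg hh b) _).symm

variable [D.IsQuasitriangular]

lemma assocLin_equivariant (h : H) :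
    (assocLin D v w x).toLinearMap ∘ₗ dact D (dact D v w) x h =
      dact D v (dact D w x) h ∘ₗ (assocLin D v w x).toLinearMap := by
  change _ ∘ₗ tact (dact D v w) x (D.Δ h) = tact v (dact D w x) (D.Δ h) ∘ₗ _
  rw [assocLin_eq, LinearMap.comp_assoc, tact_dact_left, ← LinearMap.comp_assoc,
    ← LinearMap.comp_assoc, tact_dact_right, ← Module.End.mul_eq_comp, ← Module.End.mul_eq_comp,
    ← map_mul, ← map_mul, Data.IsQuasitriangular.coassoc]

lemma lid_equivariant (h : H) :
    (TensorProduct.lid k V).toLinearMap ∘ₗ dact D (uact D) v h =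
      v h ∘ₗ (TensorProduct.lid k V).toLinearMap := by
  refine (lid_tact D v (D.Δ h)).trans ?_
  rw [Data.IsQuasitriangular.counit_left]

lemma rid_equivariant (h : H) :
    (TensorProduct.rid k V).toLinearMap ∘ₗ dact D v (uact D) h =
      v h ∘ₗ (TensorProduct.rid k V).toLinearMap := by
  refine (rid_tact D v (D.Δ h)).trans ?_
  rw [Data.IsQuasitriangular.counit_right]

lemma pentagon_lin :
    (assocLin D w x y).toLinearMap.lTensor V ∘ₗ (assocLin D v (dact D w x) y).toLinearMap ∘ₗ
      (assocLin D v w x).toLinearMap.rTensor Y =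
    (assocLin D v w (dact D x y)).toLinearMap ∘ₗ (assocLin D (dact D v w) x y).toLinearMap := by
  have hx : (TensorProduct.assoc k W X Y).toLinearMap.lTensor V ∘ₗ
      (TensorProduct.assoc k V (W ⊗[k] X) Y).toLinearMap ∘ₗ
      (TensorProduct.assoc k V W X).toLinearMap.rTensor Y =
      (TensorProduct.assoc k V W (X ⊗[k] Y)).toLinearMap ∘ₗ
        (TensorProduct.assoc k (V ⊗[k] W) X Y).toLinearMap := by
    apply TensorProduct.ext_fourfold
    intros
    rfl
  have hp : act₄ v w x y (D.ididΔ D.φ) ∘ₗ act₄ v w x y (D.Δidid D.φ) =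
      act₄ v w x y (i234 k H D.φ) ∘ₗ act₄ v w x y (D.idΔid D.φ) ∘ₗ
        act₄ v w x y (i123 k H D.φ) := by
    have h := congrArg (act₄ v w x y) (Data.IsQuasitriangular.pentagon (D := D))
    rw [map_mul, map_mul, map_mul] at h
    exact h
  have h1 := pent₁ v w x y D.φ
  have h2 := pent₂ D v w x y D.φ
  have h4 := pent₄ D v w x y D.φ
  simp only [assocLin_eq, LinearMap.lTensor_comp, LinearMap.rTensor_comp, pent₃ v w x y, pent₅]
  ext1
  ext1
  ext a b c d
  have e := fun z => LinearMap.congr_fun hx z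
  have e1 := fun z => LinearMap.congr_fun h1 z
  have e2 := fun z => LinearMap.congr_fun h2 z
  have e4 := fun z => LinearMap.congr_fun h4 z
  have e5 := fun z => LinearMap.congr_fun hp z
  simp only [LinearMap.comp_apply] at e e1 e2 e4 e5
  simp only [TensorProduct.AlgebraTensorModule.curry_apply, TensorProduct.curry_apply,
    LinearMap.coe_restrictScalars, LinearMap.comp_apply, e2, e1, e4, e, e5]

lemma triangle_lin :
    (TensorProduct.lid k X).toLinearMap.lTensor V ∘ₗ (assocLin D v (uact D) x).toLinearMap =
      (TensorProduct.rid k V).toLinearMap.rTensor X := by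
  rw [assocLin_eq, ← LinearMap.comp_assoc, idε_act, Data.IsQuasitriangular.counit_φ, map_one]
  apply TensorProduct.ext_threefold
  intro m c n
  change m ⊗ₜ (c • n) = (c • m) ⊗ₜ n
  rw [TensorProduct.tmul_smul, TensorProduct.smul_tmul']

end Unbundled

variable {k H : Type u} [CommRing k] [Ring H] [Algebra k H]

/-- A left `H`-module: a `k`-module `carrier` with an algebra homomorphism `H → End_k(carrier)`.
The quasi-Hopf data `D` on `H` plays no role for objects and morphisms; it determines the
monoidal structure of the category. -/
structure HMod (D : Data k H) where
  carrier : Type u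
  [grp : AddCommGroup carrier]
  [mod : Module k carrier]
  act : H →ₐ[k] Module.End k carrier

attribute [instance] HMod.grp HMod.mod

namespace HMod

variable {D : Data k H}

/-- `H`-equivariant `k`-linear maps. -/
@[ext]
structure Hom (V W : HMod D) where
  lin : V.carrier →ₗ[k] W.carrier
  equivariant (h : H) : lin ∘ₗ V.act h = W.act h ∘ₗ lin

instance : Category (HMod D) where
  Hom := Hom
  id V := ⟨LinearMap.id, fun _ => rfl⟩
  comp f g := ⟨g.lin ∘ₗ f.lin, fun h => by
    rw [LinearMap.comp_assoc, f.equivariant, ← LinearMap.comp_assoc, g.equivariant,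
      LinearMap.comp_assoc]⟩

lemma Hom.map_act {V W : HMod D} (f : V ⟶ W) (h : H) (v : V.carrier) :
    Hom.lin f (V.act h v) = W.act h (Hom.lin f v) := LinearMap.congr_fun (Hom.equivariant f h) v

@[ext]
lemma hom_ext {V W : HMod D} {f g : V ⟶ W} (h : Hom.lin f = Hom.lin g) : f = g := Hom.ext h

@[simp] lemma id_lin (V : HMod D) : Hom.lin (𝟙 V) = LinearMap.id := rfl

@[simp] lemma comp_lin {V W X : HMod D} (f : V ⟶ W) (g : W ⟶ X) :
    Hom.lin (f ≫ g) = Hom.lin g ∘ₗ Hom.lin f := rfl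

/-- An equivariant linear equivalence is an isomorphism. -/
def isoMk {V W : HMod D} (e : V.carrier ≃ₗ[k] W.carrier)
    (he : ∀ h, e.toLinearMap ∘ₗ V.act h = W.act h ∘ₗ e.toLinearMap) : V ≅ W where
  hom := ⟨e.toLinearMap, he⟩
  inv := ⟨e.symm.toLinearMap, fun h => by
    ext x
    apply e.injective
    have := LinearMap.congr_fun (he h) (e.symm x)
    simp only [LinearMap.comp_apply, LinearEquiv.coe_coe, LinearEquiv.apply_symm_apply] at this ⊢
    exact this.symm⟩
  hom_inv_id := by apply hom_ext; ext x; exact e.symm_apply_apply x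
  inv_hom_id := by apply hom_ext; ext x; exact e.apply_symm_apply x

@[simp] lemma isoMk_hom_lin {V W : HMod D} (e : V.carrier ≃ₗ[k] W.carrier)
    (he : ∀ h, e.toLinearMap ∘ₗ V.act h = W.act h ∘ₗ e.toLinearMap) :
    Hom.lin (isoMk e he).hom = e.toLinearMap := rfl

@[simp] lemma isoMk_inv_lin {V W : HMod D} (e : V.carrier ≃ₗ[k] W.carrier)
    (he : ∀ h, e.toLinearMap ∘ₗ V.act h = W.act h ∘ₗ e.toLinearMap) :
    Hom.lin (isoMk e he).inv = e.symm.toLinearMap := rfl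


/-- The tensor product of `H`-modules, with `h ▷ (v ⊗ w) = h₍₁₎ ▷ v ⊗ h₍₂₎ ▷ w`. -/
def tens (V W : HMod D) : HMod D where
  carrier := V.carrier ⊗[k] W.carrier
  act := dact D V.act W.act

variable (D) in
/-- The unit object: `k` with the action `h ▷ c = ε(h) c`. -/
def unit : HMod D where
  carrier := k
  act := uact D

/-- The tensor product of equivariant maps. -/
def tensMap {V V' W W' : HMod D} (f : V ⟶ V') (g : W ⟶ W') : tens V W ⟶ tens V' W' :=
  ⟨TensorProduct.map (Hom.lin f) (Hom.lin g), fun _ =>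
    tact_map _ _ _ _ _ _ (Hom.equivariant f) (Hom.equivariant g) _⟩

variable [D.IsQuasitriangular]

/-- The associator is `v ⊗ w ⊗ x ↦ φ₍₁₎ ▷ v ⊗ (φ₍₂₎ ▷ w ⊗ φ₍₃₎ ▷ x)`; the unitors are
`c ⊗ v ↦ c v` and `v ⊗ c ↦ c v`. -/
instance : MonoidalCategoryStruct (HMod D) where
  tensorObj := tens
  whiskerLeft V _ _ f := tensMap (𝟙 V) f
  whiskerRight f W := tensMap f (𝟙 W)
  tensorHom := tensMap
  tensorUnit := unit D
  associator V W X := isoMk (V := tens (tens V W) X) (W := tens V (tens W X))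
    (assocLin D V.act W.act X.act) (assocLin_equivariant D V.act W.act X.act)
  leftUnitor V := isoMk (V := tens (unit D) V) (TensorProduct.lid k V.carrier)
    (lid_equivariant D V.act)
  rightUnitor V := isoMk (V := tens V (unit D)) (TensorProduct.rid k V.carrier)
    (rid_equivariant D V.act)

instance : MonoidalCategory (HMod D) where
  tensorHom_def f g := by
    apply hom_ext; apply TensorProduct.ext'; intros; rfl
  id_tensorHom_id V W := by
    apply hom_ext; apply TensorProduct.ext'; intros; rfl
  tensorHom_comp_tensorHom f₁ f₂ g₁ g₂ := by
    apply hom_ext; apply TensorProduct.ext'; intros; rfl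
  whiskerLeft_id V W := by
    apply hom_ext; apply TensorProduct.ext'; intros; rfl
  id_whiskerRight V W := by
    apply hom_ext; apply TensorProduct.ext'; intros; rfl
  associator_naturality f g h := hom_ext (assocLin_map D _ _ _ _ _ _ _ _ _
    (Hom.equivariant f) (Hom.equivariant g) (Hom.equivariant h))
  leftUnitor_naturality f := by
    apply hom_ext; apply TensorProduct.ext'
    exact fun c v => (map_smul (Hom.lin f) (show k from c) v).symm
  rightUnitor_naturality f := by
    apply hom_ext; apply TensorProduct.ext'
    exact fun v c => (map_smul (Hom.lin f) (show k from c) v).symm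
  pentagon V W X Y := hom_ext (pentagon_lin D V.act W.act X.act Y.act)
  triangle V W := hom_ext (triangle_lin D V.act W.act)

end HMod

end

end QHopf

namespace QHopf

noncomputable section

/-! ### Internal homomorphisms of modules over a quasi-Hopf algebra -/

section InternalHom

variable {k H : Type u} [CommRing k] [Ring H] [Algebra k H] (D : Data k H)

lemma ind₂ {p : H ⊗[k] H → Prop} (hadd : ∀ x y, p x → p y → p (x + y))
    (h : ∀ a b, p (a ⊗ₜ b)) (t : H ⊗[k] H) : p t := by
  induction t with
  | zero => rw [← TensorProduct.zero_tmul H (0 : H)]; exact h _ _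
  | add x y hx hy => exact hadd x y hx hy
  | tmul a b => exact h a b

lemma ind₃ {p : H ⊗[k] (H ⊗[k] H) → Prop} (hadd : ∀ x y, p x → p y → p (x + y))
    (h : ∀ a b c, p (a ⊗ₜ (b ⊗ₜ c))) (t : H ⊗[k] (H ⊗[k] H)) : p t := by
  have h0 : p 0 := by simpa only [TensorProduct.zero_tmul] using h 0 0 0
  induction t with
  | zero => exact h0
  | add x y hx hy => exact hadd x y hx hy
  | tmul a t =>
    induction t using ind₂ with
    | hadd x y hx hy => rw [TensorProduct.tmul_add]; exact hadd _ _ hx hy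
    | h b c => exact h a b c

lemma ind₄ {p : H ⊗[k] (H ⊗[k] (H ⊗[k] H)) → Prop} (hadd : ∀ x y, p x → p y → p (x + y))
    (h : ∀ a b c d, p (a ⊗ₜ (b ⊗ₜ (c ⊗ₜ d)))) (t : H ⊗[k] (H ⊗[k] (H ⊗[k] H))) : p t := by
  have h0 : p 0 := by
    simpa only [TensorProduct.zero_tmul] using h 0 0 0 0
  induction t with
  | zero => exact h0
  | add x y hx hy => exact hadd x y hx hy
  | tmul a t =>
    induction t using ind₃ with
    | hadd x y hx hy => rw [TensorProduct.tmul_add]; exact hadd _ _ hx hy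
    | h b c d => exact h a b c d

/-! Ring identities in `H ⊗ H ⊗ H ⊗ H`, stated with the instances that occur below. -/

lemma t4_add_mul (a b c : H ⊗[k] (H ⊗[k] (H ⊗[k] H))) : (a + b) * c = a * c + b * c := by
  let _ : Ring (H ⊗[k] (H ⊗[k] (H ⊗[k] H))) := Algebra.TensorProduct.instRing
  exact Distrib.right_distrib a b c

lemma t4_mul_add (a b c : H ⊗[k] (H ⊗[k] (H ⊗[k] H))) : a * (b + c) = a * b + a * c := by
  let _ : Ring (H ⊗[k] (H ⊗[k] (H ⊗[k] H))) := Algebra.TensorProduct.instRing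
  exact Distrib.left_distrib a b c

lemma t4_zero_mul (a : H ⊗[k] (H ⊗[k] (H ⊗[k] H))) : 0 * a = 0 := zero_mul a

lemma t4_mul_zero (a : H ⊗[k] (H ⊗[k] (H ⊗[k] H))) : a * 0 = 0 := mul_zero a

lemma t4_mul_assoc (a b c : H ⊗[k] (H ⊗[k] (H ⊗[k] H))) : a * b * c = a * (b * c) :=
  mul_assoc a b c

lemma t4_one_mul (a : H ⊗[k] (H ⊗[k] (H ⊗[k] H))) : 1 * a = a := one_mul a

lemma t4_mul_one (a : H ⊗[k] (H ⊗[k] (H ⊗[k] H))) : a * 1 = a := mul_one a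

lemma t4_map_inv_mul (f : H ⊗[k] (H ⊗[k] H) →ₐ[k] H ⊗[k] (H ⊗[k] (H ⊗[k] H)))
    (a : (H ⊗[k] (H ⊗[k] H))ˣ) : f ↑a⁻¹ * f a = 1 := by
  rw [← map_mul, a.inv_mul]; exact f.map_one'

lemma t4_map_mul_inv (f : H ⊗[k] (H ⊗[k] H) →ₐ[k] H ⊗[k] (H ⊗[k] (H ⊗[k] H)))
    (a : (H ⊗[k] (H ⊗[k] H))ˣ) : f a * f ↑a⁻¹ = 1 := by
  rw [← map_mul, a.mul_inv]; exact f.map_one'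

section Algebra

lemma contrL_mul (c x y : H) (s : H ⊗[k] H) :
    contrL D.antipode c (s * (x ⊗ₜ y)) = D.antipode x * contrL D.antipode c s * y := by
  induction s using ind₂ with
  | hadd s t hs ht => simp only [add_mul, mul_add, map_add, hs, ht]
  | h a b => simp [Algebra.TensorProduct.tmul_mul_tmul, Data.antipode_mul, mul_assoc]

lemma contrR_mul (c x y : H) (s : H ⊗[k] H) :
    contrR D.antipode c ((x ⊗ₜ y) * s) = x * contrR D.antipode c s * D.antipode y := by
  induction s using ind₂ with
  | hadd s t hs ht => simp only [add_mul, mul_add, map_add, hs, ht]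
  | h a b => simp [Algebra.TensorProduct.tmul_mul_tmul, Data.antipode_mul, mul_assoc]

lemma Δid_tmul_mul (c x : H) (s : H ⊗[k] H) :
    (Algebra.TensorProduct.assoc k k k H H H (s ⊗ₜ c)) * (1 ⊗ₜ (1 ⊗ₜ x)) =
      Algebra.TensorProduct.assoc k k k H H H (s ⊗ₜ (c * x)) := by
  induction s using ind₂ with
  | hadd s t hs ht => simp only [TensorProduct.add_tmul, add_mul, map_add, hs, ht]
  | h a b => simp [Algebra.TensorProduct.tmul_mul_tmul]

variable [D.IsQuasitriangular]

/-- `a ⊗ b ⊗ c ⊗ d ↦ a ⊗ b β S(c) α d`. -/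
abbrev cP : H ⊗[k] (H ⊗[k] (H ⊗[k] H)) →ₗ[k] H ⊗[k] H :=
  (contrRL D.antipode D.β D.α).lTensor H

/-- `a ⊗ b ⊗ c ⊗ d ↦ a ⊗ S(b) α c β S(d)`. -/
abbrev cQ : H ⊗[k] (H ⊗[k] (H ⊗[k] H)) →ₗ[k] H ⊗[k] H :=
  (contrLR D.antipode D.α D.β).lTensor H

/-- `id ⊗ id ⊗ ε`. -/
abbrev ididε : H ⊗[k] (H ⊗[k] H) →ₐ[k] H ⊗[k] H :=
  Algebra.TensorProduct.map (AlgHom.id k H) D.idε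

lemma contrRL_idΔ_mul (s : H ⊗[k] H) (z : H ⊗[k] (H ⊗[k] H)) :
    contrRL D.antipode D.β D.α (D.idΔ s * z) = D.idε s * contrRL D.antipode D.β D.α z := by
  induction s using ind₂ with
  | hadd s t hs ht => simp only [add_mul, map_add, hs, ht]
  | h b c =>
    induction z using ind₃ with
    | hadd s t hs ht => simp only [mul_add, map_add, hs, ht]
    | h x y z =>
      change contrRL D.antipode D.β D.α ((b ⊗ₜ D.Δ c) * (x ⊗ₜ (y ⊗ₜ z))) = (D.ε c • b) * _
      rw [Algebra.TensorProduct.tmul_mul_tmul]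
      change b * x * D.β * contrL D.antipode D.α (D.Δ c * (y ⊗ₜ z)) = _
      rw [contrL_mul, Data.IsQuasitriangular.antipode_left, contrRL_tmul]
      simp [mul_assoc]

lemma contrRL_mul_Δid (s : H ⊗[k] H) (z : H ⊗[k] (H ⊗[k] H)) :
    contrRL D.antipode D.β D.α (z * D.Δid s) = contrRL D.antipode D.β D.α z * D.εid s := by
  induction s using ind₂ with
  | hadd s t hs ht => simp only [mul_add, map_add, hs, ht]
  | h b c =>
    induction z using ind₃ with
    | hadd s t hs ht => simp only [add_mul, map_add, hs, ht]
    | h x y z =>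
      have key : ∀ s : H ⊗[k] H, contrRL D.antipode D.β D.α
          ((x ⊗ₜ (y ⊗ₜ z)) * Algebra.TensorProduct.assoc k k k H H H (s ⊗ₜ c)) =
          x * contrR D.antipode D.β s * (D.antipode y * D.α * (z * c)) := by
        intro s
        induction s using ind₂ with
        | hadd s t hs ht => simp only [TensorProduct.add_tmul, mul_add, add_mul, map_add, hs, ht]
        | h a b =>
          rw [Algebra.TensorProduct.assoc_tmul, Algebra.TensorProduct.tmul_mul_tmul,
            Algebra.TensorProduct.tmul_mul_tmul, contrRL_tmul, contrR_tmul, D.antipode_mul]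
          simp only [mul_assoc]
      refine (key (D.Δ b)).trans ?_
      rw [Data.IsQuasitriangular.antipode_right, contrRL_tmul]
      change _ = _ * (D.ε b • c)
      simp [mul_assoc]

lemma contrLR_Δid_mul (s : H ⊗[k] H) (z : H ⊗[k] (H ⊗[k] H)) :
    contrLR D.antipode D.α D.β (D.Δid s * z) =
      contrLR D.antipode D.α D.β z * D.antipode (D.εid s) := by
  induction s using ind₂ with
  | hadd s t hs ht => simp only [add_mul, mul_add, map_add, hs, ht]
  | h b c =>
    induction z using ind₃ with
    | hadd s t hs ht => simp only [mul_add, add_mul, map_add, hs, ht]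
    | h x y z =>
      have key : ∀ s : H ⊗[k] H, contrLR D.antipode D.α D.β
          (Algebra.TensorProduct.assoc k k k H H H (s ⊗ₜ c) * (x ⊗ₜ (y ⊗ₜ z))) =
          D.antipode x * contrL D.antipode D.α s *
            (y * D.β * D.antipode z * D.antipode c) := by
        intro s
        induction s using ind₂ with
        | hadd s t hs ht => simp only [TensorProduct.add_tmul, mul_add, add_mul, map_add, hs, ht]
        | h a b =>
          rw [Algebra.TensorProduct.assoc_tmul, Algebra.TensorProduct.tmul_mul_tmul,
            Algebra.TensorProduct.tmul_mul_tmul, contrLR_tmul, contrL_tmul, D.antipode_mul,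
            D.antipode_mul]
          simp only [mul_assoc]
      refine (key (D.Δ b)).trans ?_
      rw [Data.IsQuasitriangular.antipode_left, contrLR_tmul]
      change _ = _ * D.antipode (D.ε b • c)
      simp [mul_assoc]

lemma contrLR_mul_idΔ (s : H ⊗[k] H) (z : H ⊗[k] (H ⊗[k] H)) :
    contrLR D.antipode D.α D.β (z * D.idΔ s) =
      D.antipode (D.idε s) * contrLR D.antipode D.α D.β z := by
  induction s using ind₂ with
  | hadd s t hs ht => simp only [add_mul, mul_add, map_add, hs, ht]
  | h b c =>
    induction z using ind₃ with
    | hadd s t hs ht => simp only [mul_add, add_mul, map_add, hs, ht]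
    | h x y z =>
      change contrLR D.antipode D.α D.β ((x ⊗ₜ (y ⊗ₜ z)) * (b ⊗ₜ D.Δ c)) =
        D.antipode (D.ε c • b) * _
      rw [Algebra.TensorProduct.tmul_mul_tmul]
      change D.antipode (x * b) * D.α * contrR D.antipode D.β ((y ⊗ₜ z) * D.Δ c) = _
      rw [contrR_mul, Data.IsQuasitriangular.antipode_right, contrLR_tmul, D.antipode_mul]
      simp [mul_assoc]

lemma contrL_Δ_mul (c : H) (s : H ⊗[k] H) :
    contrL D.antipode D.α (D.Δ c * s) = D.ε c • contrL D.antipode D.α s := by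
  induction s using ind₂ with
  | hadd s t hs ht => simp only [mul_add, smul_add, map_add, hs, ht]
  | h x y => rw [contrL_mul, Data.IsQuasitriangular.antipode_left]; simp

lemma contrR_mul_Δ (c : H) (s : H ⊗[k] H) :
    contrR D.antipode D.β (s * D.Δ c) = D.ε c • contrR D.antipode D.β s := by
  induction s using ind₂ with
  | hadd s t hs ht => simp only [add_mul, smul_add, map_add, hs, ht]
  | h x y => rw [contrR_mul, Data.IsQuasitriangular.antipode_right]; simp

lemma ididε_φ : ididε D (D.φ : H ⊗[k] (H ⊗[k] H)) = 1 := by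
  -- apply `id ⊗ id ⊗ ε ⊗ ε` to the pentagon relation
  let E : H ⊗[k] (H ⊗[k] (H ⊗[k] H)) →ₐ[k] H ⊗[k] H :=
    Algebra.TensorProduct.map (AlgHom.id k H) (D.idε.comp
      (Algebra.TensorProduct.map (AlgHom.id k H) D.idε))
  have h := congrArg E (Data.IsQuasitriangular.pentagon (D := D))
  rw [map_mul, map_mul, map_mul] at h
  have hεr : ∀ s : H ⊗[k] H, D.ε (D.idε s) = D.ε (D.εid s) := by
    intro s
    induction s using ind₂ with
    | hadd s t hs ht => simp only [map_add, hs, ht]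
    | h a b =>
      change D.ε (D.ε b • a) = D.ε (D.ε a • b)
      simp [mul_comm]
  have e1 : ∀ t : H ⊗[k] (H ⊗[k] H), E (D.ididΔ t) = ididε D t := by
    intro t
    induction t using ind₃ with
    | hadd s t hs ht => simp only [map_add, hs, ht]
    | h a b c =>
      change a ⊗ₜ (D.ε (D.idε (D.Δ c)) • b) = a ⊗ₜ (D.ε c • b)
      rw [Data.IsQuasitriangular.counit_right]
  have e2 : ∀ t : H ⊗[k] (H ⊗[k] H), E (D.Δidid t) = D.Δ (D.idε (D.idεid t)) := by
    intro t
    induction t using ind₃ with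
    | hadd s t hs ht => simp only [map_add, hs, ht]
    | h a b c =>
      have key : ∀ s : H ⊗[k] H, E (Algebra.TensorProduct.assoc k k k H H (H ⊗[k] H)
          (s ⊗ₜ (b ⊗ₜ c))) = (D.ε b * D.ε c) • s := by
        intro s
        induction s using ind₂ with
        | hadd s t hs ht => simp only [TensorProduct.add_tmul, smul_add, map_add, hs, ht]
        | h x y =>
          change x ⊗ₜ (D.ε (D.ε c • b) • y) = _
          simp [mul_comm]
      refine (key (D.Δ a)).trans ?_
      change _ = D.Δ (D.ε (D.ε b • c) • a)
      simp
  have e3 : E (i234 k H D.φ) = 1 ⊗ₜ D.idε (D.idεid D.φ) := by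
    have : ∀ t : H ⊗[k] (H ⊗[k] H), E (i234 k H t) = 1 ⊗ₜ D.idε (D.idεid t) := by
      intro t
      induction t using ind₃ with
      | hadd s t hs ht => simp only [map_add, TensorProduct.tmul_add, hs, ht]
      | h a b c =>
        change 1 ⊗ₜ (D.ε (D.ε c • b) • a) = 1 ⊗ₜ (D.ε (D.ε b • c) • a)
        simp [mul_comm]
    exact this _
  have e4 : ∀ t : H ⊗[k] (H ⊗[k] H), E (D.idΔid t) = ididε D t := by
    intro t
    induction t using ind₃ with
    | hadd s t hs ht => simp only [map_add, hs, ht]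
    | h a b c =>
      have key : ∀ s : H ⊗[k] H, E (a ⊗ₜ Algebra.TensorProduct.assoc k k k H H H (s ⊗ₜ c)) =
          a ⊗ₜ (D.ε c • D.idε s) := by
        intro s
        induction s using ind₂ with
        | hadd s t hs ht =>
          simp only [TensorProduct.add_tmul, TensorProduct.tmul_add, smul_add, map_add, hs, ht]
        | h x y =>
          change a ⊗ₜ (D.ε (D.ε c • y) • x) = a ⊗ₜ (D.ε c • D.ε y • x)
          simp [mul_smul]
      refine (key (D.Δ b)).trans ?_
      rw [Data.IsQuasitriangular.counit_right]
      rfl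
  have e5 : ∀ t : H ⊗[k] (H ⊗[k] H), E (i123 k H t) = ididε D t := by
    intro t
    induction t using ind₃ with
    | hadd s t hs ht => simp only [map_add, hs, ht]
    | h a b c =>
      change a ⊗ₜ (D.ε (D.ε 1 • c) • b) = a ⊗ₜ (D.ε c • b)
      simp
  rw [e1, e2, e3, e4, e5, Data.IsQuasitriangular.counit_φ, map_one, map_one, mul_one,
    ← Algebra.TensorProduct.one_def, one_mul] at h
  have hu : IsUnit (ididε D (D.φ : H ⊗[k] (H ⊗[k] H))) := D.φ.isUnit.map (ididε D)
  exact (hu.mul_eq_left.mp h.symm)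

lemma ididε_φ_inv : ididε D (↑D.φ⁻¹ : H ⊗[k] (H ⊗[k] H)) = 1 := by
  have h := congrArg (ididε D) D.φ.inv_mul
  rwa [map_mul, ididε_φ, mul_one, map_one] at h

lemma idεid_φ_inv : D.idεid (↑D.φ⁻¹ : H ⊗[k] (H ⊗[k] H)) = 1 := by
  have h := congrArg D.idεid D.φ.inv_mul
  rwa [map_mul, Data.IsQuasitriangular.counit_φ, mul_one, map_one] at h

lemma cP_ididΔ_mul (t : H ⊗[k] (H ⊗[k] H)) (z : H ⊗[k] (H ⊗[k] (H ⊗[k] H))) :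
    cP D (D.ididΔ t * z) = ididε D t * cP D z := by
  induction t with
  | zero => simp [t4_zero_mul, t4_mul_zero]
  | add s t hs ht => simp only [t4_mul_add, mul_add, add_mul, t4_add_mul, map_add, hs, ht]
  | tmul a t =>
    induction z with
    | zero => simp [t4_zero_mul, t4_mul_zero]
    | add s t hs ht => simp only [t4_add_mul, add_mul, mul_add, t4_mul_add, map_add, hs, ht]
    | tmul x z =>
      change cP D ((a ⊗ₜ D.idΔ t) * (x ⊗ₜ z)) = (a ⊗ₜ D.idε t) * cP D (x ⊗ₜ z)
      rw [Algebra.TensorProduct.tmul_mul_tmul, LinearMap.lTensor_tmul, LinearMap.lTensor_tmul,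
        Algebra.TensorProduct.tmul_mul_tmul, contrRL_idΔ_mul]

lemma cP_mul_idΔid (t : H ⊗[k] (H ⊗[k] H)) (z : H ⊗[k] (H ⊗[k] (H ⊗[k] H))) :
    cP D (z * D.idΔid t) = cP D z * D.idεid t := by
  induction t with
  | zero => simp [t4_zero_mul, t4_mul_zero]
  | add s t hs ht => simp only [t4_add_mul, add_mul, mul_add, t4_mul_add, map_add, hs, ht]
  | tmul a t =>
    induction z with
    | zero => simp [t4_zero_mul, t4_mul_zero]
    | add s t hs ht => simp only [t4_mul_add, mul_add, add_mul, t4_add_mul, map_add, hs, ht]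
    | tmul x z =>
      change cP D ((x ⊗ₜ z) * (a ⊗ₜ D.Δid t)) = cP D (x ⊗ₜ z) * (a ⊗ₜ D.εid t)
      rw [Algebra.TensorProduct.tmul_mul_tmul, LinearMap.lTensor_tmul, LinearMap.lTensor_tmul,
        Algebra.TensorProduct.tmul_mul_tmul, contrRL_mul_Δid]

lemma cQ_idΔid_mul (t : H ⊗[k] (H ⊗[k] H)) (ht : D.idεid t = 1)
    (z : H ⊗[k] (H ⊗[k] (H ⊗[k] H))) : cQ D (D.idΔid t * z) = cQ D z := by
  induction z with
  | zero => simp [t4_zero_mul, t4_mul_zero]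
  | add s t hs ht => simp only [t4_add_mul, add_mul, mul_add, t4_mul_add, map_add, hs, ht]
  | tmul x z =>
    have key : ∀ t : H ⊗[k] (H ⊗[k] H), cQ D (D.idΔid t * (x ⊗ₜ z)) =
        ((LinearMap.mulLeft k (contrLR D.antipode D.α D.β z)).comp D.antipode).lTensor H
          (D.idεid t) * (x ⊗ₜ 1) := by
      intro t
      induction t with
      | zero => simp [t4_zero_mul, t4_mul_zero]
      | add s t hs ht => simp only [t4_mul_add, mul_add, add_mul, t4_add_mul, map_add, hs, ht]
      | tmul a t =>
        change cQ D ((a ⊗ₜ D.Δid t) * (x ⊗ₜ z)) =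
          LinearMap.lTensor H _ (a ⊗ₜ D.εid t) * (x ⊗ₜ 1)
        rw [Algebra.TensorProduct.tmul_mul_tmul, LinearMap.lTensor_tmul, LinearMap.lTensor_tmul,
          Algebra.TensorProduct.tmul_mul_tmul, contrLR_Δid_mul, mul_one]
        rfl
    rw [key, ht, Algebra.TensorProduct.one_def, LinearMap.lTensor_tmul,
      Algebra.TensorProduct.tmul_mul_tmul, LinearMap.lTensor_tmul]
    simp

lemma cQ_mul_ididΔ (t : H ⊗[k] (H ⊗[k] H)) (ht : ididε D t = 1)
    (z : H ⊗[k] (H ⊗[k] (H ⊗[k] H))) : cQ D (z * D.ididΔ t) = cQ D z := by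
  induction z with
  | zero => simp [t4_zero_mul, t4_mul_zero]
  | add s t hs ht => simp only [t4_mul_add, mul_add, add_mul, t4_add_mul, map_add, hs, ht]
  | tmul x z =>
    have key : ∀ t : H ⊗[k] (H ⊗[k] H), cQ D ((x ⊗ₜ z) * D.ididΔ t) =
        (x ⊗ₜ 1) * ((LinearMap.mulRight k (contrLR D.antipode D.α D.β z)).comp D.antipode).lTensor H
          (ididε D t) := by
      intro t
      induction t with
      | zero => simp [t4_zero_mul, t4_mul_zero]
      | add s t hs ht => simp only [t4_add_mul, add_mul, mul_add, t4_mul_add, map_add, hs, ht]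
      | tmul a t =>
        change cQ D ((x ⊗ₜ z) * (a ⊗ₜ D.idΔ t)) =
          (x ⊗ₜ 1) * LinearMap.lTensor H _ (a ⊗ₜ D.idε t)
        rw [Algebra.TensorProduct.tmul_mul_tmul, LinearMap.lTensor_tmul, LinearMap.lTensor_tmul,
          Algebra.TensorProduct.tmul_mul_tmul, contrLR_mul_idΔ, one_mul]
        rfl
    rw [key, ht, Algebra.TensorProduct.one_def, LinearMap.lTensor_tmul,
      Algebra.TensorProduct.tmul_mul_tmul, LinearMap.lTensor_tmul]
    simp

lemma cP_eq_one : cP D (D.Δidid D.φ * i123 k H ↑D.φ⁻¹) = 1 := by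
  have h : D.Δidid D.φ * i123 k H ↑D.φ⁻¹ =
      D.ididΔ ↑D.φ⁻¹ * (i234 k H D.φ * D.idΔid D.φ) := by
    have h1 := Data.IsQuasitriangular.pentagon (D := D)
    calc _ = (D.ididΔ ↑D.φ⁻¹ * D.ididΔ D.φ) * (D.Δidid D.φ * i123 k H ↑D.φ⁻¹) := by
          rw [t4_map_inv_mul, t4_one_mul]
      _ = D.ididΔ ↑D.φ⁻¹ * ((i234 k H D.φ * D.idΔid D.φ) *
          (i123 k H D.φ * i123 k H ↑D.φ⁻¹)) := by
        rw [t4_mul_assoc, ← t4_mul_assoc (D.ididΔ D.φ), h1, ← t4_mul_assoc (_ * _)]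
      _ = _ := by rw [t4_map_mul_inv, t4_mul_one]
  rw [h, cP_ididΔ_mul, cP_mul_idΔid, ididε_φ_inv, Data.IsQuasitriangular.counit_φ, mul_one,
    one_mul]
  change _ ⊗ₜ contrRL D.antipode D.β D.α (D.φ : H ⊗[k] (H ⊗[k] H)) = 1
  rw [Data.IsQuasitriangular.antipode_φ]
  rfl

lemma cQ_eq_one : cQ D (i123 k H D.φ * D.Δidid ↑D.φ⁻¹) = 1 := by
  have h : i123 k H D.φ * D.Δidid ↑D.φ⁻¹ =
      D.idΔid ↑D.φ⁻¹ * (i234 k H ↑D.φ⁻¹ * D.ididΔ D.φ) := by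
    have h1 := Data.IsQuasitriangular.pentagon (D := D)
    calc _ = D.idΔid ↑D.φ⁻¹ * ((i234 k H ↑D.φ⁻¹ * i234 k H D.φ) * (D.idΔid D.φ *
          (i123 k H D.φ * D.Δidid ↑D.φ⁻¹))) := by
          rw [t4_map_inv_mul, t4_one_mul, ← t4_mul_assoc, t4_map_inv_mul, t4_one_mul]
      _ = D.idΔid ↑D.φ⁻¹ * (i234 k H ↑D.φ⁻¹ * ((i234 k H D.φ * D.idΔid D.φ * i123 k H D.φ) *
          D.Δidid ↑D.φ⁻¹)) := by
        simp only [t4_mul_assoc]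
      _ = _ := by rw [← h1, t4_mul_assoc, t4_map_mul_inv, t4_mul_one]
  rw [h, cQ_idΔid_mul D _ (idεid_φ_inv D), cQ_mul_ididΔ D _ (ididε_φ D)]
  change _ ⊗ₜ contrLR D.antipode D.α D.β (↑D.φ⁻¹ : H ⊗[k] (H ⊗[k] H)) = 1
  rw [Data.IsQuasitriangular.antipode_φ_inv]
  rfl

end Algebra

variable {V W X : Type u} [AddCommGroup V] [Module k V] [AddCommGroup W] [Module k W]
  [AddCommGroup X] [Module k X]
variable (v : H →ₐ[k] Module.End k V) (w : H →ₐ[k] Module.End k W) (x : H →ₐ[k] Module.End k X)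

/-- Postcomposition `L ↦ x(a) ∘ L` on linear maps. -/
def postAct : H →ₐ[k] Module.End k (W →ₗ[k] X) where
  toFun a := LinearMap.compRight k (x a)
  map_one' := by ext; simp
  map_mul' a b := by ext; simp
  map_zero' := by ext; simp
  map_add' a b := by ext; simp
  commutes' r := by ext; simp [Algebra.algebraMap_eq_smul_one]

/-- Precomposition `L ↦ L ∘ w(b)` on linear maps. -/
def preAct : Hᵐᵒᵖ →ₐ[k] Module.End k (W →ₗ[k] X) where
  toFun b := LinearMap.lcomp k X (w b.unop)
  map_one' := by ext; simp
  map_mul' a b := by ext; simp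
  map_zero' := by ext; simp
  map_add' a b := by ext; simp
  commutes' r := by ext; simp [Algebra.algebraMap_eq_smul_one]

/-- The action of `H ⊗ Hᵒᵖ` on linear maps, `a ⊗ b` sending `L` to `x(a) ∘ L ∘ w(b)`. -/
def sandOp : H ⊗[k] Hᵐᵒᵖ →ₐ[k] Module.End k (W →ₗ[k] X) :=
  Algebra.TensorProduct.lift (postAct x) (preAct w) (fun _ _ => by ext; rfl)

/-- `a ⊗ b` sends `L` to `x(a) ∘ L ∘ w(b)`. -/
def sand : H ⊗[k] H →ₗ[k] Module.End k (W →ₗ[k] X) :=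
  (sandOp w x).toLinearMap ∘ₗ (MulOpposite.opLinearEquiv k).toLinearMap.lTensor H

@[simp] lemma sand_tmul (a b : H) (L : W →ₗ[k] X) (n : W) :
    sand w x (a ⊗ₜ b) L n = x a (L (w b n)) := rfl

/-- The adjoint action `h ▷ L = h₍₁₎ ∘ L ∘ S(h₍₂₎)` on linear maps. -/
def hact : H →ₐ[k] Module.End k (W →ₗ[k] X) :=
  (sandOp w x).comp ((Algebra.TensorProduct.map (AlgHom.id k H) D.S.toAlgHom).comp D.Δ)

lemma hact_eq (h : H) : hact D w x h = sand w x (D.antipode.lTensor H (D.Δ h)) := by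
  have : ∀ t : H ⊗[k] H, sandOp w x (Algebra.TensorProduct.map (AlgHom.id k H) D.S.toAlgHom t) =
      sand w x (D.antipode.lTensor H t) := by
    intro t
    induction t using ind₂ with
    | hadd s t hs ht => simp only [map_add, hs, ht]
    | h a b => rfl
  exact this _

/-- `a ⊗ b ⊗ c ↦ a ⊗ b β S(c)`. -/
abbrev cK : H ⊗[k] (H ⊗[k] H) →ₗ[k] H ⊗[k] H := (contrR D.antipode D.β).lTensor H

/-- `a ⊗ b ⊗ c ↦ a ⊗ S(b) α c`. -/
abbrev cM : H ⊗[k] (H ⊗[k] H) →ₗ[k] H ⊗[k] H := (contrL D.antipode D.α).lTensor H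

/-- `f ↦ (m ↦ (n ↦ f(φ⁻¹₍₁₎ ▷ m ⊗ (φ⁻¹₍₂₎ β S(φ⁻¹₍₃₎)) ▷ n)))`. -/
def curryLin (f : V ⊗[k] W →ₗ[k] X) : V →ₗ[k] W →ₗ[k] X :=
  TensorProduct.curry (f ∘ₗ tact v w (cK D ↑D.φ⁻¹))

/-- `g ↦ (m ⊗ n ↦ φ₍₁₎ ▷ (g(m)((S(φ₍₂₎) α φ₍₃₎) ▷ n)))`. -/
def uncurryLin (g : V →ₗ[k] W →ₗ[k] X) : V ⊗[k] W →ₗ[k] X :=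
  TensorProduct.lift (sand w x (cM D D.φ) ∘ₗ g)

lemma curry_add (f g : V ⊗[k] W →ₗ[k] X) :
    TensorProduct.curry (f + g) = TensorProduct.curry f + TensorProduct.curry g := rfl

lemma sand_curry (f : V ⊗[k] W →ₗ[k] X) (hf : ∀ h, f ∘ₗ dact D v w h = x h ∘ₗ f)
    (s : H ⊗[k] H) (t : H ⊗[k] (H ⊗[k] H)) (m : V) (n : W) :
    sand w x (D.antipode.lTensor H s) (TensorProduct.curry (f ∘ₗ tact v w (cK D t)) m) n =
      f (tact v w (cK D (D.Δid s * t)) (m ⊗ₜ n)) := by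
  induction s using ind₂ with
  | hadd s t hs ht => simp only [add_mul, map_add, LinearMap.add_apply, hs, ht]
  | h a b =>
    induction t using ind₃ with
    | hadd s t hs ht =>
      simp only [mul_add, map_add, LinearMap.add_apply, LinearMap.comp_add, curry_add]
        at hs ht ⊢
      rw [hs, ht]
    | h p q r =>
      have key : ∀ u : H ⊗[k] H, cK D (Algebra.TensorProduct.assoc k k k H H H (u ⊗ₜ b) *
          (p ⊗ₜ (q ⊗ₜ r))) = u * (p ⊗ₜ (q * D.β * D.antipode r * D.antipode b)) := by
        intro u
        induction u using ind₂ with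
        | hadd s t hs ht => simp only [TensorProduct.add_tmul, add_mul, map_add, hs, ht]
        | h c d =>
          rw [Algebra.TensorProduct.assoc_tmul, Algebra.TensorProduct.tmul_mul_tmul,
            Algebra.TensorProduct.tmul_mul_tmul, LinearMap.lTensor_tmul, contrR_tmul,
            D.antipode_mul, Algebra.TensorProduct.tmul_mul_tmul]
          simp only [mul_assoc]
      have key' : cK D (D.Δid (a ⊗ₜ b) * (p ⊗ₜ (q ⊗ₜ r))) =
          D.Δ a * (p ⊗ₜ (q * D.β * D.antipode r * D.antipode b)) := key (D.Δ a)
      rw [key', map_mul, Module.End.mul_apply]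
      refine Eq.trans ?_ (LinearMap.congr_fun (hf a) _).symm
      change x a (f (v p m ⊗ₜ w (q * D.β * D.antipode r) (w (D.antipode b) n))) =
        x a (f (v p m ⊗ₜ w (q * D.β * D.antipode r * D.antipode b) n))
      rw [map_mul w (q * D.β * D.antipode r)]
      rfl

lemma uncurry_act (g : V →ₗ[k] W →ₗ[k] X) (hg : ∀ h, g ∘ₗ v h = hact D w x h ∘ₗ g)
    (s : H ⊗[k] H) (t : H ⊗[k] (H ⊗[k] H)) (m : V) (n : W) :
    TensorProduct.lift (sand w x (cM D t) ∘ₗ g) (tact v w s (m ⊗ₜ n)) =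
      sand w x (cM D (t * D.Δid s)) (g m) n := by
  induction s using ind₂ with
  | hadd s t hs ht => simp only [mul_add, map_add, LinearMap.add_apply, hs, ht]
  | h a b =>
    induction t using ind₃ with
    | hadd s t hs ht =>
      simp only [tact_tmul, TensorProduct.lift.tmul, LinearMap.comp_apply, add_mul, map_add,
        LinearMap.add_apply] at hs ht ⊢
      rw [hs, ht]
    | h p q r =>
      have key : ∀ u : H ⊗[k] H, sand w x (cM D ((p ⊗ₜ (q ⊗ₜ r)) *
          Algebra.TensorProduct.assoc k k k H H H (u ⊗ₜ b))) (g m) n =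
          x p (sand w x (D.antipode.lTensor H u) (g m) (w (D.antipode q * D.α * r * b) n)) := by
        intro u
        induction u using ind₂ with
        | hadd s t hs ht =>
          simp only [TensorProduct.add_tmul, mul_add, map_add, LinearMap.add_apply, hs, ht]
        | h c d =>
          rw [Algebra.TensorProduct.assoc_tmul, Algebra.TensorProduct.tmul_mul_tmul,
            Algebra.TensorProduct.tmul_mul_tmul, LinearMap.lTensor_tmul, contrL_tmul,
            D.antipode_mul, LinearMap.lTensor_tmul, sand_tmul, sand_tmul, map_mul,
            Module.End.mul_apply, ← Module.End.mul_apply (w (D.antipode d)), ← map_mul w]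
          simp only [mul_assoc]
      have key' : sand w x (cM D ((p ⊗ₜ (q ⊗ₜ r)) * D.Δid (a ⊗ₜ b))) (g m) n =
          x p (sand w x (D.antipode.lTensor H (D.Δ a)) (g m)
            (w (D.antipode q * D.α * r * b) n)) := key (D.Δ a)
      rw [key', ← hact_eq]
      have := LinearMap.congr_fun (hg a) m
      simp only [LinearMap.comp_apply] at this
      rw [← this, map_mul w (D.antipode q * D.α * r)]
      rfl

lemma uncurry_curry_aux (f : V ⊗[k] W →ₗ[k] X) (hf : ∀ h, f ∘ₗ dact D v w h = x h ∘ₗ f)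
    (t s : H ⊗[k] (H ⊗[k] H)) (m : V) (n : W) :
    sand w x (cM D t) (TensorProduct.curry (f ∘ₗ tact v w (cK D s)) m) n =
      f (tact v w (cP D (D.Δidid t * i123 k H s)) (m ⊗ₜ n)) := by
  induction t using ind₃ with
  | hadd s t hs ht => simp only [t4_add_mul, map_add, LinearMap.add_apply, hs, ht]
  | h a b c =>
    induction s using ind₃ with
    | hadd s t hs ht =>
      simp only [t4_mul_add, map_add, LinearMap.add_apply, LinearMap.comp_add, curry_add]
        at hs ht ⊢
      rw [hs, ht]
    | h p q r =>
      have key : ∀ u : H ⊗[k] H, cP D (Algebra.TensorProduct.assoc k k k H H (H ⊗[k] H)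
          (u ⊗ₜ (b ⊗ₜ c)) * (p ⊗ₜ (q ⊗ₜ (r ⊗ₜ 1)))) =
          u * (p ⊗ₜ (q * D.β * D.antipode r * (D.antipode b * D.α * c))) := by
        intro u
        induction u using ind₂ with
        | hadd s t hs ht =>
          simp only [TensorProduct.add_tmul, add_mul, t4_add_mul, map_add, hs, ht]
        | h d e =>
          rw [Algebra.TensorProduct.assoc_tmul, Algebra.TensorProduct.tmul_mul_tmul,
            Algebra.TensorProduct.tmul_mul_tmul, Algebra.TensorProduct.tmul_mul_tmul,
            LinearMap.lTensor_tmul, contrRL_tmul,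
            D.antipode_mul, Algebra.TensorProduct.tmul_mul_tmul]
          simp only [mul_assoc, mul_one]
      have key' : cP D (D.Δidid (a ⊗ₜ (b ⊗ₜ c)) * i123 k H (p ⊗ₜ (q ⊗ₜ r))) =
          D.Δ a * (p ⊗ₜ (q * D.β * D.antipode r * (D.antipode b * D.α * c))) := key (D.Δ a)
      rw [key', map_mul, Module.End.mul_apply]
      refine Eq.trans ?_ (LinearMap.congr_fun (hf a) _).symm
      change x a (f (v p m ⊗ₜ w (q * D.β * D.antipode r) (w (D.antipode b * D.α * c) n))) =
        x a (f (v p m ⊗ₜ w (q * D.β * D.antipode r * (D.antipode b * D.α * c)) n))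
      rw [map_mul w (q * D.β * D.antipode r)]
      rfl

lemma curry_uncurry_aux (g : V →ₗ[k] W →ₗ[k] X) (hg : ∀ h, g ∘ₗ v h = hact D w x h ∘ₗ g)
    (t s : H ⊗[k] (H ⊗[k] H)) (m : V) (n : W) :
    TensorProduct.lift (sand w x (cM D t) ∘ₗ g) (tact v w (cK D s) (m ⊗ₜ n)) =
      sand w x (cQ D (i123 k H t * D.Δidid s)) (g m) n := by
  induction s using ind₃ with
  | hadd s t hs ht => simp only [t4_mul_add, map_add, LinearMap.add_apply, hs, ht]
  | h p q r =>
    induction t using ind₃ with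
    | hadd s t hs ht =>
      simp only [LinearMap.lTensor_tmul, tact_tmul, TensorProduct.lift.tmul, LinearMap.comp_apply,
        t4_add_mul, map_add, LinearMap.add_apply] at hs ht ⊢
      rw [hs, ht]
    | h a b c =>
      have key : ∀ u : H ⊗[k] H, sand w x (cQ D ((a ⊗ₜ (b ⊗ₜ (c ⊗ₜ 1))) *
          Algebra.TensorProduct.assoc k k k H H (H ⊗[k] H) (u ⊗ₜ (q ⊗ₜ r)))) (g m) n =
          x a (sand w x (D.antipode.lTensor H u) (g m)
            (w (D.antipode b * D.α * c * (q * D.β * D.antipode r)) n)) := by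
        intro u
        induction u using ind₂ with
        | hadd s t hs ht =>
          simp only [TensorProduct.add_tmul, t4_mul_add, map_add, LinearMap.add_apply, hs, ht]
        | h d e =>
          rw [Algebra.TensorProduct.assoc_tmul, Algebra.TensorProduct.tmul_mul_tmul,
            Algebra.TensorProduct.tmul_mul_tmul, Algebra.TensorProduct.tmul_mul_tmul,
            LinearMap.lTensor_tmul, contrLR_tmul,
            D.antipode_mul, LinearMap.lTensor_tmul, sand_tmul, sand_tmul, map_mul,
            Module.End.mul_apply, ← Module.End.mul_apply (w (D.antipode e)), ← map_mul w]
          simp only [mul_assoc, one_mul]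
      have key' : sand w x (cQ D (i123 k H (a ⊗ₜ (b ⊗ₜ c)) * D.Δidid (p ⊗ₜ (q ⊗ₜ r)))) (g m) n =
          x a (sand w x (D.antipode.lTensor H (D.Δ p)) (g m)
            (w (D.antipode b * D.α * c * (q * D.β * D.antipode r)) n)) := key (D.Δ p)
      rw [key', ← hact_eq]
      have := LinearMap.congr_fun (hg p) m
      simp only [LinearMap.comp_apply] at this
      rw [← this, map_mul w (D.antipode b * D.α * c)]
      rfl

variable [D.IsQuasitriangular]

lemma cK_mul_idΔ (s : H ⊗[k] H) (t : H ⊗[k] (H ⊗[k] H)) :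
    cK D (t * D.idΔ s) = cK D t * (D.idε s ⊗ₜ 1) := by
  induction s using ind₂ with
  | hadd s t hs ht => simp only [mul_add, TensorProduct.add_tmul, map_add, hs, ht]
  | h a b =>
    induction t with
    | zero => simp
    | add s t hs ht => simp only [add_mul, map_add, hs, ht]
    | tmul c t =>
      change cK D ((c ⊗ₜ t) * (a ⊗ₜ D.Δ b)) = (c ⊗ₜ contrR _ _ t) * ((D.ε b • a) ⊗ₜ 1)
      rw [Algebra.TensorProduct.tmul_mul_tmul, LinearMap.lTensor_tmul, contrR_mul_Δ,
        Algebra.TensorProduct.tmul_mul_tmul, mul_one, mul_smul_comm, TensorProduct.tmul_smul,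
        TensorProduct.smul_tmul']

lemma cM_idΔ_mul (s : H ⊗[k] H) (t : H ⊗[k] (H ⊗[k] H)) :
    cM D (D.idΔ s * t) = (D.idε s ⊗ₜ 1) * cM D t := by
  induction s using ind₂ with
  | hadd s t hs ht => simp only [add_mul, TensorProduct.add_tmul, map_add, hs, ht]
  | h a b =>
    induction t with
    | zero => simp
    | add s t hs ht => simp only [mul_add, map_add, hs, ht]
    | tmul c t =>
      change cM D ((a ⊗ₜ D.Δ b) * (c ⊗ₜ t)) = ((D.ε b • a) ⊗ₜ 1) * (c ⊗ₜ contrL _ _ t)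
      rw [Algebra.TensorProduct.tmul_mul_tmul, LinearMap.lTensor_tmul, contrL_Δ_mul,
        Algebra.TensorProduct.tmul_mul_tmul, one_mul, smul_mul_assoc, TensorProduct.tmul_smul,
        TensorProduct.smul_tmul']

lemma curryLin_equivariant (f : V ⊗[k] W →ₗ[k] X) (hf : ∀ h, f ∘ₗ dact D v w h = x h ∘ₗ f)
    (h : H) : curryLin D v w f ∘ₗ v h = hact D w x h ∘ₗ curryLin D v w f := by
  ext m n
  rw [hact_eq]
  refine Eq.trans ?_ (sand_curry D v w x f hf (D.Δ h) ↑D.φ⁻¹ m n).symm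
  have h1 : D.Δid (D.Δ h) * ↑D.φ⁻¹ = ↑D.φ⁻¹ * D.idΔ (D.Δ h) := by
    rw [Units.mul_inv_eq_iff_eq_mul, mul_assoc, Data.IsQuasitriangular.coassoc, ← mul_assoc,
      Units.inv_mul, one_mul]
  rw [h1, cK_mul_idΔ, Data.IsQuasitriangular.counit_right, map_mul, Module.End.mul_apply,
    tact_tmul, map_one]
  rfl

lemma sand_mul_left (a : H) (t : H ⊗[k] H) (L : W →ₗ[k] X) (n : W) :
    sand w x ((a ⊗ₜ 1) * t) L n = x a (sand w x t L n) := by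
  induction t using ind₂ with
  | hadd s t hs ht => simp only [mul_add, map_add, LinearMap.add_apply, hs, ht]
  | h b c => simp [Algebra.TensorProduct.tmul_mul_tmul]

lemma uncurryLin_equivariant (g : V →ₗ[k] W →ₗ[k] X) (hg : ∀ h, g ∘ₗ v h = hact D w x h ∘ₗ g)
    (h : H) : uncurryLin D w x g ∘ₗ dact D v w h = x h ∘ₗ uncurryLin D w x g := by
  apply TensorProduct.ext'
  intro m n
  refine (uncurry_act D v w x g hg (D.Δ h) D.φ m n).trans ?_
  rw [← Data.IsQuasitriangular.coassoc, cM_idΔ_mul, Data.IsQuasitriangular.counit_right,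
    sand_mul_left]
  rfl

lemma uncurryLin_curryLin (f : V ⊗[k] W →ₗ[k] X) (hf : ∀ h, f ∘ₗ dact D v w h = x h ∘ₗ f) :
    uncurryLin D w x (curryLin D v w f) = f := by
  apply TensorProduct.ext'
  intro m n
  refine (uncurry_curry_aux D v w x f hf D.φ ↑D.φ⁻¹ m n).trans ?_
  rw [cP_eq_one, map_one]
  rfl

lemma curryLin_uncurryLin (g : V →ₗ[k] W →ₗ[k] X) (hg : ∀ h, g ∘ₗ v h = hact D w x h ∘ₗ g) :
    curryLin D v w (uncurryLin D w x g) = g := by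
  ext m n
  refine (curry_uncurry_aux D v w x g hg D.φ ↑D.φ⁻¹ m n).trans ?_
  rw [cQ_eq_one, Algebra.TensorProduct.one_def, sand_tmul, map_one, map_one]
  rfl

end InternalHom

/-- A (right) closed structure on a monoidal category: an internal hom functor
`hom : Cᵒᵖ × C ⥤ C` together with bijections `Hom(V ⊗ W, X) ≅ Hom(V, hom(W, X))` that are natural
in `V`, `W` and `X`. -/
class RightClosed (C : Type*) [Category C] [MonoidalCategory C] where
  ihom : Cᵒᵖ ⥤ C ⥤ C
  curry {V W X : C} : (V ⊗ W ⟶ X) ≃ (V ⟶ (ihom.obj (Opposite.op W)).obj X)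
  curry_left {V V' W X : C} (f : V' ⟶ V) (g : V ⊗ W ⟶ X) :
    curry (f ▷ W ≫ g) = f ≫ curry g
  curry_mid {V W W' X : C} (f : W' ⟶ W) (g : V ⊗ W ⟶ X) :
    curry (V ◁ f ≫ g) = curry g ≫ (ihom.map f.op).app X
  curry_right {V W X X' : C} (g : V ⊗ W ⟶ X) (f : X ⟶ X') :
    curry (g ≫ f) = curry g ≫ (ihom.obj (Opposite.op W)).map f

namespace HMod

variable {k H : Type u} [CommRing k] [Ring H] [Algebra k H] {D : Data k H}

/-- The internal hom `hom(W, X) = Hom_k(W, X)`, with `h ▷ L = h₍₁₎ ∘ L ∘ S(h₍₂₎)`. -/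
def hom (W X : HMod D) : HMod D where
  carrier := W.carrier →ₗ[k] X.carrier
  act := hact D W.act X.act

lemma sandOp_map {V W X Y : HMod D} (f : V ⟶ W) (g : X ⟶ Y) (t : H ⊗[k] Hᵐᵒᵖ)
    (L : W.carrier →ₗ[k] X.carrier) :
    Hom.lin g ∘ₗ sandOp W.act X.act t L ∘ₗ Hom.lin f =
      sandOp V.act Y.act t (Hom.lin g ∘ₗ L ∘ₗ Hom.lin f) := by
  induction t with
  | zero => simp
  | add s t hs ht =>
    simp only [map_add, LinearMap.add_apply, LinearMap.add_comp, LinearMap.comp_add, hs, ht]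
  | tmul a b =>
    ext n
    change Hom.lin g (X.act a (L (W.act b.unop (Hom.lin f n)))) =
      Y.act a (Hom.lin g (L (Hom.lin f (V.act b.unop n))))
    rw [Hom.map_act, Hom.map_act]

/-- `L ↦ g ∘ L ∘ f`. -/
def homMap {V W X Y : HMod D} (f : V ⟶ W) (g : X ⟶ Y) : hom W X ⟶ hom V Y :=
  ⟨LinearMap.compRight k (Hom.lin g) ∘ₗ LinearMap.lcomp k X.carrier (Hom.lin f),
    fun _ => LinearMap.ext fun L => sandOp_map f g _ L⟩

lemma homMap_apply {V W X Y : HMod D} (f : V ⟶ W) (g : X ⟶ Y) (L : W.carrier →ₗ[k] X.carrier) :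
    Hom.lin (homMap f g) L = Hom.lin g ∘ₗ L ∘ₗ Hom.lin f := rfl

/-- The internal hom functor. -/
def ihomFunctor (D : Data k H) : (HMod D)ᵒᵖ ⥤ HMod D ⥤ HMod D where
  obj W :=
    { obj X := hom W.unop X
      map g := homMap (𝟙 W.unop) g }
  map f := { app X := homMap f.unop (𝟙 X) }

variable [D.IsQuasitriangular]

instance : RightClosed (HMod D) where
  ihom := ihomFunctor D
  curry {V W X} :=
    { toFun f := ⟨curryLin D V.act W.act (Hom.lin f),
        curryLin_equivariant D V.act W.act X.act (Hom.lin f) (Hom.equivariant f)⟩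
      invFun g := ⟨uncurryLin D W.act X.act (Hom.lin g),
        uncurryLin_equivariant D V.act W.act X.act (Hom.lin g) (Hom.equivariant g)⟩
      left_inv f := hom_ext
        (uncurryLin_curryLin D V.act W.act X.act (Hom.lin f) (Hom.equivariant f))
      right_inv g := hom_ext
        (curryLin_uncurryLin D V.act W.act X.act (Hom.lin g) (Hom.equivariant g)) }
  curry_left {V V' W X} f g := by
    apply hom_ext
    refine LinearMap.ext fun m => LinearMap.ext fun n => ?_
    have := tact_map V'.act W.act V.act W.act (Hom.lin f) LinearMap.id (Hom.equivariant f)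
      (fun _ => rfl) (cK D ↑D.φ⁻¹)
    exact congrArg (Hom.lin g) (LinearMap.congr_fun this (m ⊗ₜ n))
  curry_mid {V W W' X} f g := by
    apply hom_ext
    refine LinearMap.ext fun m => LinearMap.ext fun n => ?_
    have := tact_map V.act W'.act V.act W.act LinearMap.id (Hom.lin f) (fun _ => rfl)
      (Hom.equivariant f) (cK D ↑D.φ⁻¹)
    exact congrArg (Hom.lin g) (LinearMap.congr_fun this (m ⊗ₜ n))
  curry_right g f := rfl

end HMod

end

end QHopf

namespace QHopf

noncomputable section

namespace HMod

variable {k H : Type u} [CommRing k] [Ring H] [Algebra k H] {D : Data k H}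

/-! ### Equalizers and coequalizers of modules -/

section Limits

variable {V W : HMod D} (f g : V ⟶ W)

/-- The cokernel of `f - g`. -/
def coeqObj : HMod D where
  carrier := W.carrier ⧸ LinearMap.range (Hom.lin f - Hom.lin g)
  act :=
    { toFun h := Submodule.mapQ _ _ (W.act h) (by
        rintro _ ⟨v, rfl⟩
        refine ⟨V.act h v, ?_⟩
        simp only [LinearMap.sub_apply, Hom.map_act, map_sub])
      map_one' := by ext; simp
      map_mul' a b := by ext; simp
      map_zero' := by ext; simp
      map_add' a b := by ext; simp
      commutes' r := by
        apply LinearMap.ext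
        intro q
        obtain ⟨q, rfl⟩ := Submodule.Quotient.mk_surjective _ q
        simp [Algebra.algebraMap_eq_smul_one] }

/-- The projection onto the cokernel of `f - g`. -/
def coeqπ : W ⟶ coeqObj f g := ⟨Submodule.mkQ _, fun _ => rfl⟩

/-- The kernel of `f - g`. -/
def eqObj : HMod D where
  carrier := LinearMap.ker (Hom.lin f - Hom.lin g)
  act :=
    { toFun h := (V.act h).restrict (fun v hv => by
        simp only [LinearMap.mem_ker, LinearMap.sub_apply, Hom.map_act] at hv ⊢
        rw [← map_sub, hv, map_zero])
      map_one' := by ext; simp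
      map_mul' a b := by ext; simp
      map_zero' := by ext; simp
      map_add' a b := by ext; simp
      commutes' r := by ext; simp [Algebra.algebraMap_eq_smul_one] }

/-- The inclusion of the kernel of `f - g`. -/
def eqι : eqObj f g ⟶ V := ⟨Submodule.subtype _, fun _ => rfl⟩

/-- The cokernel of `f - g` is a coequalizer of `f` and `g`. -/
def coeqIsColimit : IsColimit (Cofork.ofπ (f := f) (g := g) (coeqπ f g) (by
    apply hom_ext
    ext v
    exact (Submodule.Quotient.eq _).mpr ⟨v, rfl⟩)) :=
  Cofork.IsColimit.mk' _ fun s => ⟨⟨Submodule.liftQ _ (Hom.lin s.π) (by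
      rintro _ ⟨v, rfl⟩
      have := LinearMap.congr_fun (congrArg Hom.lin s.condition) v
      simp only [comp_lin, LinearMap.comp_apply] at this
      simp [this]), fun h => by
        apply LinearMap.ext
        intro q
        obtain ⟨q, rfl⟩ := Submodule.Quotient.mk_surjective _ q
        exact Hom.map_act s.π h q⟩, by apply hom_ext; ext v; rfl, fun {m} hm => by
          apply hom_ext
          apply LinearMap.ext
          intro q
          obtain ⟨q, rfl⟩ := Submodule.Quotient.mk_surjective _ q
          exact LinearMap.congr_fun (congrArg Hom.lin hm) q⟩

/-- The kernel of `f - g` is an equalizer of `f` and `g`. -/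
def eqIsLimit : IsLimit (Fork.ofι (f := f) (g := g) (eqι f g) (by
    apply hom_ext
    ext v
    have h := v.2
    simp only [LinearMap.mem_ker, LinearMap.sub_apply] at h
    exact sub_eq_zero.mp h)) :=
  Fork.IsLimit.mk' _ fun s => ⟨⟨(Hom.lin s.ι).codRestrict _ (fun v => by
      have := LinearMap.congr_fun (congrArg Hom.lin s.condition) v
      simp only [comp_lin, LinearMap.comp_apply] at this
      simp [this]), fun h => by
        apply LinearMap.ext
        intro v
        exact Subtype.ext (Hom.map_act s.ι h v)⟩, by apply hom_ext; ext v; rfl, fun {m} hm => by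
          apply hom_ext
          apply LinearMap.ext
          intro q
          apply Subtype.ext
          exact LinearMap.congr_fun (congrArg Hom.lin hm) q⟩

instance : HasCoequalizers (HMod D) :=
  have (V W : HMod D) (f g : V ⟶ W) : HasColimit (parallelPair f g) := ⟨⟨⟨_, coeqIsColimit f g⟩⟩⟩
  hasCoequalizers_of_hasColimit_parallelPair _

instance : HasEqualizers (HMod D) :=
  have (V W : HMod D) (f g : V ⟶ W) : HasLimit (parallelPair f g) := ⟨⟨⟨_, eqIsLimit f g⟩⟩⟩
  hasEqualizers_of_hasLimit_parallelPair _

end Limits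

/-! ### The braiding -/

lemma comm_tact {V W : Type u} [AddCommGroup V] [Module k V] [AddCommGroup W] [Module k W]
    (v : H →ₐ[k] Module.End k V) (w : H →ₐ[k] Module.End k W) (t : H ⊗[k] H) :
    (TensorProduct.comm k V W).toLinearMap ∘ₗ tact v w t =
      tact w v (Algebra.TensorProduct.comm k H H t) ∘ₗ
        (TensorProduct.comm k V W).toLinearMap := by
  induction t using ind₂ with
  | hadd s t hs ht => simp only [map_add, LinearMap.comp_add, LinearMap.add_comp, hs, ht]
  | h a b => apply TensorProduct.ext'; intros; rfl

variable [D.IsQuasitriangular]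

/-- The braiding `τ : v ⊗ w ↦ R₍₂₎ ▷ w ⊗ R₍₁₎ ▷ v`. -/
def τ (V W : HMod D) : V ⊗ W ≅ W ⊗ V :=
  isoMk (V := tens V W) (W := tens W V)
    ((LinearMap.GeneralLinearGroup.generalLinearEquiv k _
      (Units.map (tact V.act W.act).toMonoidHom D.R)).trans
        (TensorProduct.comm k V.carrier W.carrier)) (fun h => by
    change ((TensorProduct.comm k _ _).toLinearMap ∘ₗ tact V.act W.act D.R) ∘ₗ
      tact V.act W.act (D.Δ h) = tact W.act V.act (D.Δ h) ∘ₗ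
        ((TensorProduct.comm k _ _).toLinearMap ∘ₗ tact V.act W.act D.R)
    have h1 : tact W.act V.act (D.Δ h) ∘ₗ (TensorProduct.comm k _ _).toLinearMap =
        (TensorProduct.comm k _ _).toLinearMap ∘ₗ
          tact V.act W.act (Algebra.TensorProduct.comm k H H (D.Δ h)) := by
      have h2 : Algebra.TensorProduct.comm k H H (Algebra.TensorProduct.comm k H H (D.Δ h)) =
          D.Δ h := (Algebra.TensorProduct.comm k H H).symm_apply_apply _
      rw [comm_tact, h2]
    rw [← LinearMap.comp_assoc, h1, LinearMap.comp_assoc, LinearMap.comp_assoc,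
      ← Module.End.mul_eq_comp, ← Module.End.mul_eq_comp, ← map_mul, ← map_mul,
      Data.IsQuasitriangular.R_comm])

lemma τ_hom_lin (V W : HMod D) : Hom.lin (τ V W).hom =
    (TensorProduct.comm k V.carrier W.carrier).toLinearMap ∘ₗ tact V.act W.act D.R := rfl

lemma τ_naturality {V V' W W' : HMod D} (f : V ⟶ V') (g : W ⟶ W') :
    (f ⊗ₘ g) ≫ (τ V' W').hom = (τ V W).hom ≫ (g ⊗ₘ f) := by
  apply hom_ext
  have h := tact_map V.act W.act V'.act W'.act (Hom.lin f) (Hom.lin g) (Hom.equivariant f)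
    (Hom.equivariant g) (D.R : H ⊗[k] H)
  apply LinearMap.ext
  intro x
  have hx := LinearMap.congr_fun h x
  refine (congrArg (TensorProduct.comm k V'.carrier W'.carrier) hx.symm).trans ?_
  have hc : (TensorProduct.comm k V'.carrier W'.carrier).toLinearMap ∘ₗ
      TensorProduct.map (Hom.lin f) (Hom.lin g) = TensorProduct.map (Hom.lin g) (Hom.lin f) ∘ₗ
        (TensorProduct.comm k V.carrier W.carrier).toLinearMap := by
    apply TensorProduct.ext'
    intros
    rfl
  exact LinearMap.congr_fun hc (tact V.act W.act (D.R : H ⊗[k] H) x)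

/-! ### Tensoring preserves colimits -/

/-- The adjunction `- ⊗ W ⊣ hom(W, -)`. -/
def tensorRightAdj (W : HMod D) :
    tensorRight W ⊣ (RightClosed.ihom (C := HMod D)).obj (Opposite.op W) :=
  Adjunction.mkOfHomEquiv
    { homEquiv _ _ := RightClosed.curry
      homEquiv_naturality_left_symm f g := by
        rw [Equiv.symm_apply_eq]
        exact ((RightClosed.curry_left f _).trans (by rw [Equiv.apply_symm_apply])).symm
      homEquiv_naturality_right f g := RightClosed.curry_right f g }

instance (W : HMod D) : PreservesColimitsOfSize.{0, 0} (tensorRight W) :=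
  (tensorRightAdj W).leftAdjoint_preservesColimits

instance (W : HMod D) : PreservesColimitsOfSize.{0, 0} (tensorLeft W) :=
  preservesColimits_of_natIso (NatIso.ofComponents (fun V => τ V W) (fun f => by
    have h := τ_naturality f (𝟙 W)
    rw [tensorHom_id, id_tensorHom] at h
    exact h) : tensorRight W ≅ tensorLeft W)

end HMod

end

end QHopf

namespace QHopf

noncomputable section

/-! ### Internal homomorphisms of bimodules -/

namespace RightClosed

variable {C : Type*} [Category C] [MonoidalCategory C] [RightClosed C]

/-- The internal hom object `hom(V, W)`. -/
abbrev hom (V W : C) : C := (ihom.obj (Opposite.op V)).obj W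

/-- The evaluation morphism. -/
def ev (V W : C) : hom V W ⊗ V ⟶ W := curry.symm (𝟙 _)

lemma curry_whisker_ev {Z V W : C} (f : Z ⟶ hom V W) : curry (f ▷ V ≫ ev V W) = f := by
  rw [curry_left, ev, Equiv.apply_symm_apply, Category.comp_id]

@[simp] lemma curry_ev {Z V W : C} (g : Z ⊗ V ⟶ W) : curry g ▷ V ≫ ev V W = g := by
  apply curry.injective
  rw [curry_whisker_ev]

@[simp] lemma curry_ev_assoc {Z V W X : C} (g : Z ⊗ V ⟶ W) (h : W ⟶ X) :
    curry g ▷ V ≫ ev V W ≫ h = g ≫ h := by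
  rw [← Category.assoc, curry_ev]

lemma curry_symm_eq {Z V W : C} (f : Z ⟶ hom V W) : curry.symm f = f ▷ V ≫ ev V W := by
  rw [Equiv.symm_apply_eq, curry_whisker_ev]

lemma hom_ext {Z V W : C} {f g : Z ⟶ hom V W} (h : f ▷ V ≫ ev V W = g ▷ V ≫ ev V W) : f = g := by
  rw [← curry_whisker_ev f, h, curry_whisker_ev]

/-- `hom(f, g)`. -/
def homMap {V V' W W' : C} (f : V' ⟶ V) (g : W ⟶ W') : hom V W ⟶ hom V' W' :=
  (ihom.map f.op).app W ≫ (ihom.obj (Opposite.op V')).map g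

lemma homMap_ev {V V' W W' : C} (f : V' ⟶ V) (g : W ⟶ W') :
    homMap f g ▷ V' ≫ ev V' W' = hom V W ◁ f ≫ ev V W ≫ g := by
  apply curry.injective
  rw [curry_whisker_ev, curry_mid, curry_right, ev, Equiv.apply_symm_apply, Category.id_comp,
    homMap]
  exact ((ihom.map f.op).naturality g).symm

/-- Composition of internal homomorphisms. -/
def comp (V W X : C) : hom W X ⊗ hom V W ⟶ hom V X :=
  curry ((α_ _ _ _).hom ≫ hom W X ◁ ev V W ≫ ev W X)

end RightClosed

section HomBimod

open RightClosed MonObj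

variable {C : Type*} [Category C] [MonoidalCategory C] [RightClosed C] {A : Mon C}

/-- The morphism `A ⟶ hom(V, V)` adjoint to the left action on `V`. -/
def lhat (V : Bimod A A) : A.X ⟶ hom V.X V.X := curry V.actLeft

/-- The left `A`-action on `hom(V, W)`: composition with the left action on `W`. -/
def homActLeft (V W : Bimod A A) : A.X ⊗ hom V.X W.X ⟶ hom V.X W.X :=
  lhat W ▷ _ ≫ comp V.X W.X W.X

/-- The right `A`-action on `hom(V, W)`: composition with the left action on `V`. -/
def homActRight (V W : Bimod A A) : hom V.X W.X ⊗ A.X ⟶ hom V.X W.X :=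
  _ ◁ lhat V ≫ comp V.X V.X W.X

lemma homActLeft_ev (V W : Bimod A A) : homActLeft V W ▷ V.X ≫ ev V.X W.X =
    (α_ _ _ _).hom ≫ A.X ◁ ev V.X W.X ≫ W.actLeft := by
  rw [homActLeft, comp_whiskerRight, Category.assoc, comp, curry_ev]
  simp only [associator_naturality_left_assoc]
  rw [← whisker_exchange_assoc, lhat, curry_ev]

lemma homActRight_ev (V W : Bimod A A) : homActRight V W ▷ V.X ≫ ev V.X W.X =
    (α_ _ _ _).hom ≫ hom V.X W.X ◁ V.actLeft ≫ ev V.X W.X := by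
  rw [homActRight, comp_whiskerRight, Category.assoc, comp, curry_ev]
  simp only [associator_naturality_middle_assoc]
  rw [← whiskerLeft_comp_assoc, lhat, curry_ev]

/-- The internal hom of the underlying objects of two bimodules, as a bimodule. -/
def homBimod (V W : Bimod A A) : Bimod A A where
  X := hom V.X W.X
  actLeft := homActLeft V W
  actRight := homActRight V W
  one_actLeft := by
    apply RightClosed.hom_ext
    rw [comp_whiskerRight, Category.assoc, homActLeft_ev, associator_naturality_left_assoc,
      ← whisker_exchange_assoc, Bimod.one_actLeft]
    simp
  left_assoc := by
    apply RightClosed.hom_ext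
    simp only [comp_whiskerRight, Category.assoc, homActLeft_ev, associator_naturality_left_assoc,
      ← whisker_exchange_assoc, Bimod.left_assoc]
    rw [whisker_assoc, Category.assoc, Category.assoc, Iso.inv_hom_id_assoc, ← whiskerLeft_comp_assoc,
      homActLeft_ev]
    simp
  actRight_one := by
    apply RightClosed.hom_ext
    rw [comp_whiskerRight, Category.assoc, homActRight_ev, associator_naturality_middle_assoc,
      ← whiskerLeft_comp_assoc, Bimod.one_actLeft]
    simp
  right_assoc := by
    apply RightClosed.hom_ext
    simp only [comp_whiskerRight, Category.assoc, homActRight_ev]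
    rw [associator_naturality_middle_assoc, ← whiskerLeft_comp_assoc, Bimod.left_assoc,
      associator_naturality_left_assoc, ← whisker_exchange_assoc, homActRight_ev]
    simp
  middle_assoc := by
    apply RightClosed.hom_ext
    simp only [comp_whiskerRight, Category.assoc, homActRight_ev, homActLeft_ev]
    rw [associator_naturality_left_assoc, ← whisker_exchange_assoc, homActLeft_ev]
    rw [whisker_assoc, Category.assoc, Category.assoc, Iso.inv_hom_id_assoc, ← whiskerLeft_comp_assoc,
      homActRight_ev]
    simp

/-- `hom(V, W) ⟶ hom(V ⊗ A, W)`, adjoint to `L ⊗ (v ⊗ a) ↦ L(v a)`. -/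
def evr (V W : Bimod A A) : hom V.X W.X ⟶ hom (V.X ⊗ A.X) W.X :=
  curry (hom V.X W.X ◁ V.actRight ≫ ev V.X W.X)

/-- `hom(V, W) ⟶ hom(V ⊗ A, W)`, adjoint to `L ⊗ (v ⊗ a) ↦ L(v) a`. -/
def rev (V W : Bimod A A) : hom V.X W.X ⟶ hom (V.X ⊗ A.X) W.X :=
  curry ((α_ _ _ _).inv ≫ ev V.X W.X ▷ A.X ≫ W.actRight)

/-- A morphism `g : Z ⟶ hom(V, W)` equalizes `evr` and `rev` if and only if its adjoint is right
`A`-linear in the appropriate sense. -/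
lemma equalizes_iff {V W : Bimod A A} {Z : C} (g : Z ⟶ hom V.X W.X) :
    g ≫ evr V W = g ≫ rev V W ↔ Z ◁ V.actRight ≫ g ▷ V.X ≫ ev V.X W.X =
      (α_ _ _ _).inv ≫ (g ▷ V.X ≫ ev V.X W.X) ▷ A.X ≫ W.actRight := by
  have h1 : (g ≫ evr V W) ▷ (V.X ⊗ A.X) ≫ ev _ _ = Z ◁ V.actRight ≫ g ▷ V.X ≫ ev V.X W.X := by
    rw [comp_whiskerRight, Category.assoc, evr, curry_ev, whisker_exchange_assoc]
  have h2 : (g ≫ rev V W) ▷ (V.X ⊗ A.X) ≫ ev _ _ =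
      (α_ _ _ _).inv ≫ (g ▷ V.X ≫ ev V.X W.X) ▷ A.X ≫ W.actRight := by
    rw [comp_whiskerRight, Category.assoc, rev, curry_ev]
    simp
  rw [← h1, ← h2]
  exact ⟨fun h => by rw [h], RightClosed.hom_ext⟩

lemma homActLeft_homMap {V V' W W' : Bimod A A} (f : V' ⟶ V) (g : W ⟶ W') :
    homActLeft V W ≫ RightClosed.homMap f.hom g.hom =
      A.X ◁ RightClosed.homMap f.hom g.hom ≫ homActLeft V' W' := by
  apply RightClosed.hom_ext
  rw [comp_whiskerRight, comp_whiskerRight, Category.assoc, Category.assoc, homActLeft_ev,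
    homMap_ev, ← whisker_exchange_assoc]
  have h := homActLeft_ev V W
  rw [← Category.assoc (homActLeft V W ▷ V.X), h]
  simp only [Category.assoc, whisker_assoc, Iso.inv_hom_id_assoc, tensor_whiskerLeft]
  rw [← whiskerLeft_comp_assoc, ← whiskerLeft_comp_assoc, homMap_ev, Bimod.Hom.left_act_hom]
  simp

lemma homActRight_homMap {V V' W W' : Bimod A A} (f : V' ⟶ V) (g : W ⟶ W') :
    homActRight V W ≫ RightClosed.homMap f.hom g.hom =
      RightClosed.homMap f.hom g.hom ▷ A.X ≫ homActRight V' W' := by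
  apply RightClosed.hom_ext
  rw [comp_whiskerRight, comp_whiskerRight, Category.assoc, Category.assoc, homActRight_ev,
    homMap_ev, ← whisker_exchange_assoc]
  have h := homActRight_ev V W
  rw [← Category.assoc (homActRight V W ▷ V.X), h]
  simp only [Category.assoc, tensor_whiskerLeft, associator_naturality_left_assoc,
    Iso.inv_hom_id_assoc]
  rw [← whisker_exchange_assoc, homMap_ev, ← whiskerLeft_comp_assoc, ← whiskerLeft_comp_assoc,
    Bimod.Hom.left_act_hom]

lemma homMap_id (V W : C) : RightClosed.homMap (𝟙 V) (𝟙 W) = 𝟙 _ := by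
  apply RightClosed.hom_ext
  rw [homMap_ev]
  simp

lemma homMap_comp {V V' V'' W W' W'' : C} (f : V' ⟶ V) (f' : V'' ⟶ V') (g : W ⟶ W')
    (g' : W' ⟶ W'') : RightClosed.homMap (f' ≫ f) (g ≫ g') =
      RightClosed.homMap f g ≫ RightClosed.homMap f' g' := by
  apply RightClosed.hom_ext
  rw [comp_whiskerRight, Category.assoc, homMap_ev, homMap_ev, ← whisker_exchange_assoc,
    ← Category.assoc (RightClosed.homMap f g ▷ V'), homMap_ev]
  simp

variable [HasEqualizers C]

/-- The object `hom_A(V, W)` of internal homomorphisms that are right `A`-linear. -/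
def homAX (V W : Bimod A A) : C := equalizer (evr V W) (rev V W)

/-- The inclusion `hom_A(V, W) ⟶ hom(V, W)`. -/
def homAι (V W : Bimod A A) : homAX V W ⟶ hom V.X W.X := equalizer.ι _ _

instance (V W : Bimod A A) : Mono (homAι V W) := equalizer.ι_mono

/-- Lift a morphism to `hom_A(V, W)`. -/
def homALift {V W : Bimod A A} {Z : C} (g : Z ⟶ hom V.X W.X)
    (hg : Z ◁ V.actRight ≫ g ▷ V.X ≫ ev V.X W.X =
      (α_ _ _ _).inv ≫ (g ▷ V.X ≫ ev V.X W.X) ▷ A.X ≫ W.actRight) : Z ⟶ homAX V W :=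
  equalizer.lift g ((equalizes_iff g).mpr hg)

@[simp] lemma homALift_ι {V W : Bimod A A} {Z : C} (g : Z ⟶ hom V.X W.X)
    (hg : Z ◁ V.actRight ≫ g ▷ V.X ≫ ev V.X W.X =
      (α_ _ _ _).inv ≫ (g ▷ V.X ≫ ev V.X W.X) ▷ A.X ≫ W.actRight) :
    homALift g hg ≫ homAι V W = g := equalizer.lift_ι _ _

@[simp] lemma homALift_ι_assoc {V W : Bimod A A} {Z Z' : C} (g : Z ⟶ hom V.X W.X)
    (hg : Z ◁ V.actRight ≫ g ▷ V.X ≫ ev V.X W.X =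
      (α_ _ _ _).inv ≫ (g ▷ V.X ≫ ev V.X W.X) ▷ A.X ≫ W.actRight) (h : _ ⟶ Z') :
    homALift g hg ≫ homAι V W ≫ h = g ≫ h := by
  rw [← Category.assoc, homALift_ι]

lemma homAι_condition (V W : Bimod A A) :
    homAX V W ◁ V.actRight ≫ homAι V W ▷ V.X ≫ ev V.X W.X =
      (α_ _ _ _).inv ≫ (homAι V W ▷ V.X ≫ ev V.X W.X) ▷ A.X ≫ W.actRight :=
  (equalizes_iff _).mp (equalizer.condition _ _)

/-- The left `A`-action on `hom_A(V, W)`, restricted from `hom(V, W)`. -/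
def homAActLeft (V W : Bimod A A) : A.X ⊗ homAX V W ⟶ homAX V W :=
  homALift (A.X ◁ homAι V W ≫ homActLeft V W) (by
    have e : (A.X ◁ homAι V W ≫ homActLeft V W) ▷ V.X ≫ ev V.X W.X =
        (α_ _ _ _).hom ≫ A.X ◁ (homAι V W ▷ V.X ≫ ev V.X W.X) ≫ W.actLeft := by
      rw [comp_whiskerRight, Category.assoc, homActLeft_ev]
      simp
    rw [e, ← Category.assoc, tensor_whiskerLeft]
    simp only [Category.assoc, Iso.inv_hom_id_assoc]
    rw [← whiskerLeft_comp_assoc, homAι_condition]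
    simp)

/-- The right `A`-action on `hom_A(V, W)`, restricted from `hom(V, W)`. -/
def homAActRight (V W : Bimod A A) : homAX V W ⊗ A.X ⟶ homAX V W :=
  homALift (homAι V W ▷ A.X ≫ homActRight V W) (by
    have e : (homAι V W ▷ A.X ≫ homActRight V W) ▷ V.X ≫ ev V.X W.X =
        (α_ _ _ _).hom ≫ homAX V W ◁ V.actLeft ≫ homAι V W ▷ V.X ≫ ev V.X W.X := by
      rw [comp_whiskerRight, Category.assoc, homActRight_ev, whisker_exchange_assoc]
      simp
    rw [e, tensor_whiskerLeft]
    simp only [Category.assoc, Iso.inv_hom_id_assoc]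
    have hV : A.X ◁ V.actRight ≫ V.actLeft = (α_ _ _ _).inv ≫ V.actLeft ▷ A.X ≫ V.actRight := by
      rw [V.middle_assoc, Iso.inv_hom_id_assoc]
    rw [← whiskerLeft_comp_assoc, hV]
    simp only [whiskerLeft_comp, Category.assoc]
    rw [homAι_condition]
    simp)

lemma homAActLeft_ι (V W : Bimod A A) :
    homAActLeft V W ≫ homAι V W = A.X ◁ homAι V W ≫ homActLeft V W := homALift_ι _ _

lemma homAActRight_ι (V W : Bimod A A) :
    homAActRight V W ≫ homAι V W = homAι V W ▷ A.X ≫ homActRight V W := homALift_ι _ _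

/-- The bimodule `hom_A(V, W)`. -/
def homA (V W : Bimod A A) : Bimod A A where
  X := homAX V W
  actLeft := homAActLeft V W
  actRight := homAActRight V W
  one_actLeft := by
    rw [← cancel_mono (homAι V W), Category.assoc, homAActLeft_ι, ← whisker_exchange_assoc]
    have := (homBimod V W).one_actLeft
    dsimp only [homBimod] at this
    rw [this]
    simp
  left_assoc := by
    rw [← cancel_mono (homAι V W)]
    simp only [Category.assoc, homAActLeft_ι]
    rw [← whisker_exchange_assoc, ← whiskerLeft_comp_assoc, homAActLeft_ι]
    have := (homBimod V W).left_assoc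
    dsimp only [homBimod] at this
    rw [this]
    simp
  actRight_one := by
    rw [← cancel_mono (homAι V W), Category.assoc, homAActRight_ι, whisker_exchange_assoc]
    have := (homBimod V W).actRight_one
    dsimp only [homBimod] at this
    rw [this]
    simp
  right_assoc := by
    rw [← cancel_mono (homAι V W)]
    simp only [Category.assoc, homAActRight_ι]
    rw [whisker_exchange_assoc, ← comp_whiskerRight_assoc, homAActRight_ι]
    have := (homBimod V W).right_assoc
    dsimp only [homBimod] at this
    rw [this]
    simp
  middle_assoc := by
    rw [← cancel_mono (homAι V W)]
    simp only [Category.assoc, homAActRight_ι, homAActLeft_ι]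
    rw [← comp_whiskerRight_assoc, ← whiskerLeft_comp_assoc, homAActRight_ι, homAActLeft_ι]
    have := (homBimod V W).middle_assoc
    dsimp only [homBimod] at this
    simp only [comp_whiskerRight, whiskerLeft_comp, Category.assoc]
    rw [this]
    simp

/-- The inclusion of `hom_A(V, W)` into `hom(V, W)` as a morphism of bimodules. -/
def homAInclusion (V W : Bimod A A) : homA V W ⟶ homBimod V W where
  hom := homAι V W
  left_act_hom := homAActLeft_ι V W
  right_act_hom := homAActRight_ι V W

/-- The morphism `hom_A(f, g) = g ∘ - ∘ f` of underlying objects. -/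
def homAMapX {V V' W W' : Bimod A A} (f : V' ⟶ V) (g : W ⟶ W') : homAX V W ⟶ homAX V' W' :=
  homALift (homAι V W ≫ RightClosed.homMap f.hom g.hom) (by
    have e : (homAι V W ≫ RightClosed.homMap f.hom g.hom) ▷ V'.X ≫ ev V'.X W'.X =
        homAX V W ◁ f.hom ≫ (homAι V W ▷ V.X ≫ ev V.X W.X) ≫ g.hom := by
      rw [comp_whiskerRight, Category.assoc, homMap_ev, ← whisker_exchange_assoc]
      simp
    rw [e, ← whiskerLeft_comp_assoc, Bimod.Hom.right_act_hom, whiskerLeft_comp_assoc,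
      ← Category.assoc (_ ◁ V.actRight), homAι_condition]
    simp only [comp_whiskerRight, Category.assoc, Bimod.Hom.right_act_hom]
    simp)

@[simp] lemma homAMapX_ι {V V' W W' : Bimod A A} (f : V' ⟶ V) (g : W ⟶ W') :
    homAMapX f g ≫ homAι V' W' = homAι V W ≫ RightClosed.homMap f.hom g.hom := homALift_ι _ _

/-- The morphism of bimodules `hom_A(f, g) = g ∘ - ∘ f`. -/
def homAMap {V V' W W' : Bimod A A} (f : V' ⟶ V) (g : W ⟶ W') : homA V W ⟶ homA V' W' where
  hom := homAMapX f g
  left_act_hom := by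
    change homAActLeft V W ≫ homAMapX f g = A.X ◁ homAMapX f g ≫ homAActLeft V' W'
    rw [← cancel_mono (homAι V' W'), Category.assoc, Category.assoc, homAMapX_ι, homAActLeft_ι,
      ← Category.assoc, homAActLeft_ι, Category.assoc, homActLeft_homMap,
      ← whiskerLeft_comp_assoc, ← whiskerLeft_comp_assoc, homAMapX_ι]
  right_act_hom := by
    change homAActRight V W ≫ homAMapX f g = homAMapX f g ▷ A.X ≫ homAActRight V' W'
    rw [← cancel_mono (homAι V' W'), Category.assoc, Category.assoc, homAMapX_ι, homAActRight_ι,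
      ← Category.assoc, homAActRight_ι, Category.assoc, homActRight_homMap,
      ← comp_whiskerRight_assoc, ← comp_whiskerRight_assoc, homAMapX_ι]

lemma homA_hom_ext {Z V W : Bimod A A} {f g : Z ⟶ homA V W}
    (h : f.hom ≫ homAι V W = g.hom ≫ homAι V W) : f = g := by
  apply Bimod.hom_ext
  exact (cancel_mono (homAι V W)).mp h

/-- The internal hom functor `hom_A` of `A`-bimodules. -/
def ihomABimod (A : Mon C) : (Bimod A A)ᵒᵖ ⥤ Bimod A A ⥤ Bimod A A where
  obj V :=
    { obj W := homA V.unop W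
      map g := homAMap (𝟙 V.unop) g
      map_id W := by
        apply homA_hom_ext
        change homAMapX _ _ ≫ homAι _ _ = 𝟙 _ ≫ homAι _ _
        rw [homAMapX_ι, Bimod.id_hom', Bimod.id_hom', homMap_id, Category.comp_id, Category.id_comp]
      map_comp g g' := by
        apply homA_hom_ext
        change homAMapX _ _ ≫ homAι _ _ = (homAMapX _ _ ≫ homAMapX _ _) ≫ homAι _ _
        rw [homAMapX_ι, Category.assoc, homAMapX_ι, ← Category.assoc, homAMapX_ι, Category.assoc,
          ← homMap_comp]
        simp }
  map {V V'} f :=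
    { app W := homAMap f.unop (𝟙 W)
      naturality W W' g := by
        apply homA_hom_ext
        change (homAMapX _ _ ≫ homAMapX _ _) ≫ homAι _ _ =
          (homAMapX _ _ ≫ homAMapX _ _) ≫ homAι _ _
        rw [Category.assoc, homAMapX_ι, ← Category.assoc, homAMapX_ι, Category.assoc,
          ← homMap_comp, Category.assoc, homAMapX_ι, ← Category.assoc, homAMapX_ι, Category.assoc,
          ← homMap_comp]
        simp }
  map_id V := by
    apply NatTrans.ext
    funext W
    apply homA_hom_ext
    change homAMapX _ _ ≫ homAι _ _ = 𝟙 _ ≫ homAι _ _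
    rw [homAMapX_ι, unop_id, Bimod.id_hom', Bimod.id_hom', homMap_id, Category.comp_id,
      Category.id_comp]
  map_comp f f' := by
    apply NatTrans.ext
    funext W
    apply homA_hom_ext
    change homAMapX _ _ ≫ homAι _ _ = (homAMapX _ _ ≫ homAMapX _ _) ≫ homAι _ _
    rw [homAMapX_ι, Category.assoc, homAMapX_ι, ← Category.assoc, homAMapX_ι, Category.assoc,
      ← homMap_comp]
    simp

end HomBimod

/-! ### The closed monoidal category of bimodules -/

section BimodMonoidal

open RightClosed MonObj

variable {C : Type*} [Category C] [MonoidalCategory C] [HasCoequalizers C]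
  [∀ X : C, PreservesColimitsOfSize.{0, 0} (tensorLeft X)]
  [∀ X : C, PreservesColimitsOfSize.{0, 0} (tensorRight X)] {A : Mon C}

/-- The tensor product of `A`-bimodules is the tensor product over `A`, and the unit object is
`A`. -/
instance : MonoidalCategoryStruct (Bimod A A) where
  tensorObj V W := V.tensorBimod W
  whiskerLeft V _ _ f := Bimod.whiskerLeft V f
  whiskerRight f W := Bimod.whiskerRight f W
  tensorUnit := Bimod.regular A
  associator := Bimod.associatorBimod
  leftUnitor := Bimod.leftUnitorBimod
  rightUnitor := Bimod.rightUnitorBimod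

instance : MonoidalCategory (Bimod A A) where
  id_tensorHom_id V W := by
    change Bimod.whiskerRight _ _ ≫ Bimod.whiskerLeft _ _ = _
    rw [Bimod.whiskerLeft_id_bimod, Bimod.id_whiskerRight_bimod, Category.comp_id]
    rfl
  tensorHom_comp_tensorHom f₁ f₂ g₁ g₂ := by
    change (Bimod.whiskerRight _ _ ≫ Bimod.whiskerLeft _ _) ≫
      Bimod.whiskerRight _ _ ≫ Bimod.whiskerLeft _ _ =
      Bimod.whiskerRight _ _ ≫ Bimod.whiskerLeft _ _
    rw [Category.assoc, ← Category.assoc (Bimod.whiskerLeft _ _), Bimod.whisker_exchange_bimod,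
      Bimod.whiskerLeft_comp_bimod, Bimod.comp_whiskerRight_bimod]
    simp only [Category.assoc]
  whiskerLeft_id _ _ := Bimod.whiskerLeft_id_bimod
  id_whiskerRight _ _ := Bimod.id_whiskerRight_bimod
  associator_naturality {V₁ V₂ V₃ W₁ W₂ W₃} f₁ f₂ f₃ := by
    change (Bimod.whiskerRight (Bimod.whiskerRight f₁ V₂ ≫ Bimod.whiskerLeft W₁ f₂) V₃ ≫
      Bimod.whiskerLeft (W₁.tensorBimod W₂) f₃) ≫ (Bimod.associatorBimod _ _ _).hom =
      (Bimod.associatorBimod _ _ _).hom ≫ Bimod.whiskerRight f₁ (V₂.tensorBimod V₃) ≫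
        Bimod.whiskerLeft W₁ (Bimod.whiskerRight f₂ V₃ ≫ Bimod.whiskerLeft W₂ f₃)
    rw [Bimod.whiskerRight_comp_bimod, Bimod.comp_whiskerLeft_bimod, Bimod.comp_whiskerRight_bimod,
      Bimod.whiskerLeft_comp_bimod, Bimod.whisker_assoc_bimod]
    simp only [Category.assoc, Iso.inv_hom_id, Iso.inv_hom_id_assoc, Iso.hom_inv_id_assoc,
      Category.comp_id]
  leftUnitor_naturality {V W} f := by
    change Bimod.whiskerLeft (Bimod.regular A) f ≫ (Bimod.leftUnitorBimod _).hom =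
      (Bimod.leftUnitorBimod _).hom ≫ f
    rw [Bimod.id_whiskerLeft_bimod]
    simp only [Category.assoc, Iso.inv_hom_id, Category.comp_id]
  rightUnitor_naturality {V W} f := by
    change Bimod.whiskerRight f (Bimod.regular A) ≫ (Bimod.rightUnitorBimod _).hom =
      (Bimod.rightUnitorBimod _).hom ≫ f
    rw [Bimod.whiskerRight_id_bimod]
    simp only [Category.assoc, Iso.inv_hom_id, Category.comp_id]
  pentagon _ _ _ _ := Bimod.pentagon_bimod _ _ _ _
  triangle _ _ := Bimod.triangle_bimod _ _

/-- The projection `V ⊗ W ⟶ V ⊗_A W`. -/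
def tπ (V W : Bimod A A) : V.X ⊗ W.X ⟶ (V ⊗ W).X := coequalizer.π _ _

instance (V W : Bimod A A) : Epi (tπ V W) := coequalizer.π_epi

lemma tπ_condition (V W : Bimod A A) :
    V.actRight ▷ W.X ≫ tπ V W = (α_ _ _ _).hom ≫ V.X ◁ W.actLeft ≫ tπ V W :=
  (coequalizer.condition _ _).trans (Category.assoc _ _ _)

/-- Descend a morphism to `V ⊗_A W`. -/
def tdesc {V W : Bimod A A} {X : C} (f : V.X ⊗ W.X ⟶ X)
    (hf : V.actRight ▷ W.X ≫ f = (α_ _ _ _).hom ≫ V.X ◁ W.actLeft ≫ f) : (V ⊗ W).X ⟶ X :=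
  coequalizer.desc f (hf.trans (Category.assoc _ _ _).symm)

@[simp] lemma tπ_desc {V W : Bimod A A} {X : C} (f : V.X ⊗ W.X ⟶ X)
    (hf : V.actRight ▷ W.X ≫ f = (α_ _ _ _).hom ≫ V.X ◁ W.actLeft ≫ f) :
    tπ V W ≫ tdesc f hf = f := coequalizer.π_desc _ _

lemma tπ_actLeft (V W : Bimod A A) : A.X ◁ tπ V W ≫ (V ⊗ W).actLeft =
    (α_ _ _ _).inv ≫ V.actLeft ▷ W.X ≫ tπ V W :=
  Bimod.TensorBimod.whiskerLeft_π_actLeft V W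

lemma tπ_actRight (V W : Bimod A A) : tπ V W ▷ A.X ≫ (V ⊗ W).actRight =
    (α_ _ _ _).hom ≫ V.X ◁ W.actRight ≫ tπ V W :=
  Bimod.TensorBimod.π_tensor_id_actRight V W

lemma tπ_whiskerLeft (V : Bimod A A) {W W' : Bimod A A} (f : W ⟶ W') :
    tπ V W ≫ (V ◁ f).hom = V.X ◁ f.hom ≫ tπ V W' :=
  (ι_colimMap _ _)

lemma tπ_whiskerRight {V V' : Bimod A A} (f : V ⟶ V') (W : Bimod A A) :
    tπ V W ≫ (f ▷ W).hom = f.hom ▷ W.X ≫ tπ V' W :=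
  (ι_colimMap _ _)

instance (V W : Bimod A A) (X : C) : Epi (X ◁ tπ V W) :=
  inferInstanceAs (Epi ((tensorLeft X).map (tπ V W)))

instance (V W : Bimod A A) (X : C) : Epi (tπ V W ▷ X) :=
  inferInstanceAs (Epi ((tensorRight X).map (tπ V W)))

variable [RightClosed C] [HasEqualizers C]

/-- The morphism underlying `curryA`. -/
def curryAX {V W X : Bimod A A} (f : V ⊗ W ⟶ X) : V.X ⟶ homAX W X :=
  homALift (curry (tπ V W ≫ f.hom)) (by
    rw [curry_ev, comp_whiskerRight, Category.assoc, ← Bimod.Hom.right_act_hom,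
      ← Category.assoc (_ ▷ _), tπ_actRight]
    simp)

lemma curryAX_ι {V W X : Bimod A A} (f : V ⊗ W ⟶ X) :
    curryAX f ≫ homAι W X = curry (tπ V W ≫ f.hom) := homALift_ι _ _

/-- `ζ^A`: the adjoint of a morphism of bimodules `V ⊗_A W ⟶ X`. -/
def curryA {V W X : Bimod A A} (f : V ⊗ W ⟶ X) : V ⟶ homA W X where
  hom := curryAX f
  left_act_hom := by
    change V.actLeft ≫ curryAX f = A.X ◁ curryAX f ≫ homAActLeft W X
    rw [← cancel_mono (homAι W X), Category.assoc, Category.assoc, homAActLeft_ι, curryAX_ι,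
      ← whiskerLeft_comp_assoc, curryAX_ι]
    apply RightClosed.hom_ext
    rw [comp_whiskerRight, comp_whiskerRight, Category.assoc, Category.assoc, homActLeft_ev,
      curry_ev, associator_naturality_middle_assoc, ← whiskerLeft_comp_assoc, curry_ev,
      whiskerLeft_comp_assoc, ← Bimod.Hom.left_act_hom, ← Category.assoc (A.X ◁ _), tπ_actLeft]
    simp
  right_act_hom := by
    change V.actRight ≫ curryAX f = curryAX f ▷ A.X ≫ homAActRight W X
    rw [← cancel_mono (homAι W X), Category.assoc, Category.assoc, homAActRight_ι, curryAX_ι,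
      ← comp_whiskerRight_assoc, curryAX_ι]
    apply RightClosed.hom_ext
    rw [comp_whiskerRight, comp_whiskerRight, Category.assoc, Category.assoc, homActRight_ev,
      curry_ev, associator_naturality_left_assoc, ← whisker_exchange_assoc, curry_ev,
      ← Category.assoc, tπ_condition]
    simp

/-- The morphism of objects underlying a morphism of bimodules into `hom_A(W, X)`. -/
def homOf {V W X : Bimod A A} (g : V ⟶ homA W X) : V.X ⟶ homAX W X := g.hom

lemma homOf_left {V W X : Bimod A A} (g : V ⟶ homA W X) :
    V.actLeft ≫ homOf g = A.X ◁ homOf g ≫ homAActLeft W X := g.left_act_hom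

lemma homOf_right {V W X : Bimod A A} (g : V ⟶ homA W X) :
    V.actRight ≫ homOf g = homOf g ▷ A.X ≫ homAActRight W X := g.right_act_hom

/-- The morphism underlying `uncurryA`. -/
def uncurryAX {V W X : Bimod A A} (g : V ⟶ homA W X) : (V ⊗ W).X ⟶ X.X :=
  tdesc ((homOf g ≫ homAι W X) ▷ W.X ≫ ev W.X X.X) (by
    have h : V.actRight ≫ homOf g ≫ homAι W X =
        (homOf g ≫ homAι W X) ▷ A.X ≫ homActRight W X := by
      rw [← Category.assoc, homOf_right, Category.assoc, homAActRight_ι, comp_whiskerRight_assoc]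
    rw [← comp_whiskerRight_assoc, h, comp_whiskerRight_assoc, homActRight_ev,
      associator_naturality_left_assoc, ← whisker_exchange_assoc])

lemma tπ_uncurryAX {V W X : Bimod A A} (g : V ⟶ homA W X) :
    tπ V W ≫ uncurryAX g = (homOf g ≫ homAι W X) ▷ W.X ≫ ev W.X X.X :=
  tπ_desc _ _

/-- The inverse of `ζ^A`. -/
def uncurryA {V W X : Bimod A A} (g : V ⟶ homA W X) : V ⊗ W ⟶ X where
  hom := uncurryAX g
  left_act_hom := by
    have h : V.actLeft ≫ homOf g ≫ homAι W X =
        A.X ◁ (homOf g ≫ homAι W X) ≫ homActLeft W X := by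
      rw [← Category.assoc, homOf_left, Category.assoc, homAActLeft_ι, whiskerLeft_comp_assoc]
    rw [← cancel_epi (A.X ◁ tπ V W), ← whiskerLeft_comp_assoc, tπ_uncurryAX, ← Category.assoc,
      tπ_actLeft, Category.assoc, Category.assoc, tπ_uncurryAX, ← comp_whiskerRight_assoc, h,
      comp_whiskerRight_assoc, homActLeft_ev]
    simp
  right_act_hom := by
    have h := (equalizes_iff (homOf g ≫ homAι W X)).mp (by
      rw [Category.assoc, Category.assoc]
      exact congrArg (homOf g ≫ ·) (equalizer.condition _ _))
    rw [← cancel_epi (tπ V W ▷ A.X), ← comp_whiskerRight_assoc, tπ_uncurryAX, ← Category.assoc,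
      tπ_actRight, Category.assoc, Category.assoc, tπ_uncurryAX, h, Iso.hom_inv_id_assoc]

lemma uncurryA_curryA {V W X : Bimod A A} (f : V ⊗ W ⟶ X) : uncurryA (curryA f) = f := by
  apply Bimod.hom_ext
  rw [← cancel_epi (tπ V W)]
  refine (tπ_uncurryAX (curryA f)).trans ?_
  change (curryAX f ≫ homAι W X) ▷ W.X ≫ ev W.X X.X = _
  rw [curryAX_ι, curry_ev]

lemma curryA_uncurryA {V W X : Bimod A A} (g : V ⟶ homA W X) : curryA (uncurryA g) = g := by
  apply homA_hom_ext
  refine (curryAX_ι (uncurryA g)).trans ?_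
  change curry (tπ V W ≫ uncurryAX g) = _
  rw [tπ_uncurryAX, curry_whisker_ev]
  rfl

instance : RightClosed (Bimod A A) where
  ihom := ihomABimod A
  curry {V W X} := ⟨curryA, uncurryA, uncurryA_curryA, curryA_uncurryA⟩
  curry_left {V V' W X} f g := by
    apply homA_hom_ext
    change curryAX (f ▷ W ≫ g) ≫ _ = (f.hom ≫ curryAX g) ≫ _
    rw [Category.assoc, curryAX_ι, curryAX_ι, Bimod.comp_hom', ← Category.assoc, tπ_whiskerRight,
      Category.assoc, curry_left]
  curry_mid {V W W' X} f g := by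
    apply homA_hom_ext
    change curryAX (V ◁ f ≫ g) ≫ _ = (curryAX g ≫ homAMapX f (𝟙 X)) ≫ _
    rw [Category.assoc, homAMapX_ι, ← Category.assoc, curryAX_ι, curryAX_ι, Bimod.comp_hom',
      ← Category.assoc, tπ_whiskerLeft, Category.assoc, curry_mid, RightClosed.homMap]
    simp
  curry_right {V W X X'} g f := by
    apply homA_hom_ext
    change curryAX (g ≫ f) ≫ _ = (curryAX g ≫ homAMapX (𝟙 W) f) ≫ _
    rw [Category.assoc, homAMapX_ι, ← Category.assoc, curryAX_ι, curryAX_ι, Bimod.comp_hom',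
      ← Category.assoc, curry_right, RightClosed.homMap]
    simp

end BimodMonoidal

end

end QHopf

namespace QHopf

noncomputable section

/-! ### Full subcategories of closed monoidal categories -/

section FullSub

open RightClosed

variable {C : Type*} [Category C] [MonoidalCategory C] [RightClosed C]

/-- A property of objects that is inherited by internal homs. -/
class IsHomClosed (P : ObjectProperty C) : Prop where
  prop_hom {V W : C} (hV : P V) (hW : P W) : P (hom V W)

/-- The internal hom functor of a full subcategory that is stable under internal homs. -/
def fullSubIhom (P : ObjectProperty C) [IsHomClosed P] :
    P.FullSubcategoryᵒᵖ ⥤ P.FullSubcategory ⥤ P.FullSubcategory where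
  obj V := P.lift (P.ι ⋙ RightClosed.ihom.obj (Opposite.op V.unop.obj))
    (fun W => IsHomClosed.prop_hom V.unop.property W.property)
  map f :=
    { app W := ObjectProperty.homMk ((RightClosed.ihom.map f.unop.hom.op).app W.obj)
      naturality W W' g := by
        apply ObjectProperty.hom_ext
        exact (RightClosed.ihom.map f.unop.hom.op).naturality g.hom }
  map_id V := by
    ext W
    exact congrArg (fun t => NatTrans.app t W.obj)
      (RightClosed.ihom.map_id (Opposite.op V.unop.obj))
  map_comp f g := by
    ext W
    exact congrArg (fun t => NatTrans.app t W.obj)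
      (RightClosed.ihom.map_comp f.unop.hom.op g.unop.hom.op)

/-- A full monoidal subcategory that is stable under internal homs is closed. -/
instance (P : ObjectProperty C) [P.IsMonoidal] [IsHomClosed P] :
    RightClosed P.FullSubcategory where
  ihom := fullSubIhom P
  curry :=
    { toFun f := ObjectProperty.homMk (RightClosed.curry f.hom)
      invFun g := ObjectProperty.homMk (RightClosed.curry.symm g.hom)
      left_inv f := ObjectProperty.hom_ext _ (RightClosed.curry.symm_apply_apply f.hom)
      right_inv g := ObjectProperty.hom_ext _ (RightClosed.curry.apply_symm_apply g.hom) }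
  curry_left f g := ObjectProperty.hom_ext _ (RightClosed.curry_left f.hom g.hom)
  curry_mid f g := ObjectProperty.hom_ext _ (RightClosed.curry_mid f.hom g.hom)
  curry_right g f := ObjectProperty.hom_ext _ (RightClosed.curry_right g.hom f.hom)

end FullSub

/-! ### Functors of closed monoidal categories -/

section Comparison

open RightClosed

/-- The structure that makes a monoidal functor `G` a functor of closed monoidal categories:
natural isomorphisms `hom(G V, G W) ≅ G hom(V, W)` that are compatible with evaluation. -/
structure ClosedComparison {C C' : Type*} [Category C] [MonoidalCategory C] [RightClosed C]
    [Category C'] [MonoidalCategory C'] [RightClosed C'] (G : C ⥤ C') [G.Monoidal] where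
  iso (V W : C) : hom (G.obj V) (G.obj W) ≅ G.obj (hom V W)
  naturality {V V' W W' : C} (f : V' ⟶ V) (g : W ⟶ W') :
    RightClosed.homMap (G.map f) (G.map g) ≫ (iso V' W').hom =
      (iso V W).hom ≫ G.map (RightClosed.homMap f g)
  iso_ev (V W : C) : (iso V W).hom ▷ G.obj V ≫ Functor.LaxMonoidal.μ G (hom V W) V ≫
    G.map (ev V W) = ev (G.obj V) (G.obj W)

end Comparison

/-! ### Modules and bimodules over the image of an algebra under a monoidal functor -/

section MapBimod

variable {C C' : Type*} [Category C] [MonoidalCategory C] [Category C'] [MonoidalCategory C']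

open Functor.LaxMonoidal MonObj

section Lemmas

variable (G : C ⥤ C') [G.LaxMonoidal] {A : Mon C} (V : Bimod A A)

/-- The left action of `G A` on `G V`. -/
def mapActLeft : G.obj A.X ⊗ G.obj V.X ⟶ G.obj V.X :=
  Functor.LaxMonoidal.μ G A.X V.X ≫ G.map V.actLeft

/-- The right action of `G A` on `G V`. -/
def mapActRight : G.obj V.X ⊗ G.obj A.X ⟶ G.obj V.X :=
  Functor.LaxMonoidal.μ G V.X A.X ≫ G.map V.actRight

lemma mapBimod_one_actLeft :
    (ε G ≫ G.map η[A.X]) ▷ G.obj V.X ≫ mapActLeft G V = (λ_ (G.obj V.X)).hom := by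
  rw [mapActLeft, comp_whiskerRight, Category.assoc, μ_natural_left_assoc,
    ← G.map_comp, Bimod.one_actLeft, left_unitality]

lemma mapBimod_actRight_one :
    G.obj V.X ◁ (ε G ≫ G.map η[A.X]) ≫ mapActRight G V = (ρ_ (G.obj V.X)).hom := by
  rw [mapActRight, MonoidalCategory.whiskerLeft_comp, Category.assoc, μ_natural_right_assoc,
    ← G.map_comp, Bimod.actRight_one, right_unitality]

lemma mapBimod_left_assoc :
    (Functor.LaxMonoidal.μ G A.X A.X ≫ G.map μ[A.X]) ▷ G.obj V.X ≫ mapActLeft G V =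
      (α_ _ _ _).hom ≫ G.obj A.X ◁ mapActLeft G V ≫ mapActLeft G V := by
  rw [mapActLeft, comp_whiskerRight, Category.assoc, μ_natural_left_assoc,
    ← G.map_comp, Bimod.left_assoc, G.map_comp, G.map_comp, associativity_assoc,
    MonoidalCategory.whiskerLeft_comp, Category.assoc, μ_natural_right_assoc]

lemma mapBimod_right_assoc :
    G.obj V.X ◁ (Functor.LaxMonoidal.μ G A.X A.X ≫ G.map μ[A.X]) ≫ mapActRight G V =
      (α_ _ _ _).inv ≫ mapActRight G V ▷ G.obj A.X ≫ mapActRight G V := by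
  rw [mapActRight, MonoidalCategory.whiskerLeft_comp, Category.assoc, μ_natural_right_assoc,
    ← G.map_comp, Bimod.right_assoc, G.map_comp, G.map_comp, associativity_inv_assoc,
    comp_whiskerRight, Category.assoc, μ_natural_left_assoc]

lemma mapBimod_middle_assoc :
    mapActLeft G V ▷ G.obj A.X ≫ mapActRight G V =
      (α_ _ _ _).hom ≫ G.obj A.X ◁ mapActRight G V ≫ mapActLeft G V := by
  rw [mapActLeft, mapActRight, comp_whiskerRight, Category.assoc, μ_natural_left_assoc,
    ← G.map_comp, Bimod.middle_assoc, G.map_comp, G.map_comp, associativity_assoc,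
    MonoidalCategory.whiskerLeft_comp, Category.assoc, μ_natural_right_assoc]

lemma mapBimod_left_act {V W : Bimod A A} (f : V ⟶ W) :
    mapActLeft G V ≫ G.map f.hom = G.obj A.X ◁ G.map f.hom ≫ mapActLeft G W := by
  rw [mapActLeft, Category.assoc, ← G.map_comp, Bimod.Hom.left_act_hom, G.map_comp, mapActLeft,
    μ_natural_right_assoc]

lemma mapBimod_right_act {V W : Bimod A A} (f : V ⟶ W) :
    mapActRight G V ≫ G.map f.hom = G.map f.hom ▷ G.obj A.X ≫ mapActRight G W := by
  rw [mapActRight, Category.assoc, ← G.map_comp, Bimod.Hom.right_act_hom, G.map_comp,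
    mapActRight, μ_natural_left_assoc]

end Lemmas

/-- The functor on bimodules induced by a lax monoidal functor `G`: the actions on `G V` are the
images of the actions on `V`, precomposed with `G A ⊗ G V ⟶ G (A ⊗ V)` and
`G V ⊗ G A ⟶ G (V ⊗ A)`. -/
def mapBimod (G : C ⥤ C') [G.LaxMonoidal] (A : Mon C) :
    Bimod A A ⥤ Bimod (G.mapMon.obj A) (G.mapMon.obj A) where
  obj V :=
    { X := G.obj V.X
      actLeft := mapActLeft G V
      actRight := mapActRight G V
      one_actLeft := mapBimod_one_actLeft G V
      left_assoc := mapBimod_left_assoc G V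
      actRight_one := mapBimod_actRight_one G V
      right_assoc := mapBimod_right_assoc G V
      middle_assoc := mapBimod_middle_assoc G V }
  map f :=
    { hom := G.map f.hom
      left_act_hom := mapBimod_left_act G f
      right_act_hom := mapBimod_right_act G f }
  map_id V := by
    apply Bimod.hom_ext
    exact G.map_id _
  map_comp f g := by
    apply Bimod.hom_ext
    exact G.map_comp _ _

end MapBimod

end

end QHopf

namespace QHopf

noncomputable section

variable {k H : Type u} [CommRing k] [Ring H] [Algebra k H]

/-! ### Symmetric bimodules over braided commutative algebras -/

section Symmetric

variable {D : Data k H} [D.IsQuasitriangular]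

/-- An algebra in the category of `H`-modules is braided commutative if `μ ∘ τ = μ`. -/
def IsBraidedCommutative (A : Mon (HMod D)) : Prop :=
  (HMod.τ A.X A.X).hom ≫ MonObj.mul = (MonObj.mul : A.X ⊗ A.X ⟶ A.X)

/-- A bimodule `V` is symmetric if `r ∘ τ = l` on `A ⊗ V` and `l ∘ τ = r` on `V ⊗ A`, where `l` and
`r` are the left and the right action. -/
def symProp (A : Mon (HMod D)) : ObjectProperty (Bimod A A) := fun V =>
  (HMod.τ A.X V.X).hom ≫ V.actRight = V.actLeft ∧ (HMod.τ V.X A.X).hom ≫ V.actLeft = V.actRight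

end Symmetric

/-! ### Cochain twisting -/

section TwistLin

variable (D : Data k H) (F : (H ⊗[k] H)ˣ)
variable {V W X : Type u} [AddCommGroup V] [Module k V] [AddCommGroup W] [Module k W]
  [AddCommGroup X] [Module k X]
variable (v : H →ₐ[k] Module.End k V) (w : H →ₐ[k] Module.End k W) (x : H →ₐ[k] Module.End k X)

/-- The linear equivalence `m ⊗ n ↦ F⁻¹₍₁₎ ▷ m ⊗ F⁻¹₍₂₎ ▷ n`. -/
def twistLin : V ⊗[k] W ≃ₗ[k] V ⊗[k] W :=
  LinearMap.GeneralLinearGroup.generalLinearEquiv k _ (Units.map (tact v w).toMonoidHom F⁻¹)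

lemma twistLin_eq : (twistLin F v w).toLinearMap = tact v w (↑F⁻¹ : H ⊗[k] H) := rfl

lemma twistLin_equivariant (h : H) : (twistLin F v w).toLinearMap ∘ₗ dact (D.twist F) v w h =
    dact D v w h ∘ₗ (twistLin F v w).toLinearMap := by
  change tact v w (↑F⁻¹ : H ⊗[k] H) ∘ₗ tact v w (F * D.Δ h * ↑F⁻¹) =
    tact v w (D.Δ h) ∘ₗ tact v w (↑F⁻¹ : H ⊗[k] H)
  rw [← Module.End.mul_eq_comp, ← Module.End.mul_eq_comp, ← map_mul, ← map_mul, mul_assoc,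
    Units.inv_mul_cancel_left]

lemma assoc_rTensor_tact (t : H ⊗[k] H) :
    (TensorProduct.assoc k V W X).toLinearMap ∘ₗ (tact v w t).rTensor X =
      act₃ v w x (i12 k H t) ∘ₗ (TensorProduct.assoc k V W X).toLinearMap := by
  induction t using ind₂ with
  | hadd s t hs ht => simp only [map_add, LinearMap.rTensor_add, LinearMap.comp_add,
      LinearMap.add_comp, hs, ht]
  | h a b =>
    apply TensorProduct.ext_threefold
    intro m n p
    change v a m ⊗ₜ (w b n ⊗ₜ p) = v a m ⊗ₜ (w b n ⊗ₜ (x 1 p))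
    rw [map_one, Module.End.one_apply]

lemma lTensor_tact (t : H ⊗[k] H) :
    (tact w x t).lTensor V = act₃ v w x (i23 k H t) := by
  change _ = tact v (tact w x) (1 ⊗ₜ t)
  rw [tact_tmul_eq, map_one]
  rfl

lemma twist_φ_coe : ((D.twist F).φ : H ⊗[k] (H ⊗[k] H)) =
    i23 k H F * D.idΔ F * D.φ * D.Δid ↑F⁻¹ * i12 k H ↑F⁻¹ := by
  simp only [Data.twist, Units.val_mul]
  rfl

lemma twistLin_assoc :
    (assocLin D v w x).toLinearMap ∘ₗ (twistLin F (dact D v w) x).toLinearMap ∘ₗ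
      (twistLin F v w).toLinearMap.rTensor X =
    (twistLin F v (dact D w x)).toLinearMap ∘ₗ (twistLin F w x).toLinearMap.lTensor V ∘ₗ
      (assocLin (D.twist F) v w x).toLinearMap := by
  rw [twistLin_eq, twistLin_eq, twistLin_eq, twistLin_eq, assocLin_eq, assocLin_eq,
    LinearMap.comp_assoc, ← LinearMap.comp_assoc _ _ (TensorProduct.assoc k V W X).toLinearMap,
    tact_dact_left, LinearMap.comp_assoc, assoc_rTensor_tact v w x, tact_dact_right, lTensor_tact v,
    twist_φ_coe]
  simp only [← LinearMap.comp_assoc, ← Module.End.mul_eq_comp]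
  rw [← map_mul, ← map_mul, ← map_mul, ← map_mul]
  congr 2
  have h1 : D.idΔ ↑F⁻¹ * D.idΔ F = 1 := by rw [← map_mul, Units.inv_mul, map_one]
  have h2 : i23 k H ↑F⁻¹ * i23 k H F = 1 := by rw [← map_mul, Units.inv_mul, map_one]
  calc _ = (D.idΔ ↑F⁻¹ * ((i23 k H ↑F⁻¹ * i23 k H F) * D.idΔ F)) * (D.φ * D.Δid ↑F⁻¹ *
        i12 k H ↑F⁻¹) := by rw [h2, one_mul, h1, one_mul, mul_assoc]
    _ = _ := by simp only [mul_assoc]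

end TwistLin

section Twist

variable (D : Data k H) (F : (H ⊗[k] H)ˣ)

/-- The twist functor: the identity on modules and on equivariant maps. -/
def twistFunctor : HMod D ⥤ HMod (D.twist F) where
  obj V := ⟨V.carrier, V.act⟩
  map {V W} f := ⟨HMod.Hom.lin (V := V) (W := W) f, HMod.Hom.equivariant (V := V) (W := W) f⟩

variable [D.IsQuasitriangular] [(D.twist F).IsQuasitriangular]

/-- `v ⊗ w ↦ F⁻¹₍₁₎ ▷ v ⊗ F⁻¹₍₂₎ ▷ w`. -/
def twistμ (V W : HMod D) : (twistFunctor D F).obj V ⊗ (twistFunctor D F).obj W ≅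
    (twistFunctor D F).obj (V ⊗ W) :=
  HMod.isoMk (V := HMod.tens ((twistFunctor D F).obj V) ((twistFunctor D F).obj W))
    (W := (twistFunctor D F).obj (HMod.tens V W)) (twistLin F V.act W.act)
    (twistLin_equivariant D F V.act W.act)

/-- The identity of `k`. -/
def twistε : 𝟙_ (HMod (D.twist F)) ≅ (twistFunctor D F).obj (𝟙_ (HMod D)) :=
  HMod.isoMk (V := HMod.unit (D.twist F)) (W := (twistFunctor D F).obj (HMod.unit D))
    (LinearEquiv.refl k k) (fun _ => rfl)

/-- The twist functor is monoidal, with the coherence maps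
`v ⊗ w ↦ F⁻¹₍₁₎ ▷ v ⊗ F⁻¹₍₂₎ ▷ w` and the identity of `k`. -/
instance [D.IsCochainTwist F] : (twistFunctor D F).Monoidal :=
  Functor.CoreMonoidal.toMonoidal
    { εIso := twistε D F
      μIso := twistμ D F
      μIso_hom_natural_left {V W} f X := HMod.hom_ext
        (tact_map V.act X.act W.act X.act (HMod.Hom.lin f) LinearMap.id (HMod.Hom.equivariant f)
          (fun _ => rfl) (↑F⁻¹ : H ⊗[k] H)).symm
      μIso_hom_natural_right {V W} X f := HMod.hom_ext
        (tact_map X.act V.act X.act W.act LinearMap.id (HMod.Hom.lin f) (fun _ => rfl)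
          (HMod.Hom.equivariant f) (↑F⁻¹ : H ⊗[k] H)).symm
      associativity V W X := by
        apply HMod.hom_ext
        refine Eq.trans ?_ ((twistLin_assoc D F V.act W.act X.act).trans ?_)
        · rfl
        · rfl
      left_unitality V := HMod.hom_ext (by
        have h1 : D.εid ↑F⁻¹ = 1 := by
          have := congrArg D.εid F.inv_mul
          rw [map_mul, Data.IsCochainTwist.counit_left (F := F), mul_one, map_one] at this
          exact this
        have h := lid_tact D V.act (↑F⁻¹ : H ⊗[k] H)
        rw [h1, map_one] at h
        refine h.symm.trans ?_
        exact (congrArg (fun t => _ ∘ₗ (_ ∘ₗ t)) TensorProduct.map_id).symm)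
      right_unitality V := HMod.hom_ext (by
        have h1 : D.idε ↑F⁻¹ = 1 := by
          have := congrArg D.idε F.inv_mul
          rw [map_mul, Data.IsCochainTwist.counit_right (F := F), mul_one, map_one] at this
          exact this
        have h := rid_tact D V.act (↑F⁻¹ : H ⊗[k] H)
        rw [h1, map_one] at h
        refine h.symm.trans ?_
        exact (congrArg (fun t => _ ∘ₗ (_ ∘ₗ t)) TensorProduct.map_id).symm) }

end Twist

end

end QHopf

namespace QHopf

noncomputable section

variable {k H : Type u} [CommRing k] [Ring H] [Algebra k H]

section TwistHom

variable (D : Data k H) (F : (H ⊗[k] H)ˣ)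

/-- The action of `H ⊗ H` on linear maps, `a ⊗ b` sending `L` to `w(a) ∘ L ∘ v(S(b))`. -/
def sandS {V W : Type u} [AddCommGroup V] [Module k V] [AddCommGroup W] [Module k W]
    (v : H →ₐ[k] Module.End k V) (w : H →ₐ[k] Module.End k W) :
    H ⊗[k] H →ₐ[k] Module.End k (V →ₗ[k] W) :=
  (sandOp v w).comp (Algebra.TensorProduct.map (AlgHom.id k H) D.S.toAlgHom)

lemma sandS_tmul {V W : Type u} [AddCommGroup V] [Module k V] [AddCommGroup W] [Module k W]
    (v : H →ₐ[k] Module.End k V) (w : H →ₐ[k] Module.End k W) (a b : H) (L : V →ₗ[k] W) (n : V) :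
    sandS D v w (a ⊗ₜ b) L n = w a (L (v (D.antipode b) n)) := rfl

variable [D.IsQuasitriangular] [(D.twist F).IsQuasitriangular]

/-- `γ : L ↦ F⁻¹₍₁₎ ∘ L ∘ S(F⁻¹₍₂₎)`. -/
def twistγ (V W : HMod D) :
    RightClosed.hom ((twistFunctor D F).obj V) ((twistFunctor D F).obj W) ≅
      (twistFunctor D F).obj (RightClosed.hom V W) :=
  HMod.isoMk (V := HMod.hom ((twistFunctor D F).obj V) ((twistFunctor D F).obj W))
    (W := (twistFunctor D F).obj (HMod.hom V W))
    (LinearMap.GeneralLinearGroup.generalLinearEquiv k _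
      (Units.map (sandS D V.act W.act).toMonoidHom F⁻¹)) (fun h => by
    change sandS D V.act W.act (↑F⁻¹ : H ⊗[k] H) * sandS D V.act W.act (F * D.Δ h * ↑F⁻¹) =
      sandS D V.act W.act (D.Δ h) * sandS D V.act W.act (↑F⁻¹ : H ⊗[k] H)
    rw [← map_mul, ← map_mul, mul_assoc, Units.inv_mul_cancel_left])

end TwistHom

/-! ### Twisting of algebras, bimodules and symmetric bimodules -/

/-- The category of symmetric `A`-bimodules, a full subcategory of the category of
`A`-bimodules. -/
abbrev SymBimod {D : Data k H} [D.IsQuasitriangular] (A : Mon (HMod D)) :=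
  (symProp A).FullSubcategory

/-- The property of a braiding on symmetric `A`-bimodules to be induced by the braiding `τ` of
`H`-modules, that is to be given by `v ⊗_A w ↦ R₍₂₎ ▷ w ⊗_A R₍₁₎ ▷ v`. -/
def IsInducedBraiding {D : Data k H} [D.IsQuasitriangular] (A : Mon (HMod D))
    [(symProp A).IsMonoidal] [BraidedCategory (SymBimod A)] : Prop :=
  ∀ V W : SymBimod A, tπ V.obj W.obj ≫ (β_ V W).hom.hom.hom =
    (HMod.τ V.obj.X W.obj.X).hom ≫ tπ W.obj V.obj

section Twist

variable (D : Data k H) (F : (H ⊗[k] H)ˣ) [D.IsQuasitriangular] [(D.twist F).IsQuasitriangular]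
  [D.IsCochainTwist F] (A : Mon (HMod D))

/-- The twisted algebra `A_F`, with product `a ⋆ b = (F⁻¹₍₁₎ ▷ a) (F⁻¹₍₂₎ ▷ b)`. -/
abbrev twistAlg : Mon (HMod (D.twist F)) := (twistFunctor D F).mapMon.obj A

/-- The twist functor on bimodules. It is the identity on the underlying modules and morphisms;
the left action on `V_F` is `a ⊗ v ↦ (F⁻¹₍₁₎ ▷ a) (F⁻¹₍₂₎ ▷ v)`, similarly for the right action. -/
abbrev twistBimod : Bimod A A ⥤ Bimod (twistAlg D F A) (twistAlg D F A) :=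
  mapBimod (twistFunctor D F) A

/-- The restriction of the twist functor to symmetric bimodules. -/
abbrev twistSymBimod
    (h : ∀ V : Bimod A A, symProp A V → symProp (twistAlg D F A) ((twistBimod D F A).obj V)) :
    SymBimod A ⥤ SymBimod (twistAlg D F A) :=
  (symProp (twistAlg D F A)).lift ((symProp A).ι ⋙ twistBimod D F A)
    (fun V => h V.obj V.property)

end Twist

end

end QHopf

namespace QHopf

noncomputable section

section TwistData

variable {k H : Type u} [CommRing k] [Ring H] [Algebra k H]

lemma i12_eq_assoc (x : H ⊗[k] H) :
    i12 k H x = Algebra.TensorProduct.assoc k k k H H H (x ⊗ₜ 1) := by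
  induction x using ind₂ with
  | hadd s t hs ht => simp only [map_add, TensorProduct.add_tmul, hs, ht]
  | h a b => rfl

namespace Data

variable (D : Data k H) (F : (H ⊗[k] H)ˣ)

lemma twist_Δ (h : H) : (D.twist F).Δ h = F * D.Δ h * ↑F⁻¹ := rfl

lemma twist_idΔ (x : H ⊗[k] H) :
    (D.twist F).idΔ x = i23 k H F * D.idΔ x * i23 k H ↑F⁻¹ := by
  induction x using ind₂ with
  | hadd s t hs ht => simp only [map_add, hs, ht, mul_add, add_mul]
  | h a b =>
    change a ⊗ₜ (F * D.Δ b * ↑F⁻¹) = (1 ⊗ₜ F.1) * (a ⊗ₜ D.Δ b) * (1 ⊗ₜ (F⁻¹).1)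
    simp [Algebra.TensorProduct.tmul_mul_tmul]

lemma twist_Δid (x : H ⊗[k] H) :
    (D.twist F).Δid x = i12 k H F * D.Δid x * i12 k H ↑F⁻¹ := by
  induction x using ind₂ with
  | hadd s t hs ht => simp only [map_add, hs, ht, mul_add, add_mul]
  | h a b =>
    rw [i12_eq_assoc, i12_eq_assoc]
    change Algebra.TensorProduct.assoc k k k H H H ((F * D.Δ a * ↑F⁻¹) ⊗ₜ b) =
      _ * Algebra.TensorProduct.assoc k k k H H H (D.Δ a ⊗ₜ b) * _
    rw [← map_mul, ← map_mul]
    simp [Algebra.TensorProduct.tmul_mul_tmul]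

lemma twist_ididΔ (x : H ⊗[k] (H ⊗[k] H)) :
    (D.twist F).ididΔ x = i234 k H (i23 k H F) * D.ididΔ x * i234 k H (i23 k H ↑F⁻¹) := by
  induction x with
  | zero => simp only [map_zero, t4_mul_zero, t4_zero_mul]
  | add s t hs ht => simp only [map_add, hs, ht, t4_mul_add, t4_add_mul]
  | tmul a b =>
    change a ⊗ₜ (D.twist F).idΔ b = (1 ⊗ₜ _) * (a ⊗ₜ D.idΔ b) * (1 ⊗ₜ _)
    rw [twist_idΔ, Algebra.TensorProduct.tmul_mul_tmul, Algebra.TensorProduct.tmul_mul_tmul,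
      one_mul, mul_one]

lemma twist_idΔid (x : H ⊗[k] (H ⊗[k] H)) :
    (D.twist F).idΔid x = i234 k H (i12 k H F) * D.idΔid x * i234 k H (i12 k H ↑F⁻¹) := by
  induction x with
  | zero => simp only [map_zero, t4_mul_zero, t4_zero_mul]
  | add s t hs ht => simp only [map_add, hs, ht, t4_mul_add, t4_add_mul]
  | tmul a b =>
    change a ⊗ₜ (D.twist F).Δid b = (1 ⊗ₜ _) * (a ⊗ₜ D.Δid b) * (1 ⊗ₜ _)
    rw [twist_Δid, Algebra.TensorProduct.tmul_mul_tmul, Algebra.TensorProduct.tmul_mul_tmul,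
      one_mul, mul_one]

lemma i123_i12_eq_assoc (x : H ⊗[k] H) : i123 k H (i12 k H x) =
    Algebra.TensorProduct.assoc k k k H H (H ⊗[k] H) (x ⊗ₜ 1) := by
  induction x using ind₂ with
  | hadd s t hs ht => simp only [map_add, TensorProduct.add_tmul, hs, ht]
  | h a b => rfl

lemma twist_Δidid (x : H ⊗[k] (H ⊗[k] H)) :
    (D.twist F).Δidid x = i123 k H (i12 k H F) * D.Δidid x * i123 k H (i12 k H ↑F⁻¹) := by
  induction x with
  | zero => simp only [map_zero, t4_mul_zero, t4_zero_mul]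
  | add s t hs ht => simp only [map_add, hs, ht, t4_mul_add, t4_add_mul]
  | tmul a b =>
    rw [i123_i12_eq_assoc, i123_i12_eq_assoc]
    change Algebra.TensorProduct.assoc k k k H H (H ⊗[k] H) ((F * D.Δ a * ↑F⁻¹) ⊗ₜ b) =
      _ * Algebra.TensorProduct.assoc k k k H H (H ⊗[k] H) (D.Δ a ⊗ₜ b) * _
    rw [← map_mul, ← map_mul, Algebra.TensorProduct.tmul_mul_tmul,
      Algebra.TensorProduct.tmul_mul_tmul, one_mul, mul_one]

/-! Compatibilities of the maps between tensor powers of `H`. -/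

lemma ididΔ_i23 (x : H ⊗[k] H) : D.ididΔ (i23 k H x) = i234 k H (D.idΔ x) := rfl

lemma idΔid_i23 (x : H ⊗[k] H) : D.idΔid (i23 k H x) = i234 k H (D.Δid x) := rfl

lemma i123_i23 (x : H ⊗[k] H) : i123 k H (i23 k H x) = i234 k H (i12 k H x) := rfl

lemma ididΔ_i12 (x : H ⊗[k] H) : D.ididΔ (i12 k H x) = i123 k H (i12 k H x) := by
  induction x using ind₂ with
  | hadd s t hs ht => simp only [map_add, hs, ht]
  | h a b =>
    change a ⊗ₜ (b ⊗ₜ D.Δ 1) = a ⊗ₜ (b ⊗ₜ (1 ⊗ₜ 1))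
    rw [map_one]; rfl

lemma Δidid_i23 (x : H ⊗[k] H) : D.Δidid (i23 k H x) = i234 k H (i23 k H x) := by
  change Algebra.TensorProduct.assoc k k k H H (H ⊗[k] H) (D.Δ 1 ⊗ₜ x) = _
  rw [map_one]; rfl

lemma idΔid_i12 (x : H ⊗[k] H) : D.idΔid (i12 k H x) = i123 k H (D.idΔ x) := by
  induction x using ind₂ with
  | hadd s t hs ht => simp only [map_add, hs, ht]
  | h a b =>
    change a ⊗ₜ (Algebra.TensorProduct.assoc k k k H H H (D.Δ b ⊗ₜ 1)) = a ⊗ₜ (i12 k H (D.Δ b))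
    rw [i12_eq_assoc]

lemma Δidid_tmul_one (a b : H) :
    Algebra.TensorProduct.assoc k k k H H (H ⊗[k] H) (D.Δ a ⊗ₜ (b ⊗ₜ 1)) =
      i123 k H (D.Δid (a ⊗ₜ b)) := by
  have key (s : H ⊗[k] H) : Algebra.TensorProduct.assoc k k k H H (H ⊗[k] H) (s ⊗ₜ (b ⊗ₜ 1)) =
      i123 k H (Algebra.TensorProduct.assoc k k k H H H (s ⊗ₜ b)) := by
    induction s using ind₂ with
    | hadd s t hs ht => simp only [map_add, TensorProduct.add_tmul, hs, ht]
    | h c d => rfl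
  exact key _

lemma Δidid_i12 (x : H ⊗[k] H) : D.Δidid (i12 k H x) = i123 k H (D.Δid x) := by
  induction x using ind₂ with
  | hadd s t hs ht => simp only [map_add, hs, ht]
  | h a b => exact Δidid_tmul_one D a b

lemma ididΔ_Δid (x : H ⊗[k] H) : D.ididΔ (D.Δid x) = D.Δidid (D.idΔ x) := by
  induction x using ind₂ with
  | hadd s t hs ht => simp only [map_add, hs, ht]
  | h a b =>
    have key (s : H ⊗[k] H) : D.ididΔ (Algebra.TensorProduct.assoc k k k H H H (s ⊗ₜ b)) =
        Algebra.TensorProduct.assoc k k k H H (H ⊗[k] H) (s ⊗ₜ D.Δ b) := by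
      induction s using ind₂ with
      | hadd s t hs ht => simp only [map_add, TensorProduct.add_tmul, hs, ht]
      | h c d => rfl
    exact key _

lemma i23_mul_i123_i12_comm (x y : H ⊗[k] H) : i234 k H (i23 k H x) * i123 k H (i12 k H y) =
    i123 k H (i12 k H y) * i234 k H (i23 k H x) := by
  have h : i234 k H (i23 k H x) =
      Algebra.TensorProduct.assoc k k k H H (H ⊗[k] H) (1 ⊗ₜ x) := rfl
  rw [i123_i12_eq_assoc, h, ← map_mul, ← map_mul, Algebra.TensorProduct.tmul_mul_tmul,
    Algebra.TensorProduct.tmul_mul_tmul, one_mul, mul_one, one_mul, mul_one]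

/-- The reassociation `((a ⊗ b ⊗ c) ⊗ d) ↦ a ⊗ b ⊗ c ⊗ d`. -/
def assoc₃₁ : (H ⊗[k] (H ⊗[k] H)) ⊗[k] H →ₐ[k] H ⊗[k] (H ⊗[k] (H ⊗[k] H)) :=
  (Algebra.TensorProduct.map (AlgHom.id k H)
    (Algebra.TensorProduct.assoc k k k H H H).toAlgHom).comp
    (Algebra.TensorProduct.assoc k k k H (H ⊗[k] H) H).toAlgHom

lemma Δidid_Δid_tmul (a b : H) :
    D.Δidid (D.Δid (a ⊗ₜ b)) = assoc₃₁ (D.Δid (D.Δ a) ⊗ₜ b) := by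
  have key (s : H ⊗[k] H) : D.Δidid (Algebra.TensorProduct.assoc k k k H H H (s ⊗ₜ b)) =
      assoc₃₁ (D.Δid s ⊗ₜ b) := by
    induction s using ind₂ with
    | hadd s t hs ht => simp only [map_add, TensorProduct.add_tmul, hs, ht]
    | h c d =>
      have key' (t : H ⊗[k] H) :
          Algebra.TensorProduct.assoc k k k H H (H ⊗[k] H) (t ⊗ₜ (d ⊗ₜ b)) =
          assoc₃₁ (Algebra.TensorProduct.assoc k k k H H H (t ⊗ₜ d) ⊗ₜ b) := by
        induction t using ind₂ with
        | hadd s t hs ht => simp only [map_add, TensorProduct.add_tmul, hs, ht]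
        | h e f => rfl
      exact key' _
  exact key _

lemma idΔid_Δid_tmul (a b : H) :
    D.idΔid (D.Δid (a ⊗ₜ b)) = assoc₃₁ (D.idΔ (D.Δ a) ⊗ₜ b) := by
  have key (s : H ⊗[k] H) : D.idΔid (Algebra.TensorProduct.assoc k k k H H H (s ⊗ₜ b)) =
      assoc₃₁ (D.idΔ s ⊗ₜ b) := by
    induction s using ind₂ with
    | hadd s t hs ht => simp only [map_add, TensorProduct.add_tmul, hs, ht]
    | h c d => rfl
  exact key _

lemma i123_eq_assoc₃₁ (x : H ⊗[k] (H ⊗[k] H)) : i123 k H x = assoc₃₁ (x ⊗ₜ 1) := by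
  induction x using ind₃ with
  | hadd s t hs ht => simp only [map_add, TensorProduct.add_tmul, hs, ht]
  | h a b c => rfl

section Group

variable {G : Type*} [Group G]

lemma pentagon_twist_aux {a b c p q q' r u w v y z φ₁ φ₂ φ₃ φ₄ φ₅ : G} (hab : a * b = b * a)
    (h₁ : q * φ₃ = φ₃ * q') (h₂ : φ₅ * u = w * φ₅) (hp : φ₁ * φ₂ = φ₃ * φ₄ * φ₅) :
    (a * (p * q * φ₁ * r⁻¹ * b⁻¹) * a⁻¹) * (b * (a * r * φ₂ * u⁻¹ * v⁻¹) * b⁻¹) =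
      (a * p * φ₃ * y⁻¹ * c⁻¹) * (c * (y * q' * φ₄ * w⁻¹ * z⁻¹) * c⁻¹) *
        (c * z * φ₅ * v⁻¹ * b⁻¹) := by
  have hab' : b⁻¹ * a⁻¹ * (b * a) = 1 := by rw [← hab]; group
  have h₂' : w⁻¹ * φ₅ = φ₅ * u⁻¹ := by rw [inv_mul_eq_iff_eq_mul, ← mul_assoc, ← h₂]; group
  calc _ = a * p * q * φ₁ * r⁻¹ * (b⁻¹ * a⁻¹ * (b * a)) * r * φ₂ * u⁻¹ * v⁻¹ * b⁻¹ := by group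
    _ = a * p * q * (φ₁ * φ₂) * u⁻¹ * v⁻¹ * b⁻¹ := by rw [hab']; group
    _ = a * p * (q * φ₃) * φ₄ * (φ₅ * u⁻¹) * v⁻¹ * b⁻¹ := by rw [hp]; group
    _ = _ := by rw [h₁, ← h₂']; group

lemma hexagon_forward_twist_aux {a b c d e f l m n x y r r' φ φ₁ φ₂ ψ : G}
    (h₁ : r' * y = x * r') (h₂ : r * m = n * r)
    (hR : ψ = φ₁⁻¹ * r' * φ₂ * r * φ⁻¹) :
    a * (b * ψ * c⁻¹) * a⁻¹ = (a * b * φ₁⁻¹ * x⁻¹ * d⁻¹) * (d * r' * e⁻¹) *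
      (e * y * φ₂ * n⁻¹ * f⁻¹) * (f * r * l⁻¹) * (l * m * φ⁻¹ * c⁻¹ * a⁻¹) := by
  have h₁' : x⁻¹ * r' * y = r' := by rw [mul_assoc, h₁]; group
  have h₂' : n⁻¹ * r * m = r := by rw [mul_assoc, h₂]; group
  calc _ = a * b * φ₁⁻¹ * (x⁻¹ * r' * y) * φ₂ * (n⁻¹ * r * m) * φ⁻¹ * c⁻¹ * a⁻¹ := by
        rw [hR, h₁', h₂']; group
    _ = _ := by group

lemma hexagon_reverse_twist_aux {a b c d e f l m n x y r r' φ φ₁ φ₂ ψ : G}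
    (h₁ : r' * y = x * r') (h₂ : r * m = n * r)
    (hR : ψ = φ₁ * r' * φ₂⁻¹ * r * φ) :
    a * (b * ψ * c⁻¹) * a⁻¹ = (a * b * φ₁ * x⁻¹ * d⁻¹) * (d * r' * e⁻¹) *
      (e * y * φ₂⁻¹ * n⁻¹ * f⁻¹) * (f * r * l⁻¹) * (l * m * φ * c⁻¹ * a⁻¹) := by
  have h₁' : x⁻¹ * r' * y = r' := by rw [mul_assoc, h₁]; group
  have h₂' : n⁻¹ * r * m = r := by rw [mul_assoc, h₂]; group
  calc _ = a * b * φ₁ * (x⁻¹ * r' * y) * φ₂⁻¹ * (n⁻¹ * r * m) * φ * c⁻¹ * a⁻¹ := by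
        rw [hR, h₁', h₂']; group
    _ = _ := by group

end Group


/-- The map on units induced by an algebra homomorphism. -/
abbrev um {A B : Type u} [Semiring A] [Algebra k A] [Semiring B] [Algebra k B] (f : A →ₐ[k] B) :
    Aˣ →* Bˣ := Units.map (f : A →* B)


lemma twist_φ : (D.twist F).φ = um (i23 k H) F * um D.idΔ F * D.φ * (um D.Δid F)⁻¹ *
    (um (i12 k H) F)⁻¹ := rfl

lemma twist_R : (D.twist F).R = um (Algebra.TensorProduct.comm k H H).toAlgHom F * D.R * F⁻¹ := rfl

lemma p132_i12 (x : H ⊗[k] H) : p132 k H (i12 k H x) = i13 k H x := by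
  induction x using ind₂ with
  | hadd s t hs ht => simp only [map_add, hs, ht]
  | h a b => rfl

lemma p213_i23 (x : H ⊗[k] H) : p213 k H (i23 k H x) = i13 k H x := by
  induction x using ind₂ with
  | hadd s t hs ht => simp only [map_add, hs, ht]
  | h a b => rfl

lemma p213_i12 (x : H ⊗[k] H) :
    p213 k H (i12 k H x) = i12 k H (Algebra.TensorProduct.comm k H H x) := by
  induction x using ind₂ with
  | hadd s t hs ht => simp only [map_add, hs, ht]
  | h a b => rfl

lemma p132_i13 (x : H ⊗[k] H) : p132 k H (i13 k H x) = i12 k H x := by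
  induction x using ind₂ with
  | hadd s t hs ht => simp only [map_add, hs, ht]
  | h a b => rfl

lemma p213_i13 (x : H ⊗[k] H) : p213 k H (i13 k H x) = i23 k H x := by
  induction x using ind₂ with
  | hadd s t hs ht => simp only [map_add, hs, ht]
  | h a b => rfl

lemma p132_i23 (x : H ⊗[k] H) :
    p132 k H (i23 k H x) = i23 k H (Algebra.TensorProduct.comm k H H x) := rfl

lemma p213_assoc (s : H ⊗[k] H) (b : H) :
    p213 k H (Algebra.TensorProduct.assoc k k k H H H (s ⊗ₜ b)) =
      Algebra.TensorProduct.assoc k k k H H H (Algebra.TensorProduct.comm k H H s ⊗ₜ b) := by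
  induction s using ind₂ with
  | hadd s t hs ht => simp only [map_add, TensorProduct.add_tmul, hs, ht]
  | h c d => rfl

lemma p231_apply (x : H ⊗[k] (H ⊗[k] H)) : p231 k H x = p213 k H (p132 k H x) := rfl

lemma p312_apply (x : H ⊗[k] (H ⊗[k] H)) : p312 k H x = p132 k H (p213 k H x) := rfl

lemma p231_Δid (x : H ⊗[k] H) :
    p231 k H (D.Δid x) = D.idΔ (Algebra.TensorProduct.comm k H H x) := by
  induction x using ind₂ with
  | hadd s t hs ht => simp only [map_add, hs, ht]
  | h a b =>
    have key (s : H ⊗[k] H) :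
        p231 k H (Algebra.TensorProduct.assoc k k k H H H (s ⊗ₜ b)) = b ⊗ₜ s := by
      induction s using ind₂ with
      | hadd s t hs ht => simp only [map_add, TensorProduct.add_tmul, TensorProduct.tmul_add, hs, ht]
      | h c d => rfl
    exact key _

lemma p312_idΔ (x : H ⊗[k] H) :
    p312 k H (D.idΔ x) = D.Δid (Algebra.TensorProduct.comm k H H x) := by
  induction x using ind₂ with
  | hadd s t hs ht => simp only [map_add, hs, ht]
  | h a b =>
    have key (s : H ⊗[k] H) :
        p312 k H (a ⊗ₜ s) = Algebra.TensorProduct.assoc k k k H H H (s ⊗ₜ a) := by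
      induction s using ind₂ with
      | hadd s t hs ht => simp only [map_add, TensorProduct.add_tmul, TensorProduct.tmul_add, hs, ht]
      | h c d => rfl
    exact key _

lemma contrL_contrL (c : H) (s t : H ⊗[k] H) :
    contrL D.antipode (contrL D.antipode c s) t = contrL D.antipode c (s * t) := by
  induction t using ind₂ with
  | hadd x y hx hy => simp only [mul_add, map_add, hx, hy]
  | h a b => rw [contrL_mul, contrL_tmul]

lemma contrR_contrR (c : H) (s t : H ⊗[k] H) :
    contrR D.antipode (contrR D.antipode c s) t = contrR D.antipode c (t * s) := by
  induction t using ind₂ with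
  | hadd x y hx hy => simp only [add_mul, map_add, hx, hy]
  | h a b => rw [contrR_mul, contrR_tmul]

lemma contrRL_contr (c d : H) (s t : H ⊗[k] H) (z : H ⊗[k] (H ⊗[k] H)) :
    contrRL D.antipode (contrR D.antipode c s) (contrL D.antipode d t) z =
      contrRL D.antipode c d (i23 k H t * z * i12 k H s) := by
  induction z using ind₃ with
  | hadd x y hx hy => simp only [map_add, mul_add, add_mul, hx, hy]
  | h a b c =>
    rw [contrRL_tmul]
    induction s using ind₂ with
    | hadd x y hx hy => simp only [map_add, mul_add, add_mul, hx, hy]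
    | h p q =>
      induction t using ind₂ with
      | hadd x y hx hy => simp only [map_add, mul_add, add_mul, hx, hy]
      | h x y =>
        simp [Algebra.TensorProduct.tmul_mul_tmul, contrRL_tmul, Data.antipode_mul, mul_assoc]

lemma contrLR_contr (c d : H) (s t : H ⊗[k] H) (z : H ⊗[k] (H ⊗[k] H)) :
    contrLR D.antipode (contrL D.antipode c s) (contrR D.antipode d t) z =
      contrLR D.antipode c d (i12 k H s * z * i23 k H t) := by
  induction z using ind₃ with
  | hadd x y hx hy => simp only [map_add, mul_add, add_mul, hx, hy]
  | h a b c =>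
    rw [contrLR_tmul]
    induction s using ind₂ with
    | hadd x y hx hy => simp only [map_add, mul_add, add_mul, hx, hy]
    | h p q =>
      induction t using ind₂ with
      | hadd x y hx hy => simp only [map_add, mul_add, add_mul, hx, hy]
      | h x y =>
        simp [Algebra.TensorProduct.tmul_mul_tmul, contrLR_tmul, Data.antipode_mul, mul_assoc]

lemma idεid_i12 (x : H ⊗[k] H) : D.idεid (i12 k H x) = D.idε x ⊗ₜ 1 := by
  induction x using ind₂ with
  | hadd s t hs ht => simp only [map_add, TensorProduct.add_tmul, hs, ht]
  | h a b =>
    change a ⊗ₜ (D.ε b • (1 : H)) = (D.ε b • a) ⊗ₜ (1 : H)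
    rw [TensorProduct.tmul_smul, TensorProduct.smul_tmul']

lemma twist_φ_inv_coe : (↑(D.twist F).φ⁻¹ : H ⊗[k] (H ⊗[k] H)) =
    i12 k H F * (D.Δid F * ↑D.φ⁻¹ * D.idΔ ↑F⁻¹) * i23 k H ↑F⁻¹ := by
  rw [twist_φ]
  simp only [mul_inv_rev, inv_inv, Units.val_mul, mul_assoc]
  rfl

lemma εid_inv [D.IsCochainTwist F] : D.εid ↑F⁻¹ = 1 := by
  have := congrArg D.εid F.inv_mul
  rwa [map_mul, Data.IsCochainTwist.counit_left (F := F), mul_one, map_one] at this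

lemma idε_inv [D.IsCochainTwist F] : D.idε ↑F⁻¹ = 1 := by
  have := congrArg D.idε F.inv_mul
  rwa [map_mul, Data.IsCochainTwist.counit_right (F := F), mul_one, map_one] at this

variable [D.IsQuasitriangular]

lemma ididΔ_idΔ_mul (x : H ⊗[k] H) :
    D.ididΔ (D.idΔ x) * i234 k H D.φ = i234 k H D.φ * D.idΔid (D.idΔ x) := by
  induction x using ind₂ with
  | hadd s t hs ht => simp only [map_add, t4_add_mul, t4_mul_add, hs, ht]
  | h a b =>
    change (a ⊗ₜ D.idΔ (D.Δ b)) * (1 ⊗ₜ D.φ.1) = (1 ⊗ₜ D.φ.1) * (a ⊗ₜ D.Δid (D.Δ b))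
    rw [Algebra.TensorProduct.tmul_mul_tmul, Algebra.TensorProduct.tmul_mul_tmul,
      IsQuasitriangular.coassoc, one_mul, mul_one]

lemma i123_φ_mul (x : H ⊗[k] H) :
    i123 k H D.φ * D.Δidid (D.Δid x) = D.idΔid (D.Δid x) * i123 k H D.φ := by
  induction x using ind₂ with
  | hadd s t hs ht => simp only [map_add, t4_add_mul, t4_mul_add, hs, ht]
  | h a b =>
    rw [Δidid_Δid_tmul, idΔid_Δid_tmul, i123_eq_assoc₃₁, ← map_mul, ← map_mul,
      Algebra.TensorProduct.tmul_mul_tmul, Algebra.TensorProduct.tmul_mul_tmul,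
      IsQuasitriangular.coassoc, one_mul, mul_one]




lemma i12_R_mul_Δid (x : H ⊗[k] H) :
    i12 k H D.R * D.Δid x = p213 k H (D.Δid x) * i12 k H D.R := by
  induction x using ind₂ with
  | hadd s t hs ht => simp only [map_add, mul_add, add_mul, hs, ht]
  | h a b =>
    change _ * Algebra.TensorProduct.assoc k k k H H H (D.Δ a ⊗ₜ b) =
      p213 k H (Algebra.TensorProduct.assoc k k k H H H (D.Δ a ⊗ₜ b)) * _
    rw [p213_assoc, i12_eq_assoc, ← map_mul, ← map_mul, Algebra.TensorProduct.tmul_mul_tmul,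
      Algebra.TensorProduct.tmul_mul_tmul, IsQuasitriangular.R_comm, one_mul, mul_one]

lemma i23_R_mul_idΔ (x : H ⊗[k] H) :
    i23 k H D.R * D.idΔ x = p132 k H (D.idΔ x) * i23 k H D.R := by
  induction x using ind₂ with
  | hadd s t hs ht => simp only [map_add, mul_add, add_mul, hs, ht]
  | h a b =>
    change (1 ⊗ₜ D.R.1) * (a ⊗ₜ D.Δ b) =
      (a ⊗ₜ Algebra.TensorProduct.comm k H H (D.Δ b)) * (1 ⊗ₜ D.R.1)
    rw [Algebra.TensorProduct.tmul_mul_tmul,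
      Algebra.TensorProduct.tmul_mul_tmul, IsQuasitriangular.R_comm, one_mul, mul_one]

lemma i13_R_mul_p213_idΔ (x : H ⊗[k] H) :
    i13 k H D.R * p213 k H (D.idΔ x) = p231 k H (D.idΔ x) * i13 k H D.R := by
  rw [← p213_i23, ← map_mul, i23_R_mul_idΔ, map_mul, p231_apply]

lemma i13_R_mul_p132_Δid (x : H ⊗[k] H) :
    i13 k H D.R * p132 k H (D.Δid x) = p312 k H (D.Δid x) * i13 k H D.R := by
  rw [← p132_i12, ← map_mul, i12_R_mul_Δid, map_mul, p312_apply]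


lemma twist_idΔ_R : (D.twist F).idΔ (D.twist F).R =
    p231 k H ↑(D.twist F).φ⁻¹ * i13 k H (D.twist F).R * p213 k H (D.twist F).φ *
      i12 k H (D.twist F).R * ↑(D.twist F).φ⁻¹ := by
  let σ := (Algebra.TensorProduct.comm k H H).toAlgHom
  have h := hexagon_forward_twist_aux (a := um (i23 k H) F) (c := um D.idΔ F)
    (b := um D.idΔ (um σ F)) (d := um (i13 k H) (um σ F))
    (e := um (i13 k H) F) (f := um (i12 k H) (um σ F)) (l := um (i12 k H) F)
    (Units.ext (i13_R_mul_p213_idΔ D F) : um (i13 k H) D.R * um (p213 k H).toAlgHom (um D.idΔ F) =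
      um (p231 k H).toAlgHom (um D.idΔ F) * um (i13 k H) D.R)
    (Units.ext (i12_R_mul_Δid D F) : um (i12 k H) D.R * um D.Δid F =
      um (p213 k H).toAlgHom (um D.Δid F) * um (i12 k H) D.R)
    (Units.ext IsQuasitriangular.idΔ_R : um D.idΔ D.R =
      (um (p231 k H).toAlgHom D.φ)⁻¹ * um (i13 k H) D.R * um (p213 k H).toAlgHom D.φ *
        um (i12 k H) D.R * D.φ⁻¹)
  have e₁ : um (p231 k H).toAlgHom (um (i12 k H) F) = um (i23 k H) F := Units.ext (by
    change p213 k H (p132 k H (i12 k H F)) = _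
    rw [p132_i12, p213_i13]; rfl)
  have e₂ : um (p231 k H).toAlgHom (um D.Δid F) = um D.idΔ (um σ F) := Units.ext (p231_Δid D F)
  have e₃ : um (p231 k H).toAlgHom (um (i23 k H) F) = um (i13 k H) (um σ F) := Units.ext (by
    change p213 k H (p132 k H (i23 k H F)) = _
    rw [p132_i23, p213_i23]; rfl)
  have e₄ : um (p213 k H).toAlgHom (um (i23 k H) F) = um (i13 k H) F := Units.ext (p213_i23 F.1)
  have e₅ : um (p213 k H).toAlgHom (um (i12 k H) F) = um (i12 k H) (um σ F) :=
    Units.ext (p213_i12 F.1)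
  have e₆ (u : (H ⊗[k] H)ˣ) : um (D.twist F).idΔ u = um (i23 k H) F * um D.idΔ u *
    (um (i23 k H) F)⁻¹ := Units.ext (twist_idΔ D F u)
  have key : um (D.twist F).idΔ (D.twist F).R = (um (p231 k H).toAlgHom (D.twist F).φ)⁻¹ *
      um (i13 k H) (D.twist F).R * um (p213 k H).toAlgHom (D.twist F).φ *
        um (i12 k H) (D.twist F).R * (D.twist F).φ⁻¹ := by
    rw [e₆, twist_R, twist_φ]
    simp only [map_mul, map_inv, e₁, e₂, e₃, e₄, e₅, mul_inv_rev, inv_inv] at h ⊢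
    simp only [mul_assoc] at h ⊢
    exact h
  exact congrArg Units.val key

lemma twist_Δid_R : (D.twist F).Δid (D.twist F).R =
    p312 k H (D.twist F).φ * i13 k H (D.twist F).R * p132 k H ↑(D.twist F).φ⁻¹ *
      i23 k H (D.twist F).R * (D.twist F).φ := by
  let σ := (Algebra.TensorProduct.comm k H H).toAlgHom
  have h := hexagon_reverse_twist_aux (a := um (i12 k H) F) (c := um D.Δid F)
    (b := um D.Δid (um σ F)) (d := um (i13 k H) (um σ F))
    (e := um (i13 k H) F) (f := um (i23 k H) (um σ F)) (l := um (i23 k H) F)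
    (Units.ext (i13_R_mul_p132_Δid D F) : um (i13 k H) D.R * um (p132 k H).toAlgHom (um D.Δid F) =
      um (p312 k H).toAlgHom (um D.Δid F) * um (i13 k H) D.R)
    (Units.ext (i23_R_mul_idΔ D F) : um (i23 k H) D.R * um D.idΔ F =
      um (p132 k H).toAlgHom (um D.idΔ F) * um (i23 k H) D.R)
    (Units.ext IsQuasitriangular.Δid_R : um D.Δid D.R =
      um (p312 k H).toAlgHom D.φ * um (i13 k H) D.R * (um (p132 k H).toAlgHom D.φ)⁻¹ *
        um (i23 k H) D.R * D.φ)
  have e₁ : um (p312 k H).toAlgHom (um (i23 k H) F) = um (i12 k H) F := Units.ext (by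
    change p132 k H (p213 k H (i23 k H F)) = _
    rw [p213_i23, p132_i13]; rfl)
  have e₂ : um (p312 k H).toAlgHom (um D.idΔ F) = um D.Δid (um σ F) := Units.ext (p312_idΔ D F)
  have e₃ : um (p312 k H).toAlgHom (um (i12 k H) F) = um (i13 k H) (um σ F) := Units.ext (by
    change p132 k H (p213 k H (i12 k H F)) = _
    rw [p213_i12, p132_i12]; rfl)
  have e₄ : um (p132 k H).toAlgHom (um (i12 k H) F) = um (i13 k H) F := Units.ext (p132_i12 F.1)
  have e₅ : um (p132 k H).toAlgHom (um (i23 k H) F) = um (i23 k H) (um σ F) :=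
    Units.ext (p132_i23 F.1)
  have e₆ (u : (H ⊗[k] H)ˣ) : um (D.twist F).Δid u = um (i12 k H) F * um D.Δid u *
    (um (i12 k H) F)⁻¹ := Units.ext (twist_Δid D F u)
  have key : um (D.twist F).Δid (D.twist F).R = um (p312 k H).toAlgHom (D.twist F).φ *
      um (i13 k H) (D.twist F).R * (um (p132 k H).toAlgHom (D.twist F).φ)⁻¹ *
        um (i23 k H) (D.twist F).R * (D.twist F).φ := by
    rw [e₆, twist_R, twist_φ]
    simp only [map_mul, map_inv, e₁, e₂, e₃, e₄, e₅, mul_inv_rev, inv_inv] at h ⊢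
    simp only [mul_assoc] at h ⊢
    exact h
  exact congrArg Units.val key

lemma twist_pentagon : (D.twist F).ididΔ (D.twist F).φ * (D.twist F).Δidid (D.twist F).φ =
    i234 k H (D.twist F).φ * (D.twist F).idΔid (D.twist F).φ * i123 k H (D.twist F).φ := by
  have hab : um (i234 k H) (um (i23 k H) F) * um (i123 k H) (um (i12 k H) F) =
      um (i123 k H) (um (i12 k H) F) * um (i234 k H) (um (i23 k H) F) :=
    Units.ext (i23_mul_i123_i12_comm F.1 F.1)
  have h₁ : um D.ididΔ (um D.idΔ F) * um (i234 k H) D.φ =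
      um (i234 k H) D.φ * um D.idΔid (um D.idΔ F) := Units.ext (ididΔ_idΔ_mul D F)
  have h₂ : um (i123 k H) D.φ * um D.Δidid (um D.Δid F) =
      um D.idΔid (um D.Δid F) * um (i123 k H) D.φ := Units.ext (i123_φ_mul D F)
  have hp : um D.ididΔ D.φ * um D.Δidid D.φ =
      um (i234 k H) D.φ * um D.idΔid D.φ * um (i123 k H) D.φ :=
    Units.ext IsQuasitriangular.pentagon
  have h := pentagon_twist_aux (c := um (i234 k H) (um (i12 k H) F))
    (p := um (i234 k H) (um D.idΔ F)) (r := um D.Δidid (um D.idΔ F))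
    (v := um (i123 k H) (um D.Δid F)) (y := um (i234 k H) (um D.Δid F))
    (z := um (i123 k H) (um D.idΔ F)) hab h₁ h₂ hp
  have t₁ (u : (H ⊗[k] (H ⊗[k] H))ˣ) : um (D.twist F).ididΔ u =
    um (i234 k H) (um (i23 k H) F) * um D.ididΔ u * (um (i234 k H) (um (i23 k H) F))⁻¹ :=
    Units.ext (twist_ididΔ D F u)
  have t₂ (u : (H ⊗[k] (H ⊗[k] H))ˣ) : um (D.twist F).idΔid u =
    um (i234 k H) (um (i12 k H) F) * um D.idΔid u * (um (i234 k H) (um (i12 k H) F))⁻¹ :=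
    Units.ext (twist_idΔid D F u)
  have t₃ (u : (H ⊗[k] (H ⊗[k] H))ˣ) : um (D.twist F).Δidid u =
    um (i123 k H) (um (i12 k H) F) * um D.Δidid u * (um (i123 k H) (um (i12 k H) F))⁻¹ :=
    Units.ext (twist_Δidid D F u)
  have e₁ : um D.ididΔ (um (i23 k H) F) = um (i234 k H) (um D.idΔ F) := Units.ext (ididΔ_i23 D F)
  have e₂ : um D.ididΔ (um D.Δid F) = um D.Δidid (um D.idΔ F) := Units.ext (ididΔ_Δid D F)
  have e₃ : um D.ididΔ (um (i12 k H) F) = um (i123 k H) (um (i12 k H) F) :=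
    Units.ext (ididΔ_i12 D F)
  have e₄ : um D.Δidid (um (i23 k H) F) = um (i234 k H) (um (i23 k H) F) :=
    Units.ext (Δidid_i23 D F)
  have e₅ : um D.Δidid (um (i12 k H) F) = um (i123 k H) (um D.Δid F) := Units.ext (Δidid_i12 D F)
  have e₆ : um D.idΔid (um (i23 k H) F) = um (i234 k H) (um D.Δid F) := Units.ext (idΔid_i23 D F)
  have e₇ : um D.idΔid (um (i12 k H) F) = um (i123 k H) (um D.idΔ F) := Units.ext (idΔid_i12 D F)
  have e₈ : um (i123 k H) (um (i23 k H) F) = um (i234 k H) (um (i12 k H) F) :=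
    Units.ext (i123_i23 F.1)
  have key : um (D.twist F).ididΔ (D.twist F).φ * um (D.twist F).Δidid (D.twist F).φ =
      um (i234 k H) (D.twist F).φ * um (D.twist F).idΔid (D.twist F).φ *
        um (i123 k H) (D.twist F).φ := by
    rw [t₁, t₂, t₃, twist_φ]
    simp only [map_mul, map_inv, e₁, e₂, e₃, e₄, e₅, e₆, e₇, e₈]
    exact h
  exact congrArg Units.val key

lemma idεid_idΔ (x : H ⊗[k] H) : D.idεid (D.idΔ x) = x := by
  induction x using ind₂ with
  | hadd s t hs ht => simp only [map_add, hs, ht]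
  | h a b =>
    change a ⊗ₜ D.εid (D.Δ b) = _
    rw [IsQuasitriangular.counit_left]

lemma idεid_Δid (x : H ⊗[k] H) : D.idεid (D.Δid x) = x := by
  induction x using ind₂ with
  | hadd s t hs ht => simp only [map_add, hs, ht]
  | h a b =>
    have key (s : H ⊗[k] H) : D.idεid (Algebra.TensorProduct.assoc k k k H H H (s ⊗ₜ b)) =
        D.idε s ⊗ₜ b := by
      induction s using ind₂ with
      | hadd s t hs ht => simp only [map_add, TensorProduct.add_tmul, hs, ht]
      | h c d =>
        change c ⊗ₜ (D.ε d • b) = (D.ε d • c) ⊗ₜ b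
        rw [TensorProduct.tmul_smul, TensorProduct.smul_tmul']
    exact (key _).trans (by rw [AlgHom.toLinearMap_apply, IsQuasitriangular.counit_right])

/-- The twist of a quasitriangular quasi-Hopf algebra by a cochain twist. -/
theorem twist_isQuasitriangular [D.IsCochainTwist F] : (D.twist F).IsQuasitriangular where
  counit_left h := by
    change D.εid (F * D.Δ h * ↑F⁻¹) = h
    rw [map_mul, map_mul, εid_inv, IsCochainTwist.counit_left, IsQuasitriangular.counit_left,
      one_mul, mul_one]
  counit_right h := by
    change D.idε (F * D.Δ h * ↑F⁻¹) = h
    rw [map_mul, map_mul, idε_inv, IsCochainTwist.counit_right, IsQuasitriangular.counit_right,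
      one_mul, mul_one]
  coassoc h := by
    rw [twist_idΔ, twist_Δid, twist_Δ, twist_φ_coe, map_mul, map_mul, map_mul, map_mul]
    have e₁ : i23 k H ↑F⁻¹ * i23 k H F = 1 := by rw [← map_mul, F.inv_mul, map_one]
    have e₂ : D.idΔ ↑F⁻¹ * D.idΔ F = 1 := by rw [← map_mul, F.inv_mul, map_one]
    have e₃ : i12 k H ↑F⁻¹ * i12 k H F = 1 := by rw [← map_mul, F.inv_mul, map_one]
    have e₄ : D.Δid ↑F⁻¹ * D.Δid F = 1 := by rw [← map_mul, F.inv_mul, map_one]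
    calc _ = i23 k H F * D.idΔ F * D.idΔ (D.Δ h) * (D.idΔ ↑F⁻¹ * ((i23 k H ↑F⁻¹ * i23 k H F) *
          D.idΔ F)) * D.φ * D.Δid ↑F⁻¹ * i12 k H ↑F⁻¹ := by simp only [mul_assoc]
      _ = i23 k H F * D.idΔ F * (D.idΔ (D.Δ h) * D.φ) * D.Δid ↑F⁻¹ * i12 k H ↑F⁻¹ := by
        rw [e₁, one_mul, e₂, mul_one]; simp only [mul_assoc]
      _ = i23 k H F * D.idΔ F * D.φ * (D.Δid ↑F⁻¹ * ((i12 k H ↑F⁻¹ * i12 k H F) * D.Δid F)) *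
          D.Δid (D.Δ h) * D.Δid ↑F⁻¹ * i12 k H ↑F⁻¹ := by
        rw [IsQuasitriangular.coassoc, e₃, one_mul, e₄, mul_one]; simp only [mul_assoc]
      _ = _ := by simp only [mul_assoc]
  pentagon := twist_pentagon D F
  counit_φ := by
    change D.idεid _ = 1
    rw [twist_φ_coe]
    simp only [map_mul]
    rw [idεid_idΔ, idεid_Δid, idεid_i12, idε_inv, IsQuasitriangular.counit_φ]
    change (1 ⊗ₜ D.εid F) * _ * _ * _ * _ = _
    rw [IsCochainTwist.counit_left, ← Algebra.TensorProduct.one_def, one_mul, mul_one, mul_one,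
      F.mul_inv]
  antipode_left h := by
    change contrL D.antipode (contrL D.antipode D.α ↑F⁻¹) (F * D.Δ h * ↑F⁻¹) =
      D.ε h • contrL D.antipode D.α ↑F⁻¹
    rw [contrL_contrL, mul_assoc, F.inv_mul_cancel_left, contrL_Δ_mul]
  antipode_right h := by
    change contrR D.antipode (contrR D.antipode D.β F) (F * D.Δ h * ↑F⁻¹) =
      D.ε h • contrR D.antipode D.β F
    rw [contrR_contrR, F.inv_mul_cancel_right, contrR_mul_Δ]
  antipode_φ := by
    change contrRL D.antipode (contrR D.antipode D.β F) (contrL D.antipode D.α ↑F⁻¹) _ = 1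
    rw [contrRL_contr, twist_φ_coe]
    have e₁ : i23 k H ↑F⁻¹ * i23 k H F = 1 := by rw [← map_mul, F.inv_mul, map_one]
    have e₃ : i12 k H ↑F⁻¹ * i12 k H F = 1 := by rw [← map_mul, F.inv_mul, map_one]
    have h : i23 k H ↑F⁻¹ * (i23 k H F * D.idΔ F * D.φ * D.Δid ↑F⁻¹ * i12 k H ↑F⁻¹) *
        i12 k H F = D.idΔ F * (D.φ * D.Δid ↑F⁻¹) :=
      calc _ = (i23 k H ↑F⁻¹ * i23 k H F) * (D.idΔ F * (D.φ * D.Δid ↑F⁻¹)) *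
            (i12 k H ↑F⁻¹ * i12 k H F) := by simp only [mul_assoc]
        _ = _ := by rw [e₁, e₃, one_mul, mul_one]
    rw [h, contrRL_idΔ_mul, contrRL_mul_Δid, IsCochainTwist.counit_right, εid_inv,
      IsQuasitriangular.antipode_φ, one_mul, one_mul]
  antipode_φ_inv := by
    change contrLR D.antipode (contrL D.antipode D.α ↑F⁻¹) (contrR D.antipode D.β F) _ = 1
    rw [contrLR_contr, twist_φ_inv_coe]
    have e₁ : i23 k H ↑F⁻¹ * i23 k H F = 1 := by rw [← map_mul, F.inv_mul, map_one]
    have e₃ : i12 k H ↑F⁻¹ * i12 k H F = 1 := by rw [← map_mul, F.inv_mul, map_one]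
    have h : i12 k H ↑F⁻¹ * (i12 k H F * (D.Δid F * ↑D.φ⁻¹ * D.idΔ ↑F⁻¹) * i23 k H ↑F⁻¹) *
        i23 k H F = D.Δid F * (↑D.φ⁻¹ * D.idΔ ↑F⁻¹) :=
      calc _ = (i12 k H ↑F⁻¹ * i12 k H F) * (D.Δid F * (↑D.φ⁻¹ * D.idΔ ↑F⁻¹)) *
            (i23 k H ↑F⁻¹ * i23 k H F) := by simp only [mul_assoc]
        _ = _ := by rw [e₁, e₃, one_mul, mul_one]
    rw [h, contrLR_Δid_mul, contrLR_mul_idΔ, IsCochainTwist.counit_left, idε_inv,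
      IsQuasitriangular.antipode_φ_inv, antipode_one, one_mul, one_mul]
  R_comm h := by
    rw [twist_Δ, twist_R]
    simp only [map_mul, Units.val_mul]
    have e₁ : (F⁻¹ : (H ⊗[k] H)ˣ).1 * F = 1 := F.inv_mul
    have e₂ : Algebra.TensorProduct.comm k H H ↑F⁻¹ * Algebra.TensorProduct.comm k H H F = 1 := by
      rw [← map_mul, F.inv_mul, map_one]
    change _ * (Algebra.TensorProduct.comm k H H F * D.R * ↑F⁻¹) =
      (Algebra.TensorProduct.comm k H H F * D.R * ↑F⁻¹) * _
    calc _ = Algebra.TensorProduct.comm k H H F * Algebra.TensorProduct.comm k H H (D.Δ h) *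
          (Algebra.TensorProduct.comm k H H ↑F⁻¹ * Algebra.TensorProduct.comm k H H F) *
            D.R * ↑F⁻¹ := by simp only [mul_assoc]
      _ = Algebra.TensorProduct.comm k H H F * (D.R * ((↑F⁻¹ * F) * D.Δ h)) * ↑F⁻¹ := by
        rw [e₁, e₂, mul_one, one_mul, ← IsQuasitriangular.R_comm]; simp only [mul_assoc]
      _ = _ := by simp only [mul_assoc]
  idΔ_R := twist_idΔ_R D F
  Δid_R := twist_Δid_R D F

end Data

end TwistData

end

end QHopf

namespace QHopf
noncomputable section

/-! ### The braided category of modules and the braided twist functor -/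

namespace HMod
variable {k H : Type u} [CommRing k] [Ring H] [Algebra k H] {D : Data k H}

section Hexagon

variable {V W X : Type u} [AddCommGroup V] [Module k V] [AddCommGroup W] [Module k W]
  [AddCommGroup X] [Module k X] (v : H →ₐ[k] Module.End k V) (w : H →ₐ[k] Module.End k W)
  (x : H →ₐ[k] Module.End k X)

lemma assoc_comm_act₃ (t : H ⊗[k] (H ⊗[k] H)) :
    (TensorProduct.assoc k W X V).toLinearMap ∘ₗ
      (TensorProduct.comm k V (W ⊗[k] X)).toLinearMap ∘ₗ act₃ v w x t =
    act₃ w x v (p312 k H t) ∘ₗ (TensorProduct.assoc k W X V).toLinearMap ∘ₗ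
      (TensorProduct.comm k V (W ⊗[k] X)).toLinearMap := by
  induction t using ind₃ with
  | hadd s t hs ht => simp only [map_add, LinearMap.comp_add, LinearMap.add_comp, hs, ht]
  | h a b c => ext; rfl

lemma lTensor_comm_act₃ (t : H ⊗[k] (H ⊗[k] H)) :
    (TensorProduct.comm k W X).toLinearMap.lTensor V ∘ₗ act₃ v w x t =
      act₃ v x w (p132 k H t) ∘ₗ (TensorProduct.comm k W X).toLinearMap.lTensor V := by
  induction t using ind₃ with
  | hadd s t hs ht => simp only [map_add, LinearMap.comp_add, LinearMap.add_comp, hs, ht]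
  | h a b c => ext; rfl

lemma assoc_rTensor_comm_tact (t : H ⊗[k] H) :
    (TensorProduct.assoc k W V X).toLinearMap ∘ₗ
      ((TensorProduct.comm k V W).toLinearMap ∘ₗ tact v w t).rTensor X =
    act₃ w v x (p213 k H (i12 k H t)) ∘ₗ (TensorProduct.assoc k W V X).toLinearMap ∘ₗ
      (TensorProduct.comm k V W).toLinearMap.rTensor X := by
  rw [comm_tact, LinearMap.rTensor_comp, ← LinearMap.comp_assoc, assoc_rTensor_tact,
    Data.p213_i12, LinearMap.comp_assoc]

lemma act₃_comm_assoc_symm (t : H ⊗[k] (H ⊗[k] H)) :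
    act₃ x v w t ∘ₗ (TensorProduct.comm k (V ⊗[k] W) X).toLinearMap ∘ₗ
      (TensorProduct.assoc k V W X).symm.toLinearMap =
    (TensorProduct.comm k (V ⊗[k] W) X).toLinearMap ∘ₗ
      (TensorProduct.assoc k V W X).symm.toLinearMap ∘ₗ act₃ v w x (p312 k H t) := by
  induction t using ind₃ with
  | hadd s t hs ht => simp only [map_add, LinearMap.comp_add, LinearMap.add_comp, hs, ht]
  | h a b c => ext; rfl

lemma act₃_lTensor_comm (t : H ⊗[k] (H ⊗[k] H)) :
    act₃ v x w t ∘ₗ (TensorProduct.comm k W X).toLinearMap.lTensor V =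
      (TensorProduct.comm k W X).toLinearMap.lTensor V ∘ₗ act₃ v w x (p132 k H t) := by
  induction t using ind₃ with
  | hadd s t hs ht => simp only [map_add, LinearMap.comp_add, LinearMap.add_comp, hs, ht]
  | h a b c => ext; rfl

lemma rTensor_tact_assoc_symm (t : H ⊗[k] H) :
    (tact v w t).rTensor X ∘ₗ (TensorProduct.assoc k V W X).symm.toLinearMap =
      (TensorProduct.assoc k V W X).symm.toLinearMap ∘ₗ act₃ v w x (i12 k H t) := by
  refine LinearMap.ext fun z => ?_
  apply (TensorProduct.assoc k V W X).injective
  have h := LinearMap.congr_fun (assoc_rTensor_tact v w x t)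
    ((TensorProduct.assoc k V W X).symm z)
  simpa using h

lemma tact_dact_assoc_symm (t : H ⊗[k] H) :
    tact (dact D v w) x t ∘ₗ (TensorProduct.assoc k V W X).symm.toLinearMap =
      (TensorProduct.assoc k V W X).symm.toLinearMap ∘ₗ act₃ v w x (D.Δid t) := by
  refine LinearMap.ext fun z => ?_
  apply (TensorProduct.assoc k V W X).injective
  have h := LinearMap.congr_fun (tact_dact_left D v w x t)
    ((TensorProduct.assoc k V W X).symm z)
  simpa using h

variable [D.IsQuasitriangular]

lemma hexagon_forward_elem : (D.φ : H ⊗[k] (H ⊗[k] H)) * (p312 k H (D.idΔ D.R) * p312 k H D.φ) =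
    p132 k H (i23 k H D.R) * p132 k H D.φ * p132 k H (p213 k H (i12 k H D.R)) := by
  have e₁ (t : H ⊗[k] (H ⊗[k] H)) : p312 k H (p231 k H t) = t := by
    induction t using ind₃ with
    | hadd s t hs ht => simp only [map_add, hs, ht]
    | h a b c => rfl
  have e₂ (t : H ⊗[k] (H ⊗[k] H)) : p312 k H (p213 k H t) = p132 k H t := by
    induction t using ind₃ with
    | hadd s t hs ht => simp only [map_add, hs, ht]
    | h a b c => rfl
  rw [← map_mul, Data.IsQuasitriangular.idΔ_R, Units.inv_mul_cancel_right, map_mul, map_mul,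
    map_mul, e₁, e₂, Data.p312_apply, Data.p213_i13, Data.p312_apply]
  simp only [mul_assoc, Units.mul_inv_cancel_left]

lemma hexagon_forward_lin :
    (assocLin D w x v).toLinearMap ∘ₗ ((TensorProduct.comm k V (W ⊗[k] X)).toLinearMap ∘ₗ
      tact v (dact D w x) D.R) ∘ₗ (assocLin D v w x).toLinearMap =
    ((TensorProduct.comm k V X).toLinearMap ∘ₗ tact v x D.R).lTensor W ∘ₗ
      (assocLin D w v x).toLinearMap ∘ₗ
        ((TensorProduct.comm k V W).toLinearMap ∘ₗ tact v w D.R).rTensor X := by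
  have hP : (TensorProduct.assoc k W X V).toLinearMap ∘ₗ
      (TensorProduct.comm k V (W ⊗[k] X)).toLinearMap ∘ₗ
        (TensorProduct.assoc k V W X).toLinearMap =
      (TensorProduct.comm k V X).toLinearMap.lTensor W ∘ₗ
        (TensorProduct.assoc k W V X).toLinearMap ∘ₗ
          (TensorProduct.comm k V W).toLinearMap.rTensor X := by
    apply TensorProduct.ext_threefold
    intros
    rfl
  rw [assocLin_eq, assocLin_eq, assocLin_eq, tact_dact_right, LinearMap.lTensor_comp,
    lTensor_tact w v x]
  have h := congrArg (act₃ w x v) (hexagon_forward_elem (D := D))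
  simp only [map_mul, Module.End.mul_eq_comp] at h
  ext1
  ext a b c
  have e := fun t z => LinearMap.congr_fun (assoc_comm_act₃ v w x t) z
  have e₁ := fun t z => LinearMap.congr_fun (lTensor_comm_act₃ w v x t) z
  have e₂ := fun t z => LinearMap.congr_fun (assoc_rTensor_comm_tact v w x t) z
  have e₃ := fun z => LinearMap.congr_fun h z
  have e₄ := fun z => LinearMap.congr_fun hP z
  simp only [LinearMap.comp_apply] at e e₁ e₂ e₃ e₄
  simp only [TensorProduct.AlgebraTensorModule.curry_apply, TensorProduct.curry_apply,
    LinearMap.coe_restrictScalars, LinearMap.comp_apply, e, e₁, e₂, e₃, e₄]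

lemma hexagon_reverse_elem :
    p312 k H (↑D.φ⁻¹ : H ⊗[k] (H ⊗[k] H)) * (D.Δid D.R * ↑D.φ⁻¹) =
      p132 k H (i12 k H D.R) * p132 k H (↑D.φ⁻¹ : H ⊗[k] (H ⊗[k] H)) * i23 k H D.R := by
  have e : p312 k H (↑D.φ⁻¹ : H ⊗[k] (H ⊗[k] H)) * p312 k H D.φ = 1 := by
    rw [← map_mul, Units.inv_mul, map_one]
  rw [Data.IsQuasitriangular.Δid_R, Units.mul_inv_cancel_right, Data.p132_i12]
  simp only [← mul_assoc]
  rw [e, one_mul]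

lemma hexagon_reverse_lin :
    (assocLin D x v w).symm.toLinearMap ∘ₗ ((TensorProduct.comm k (V ⊗[k] W) X).toLinearMap ∘ₗ
      tact (dact D v w) x D.R) ∘ₗ (assocLin D v w x).symm.toLinearMap =
    ((TensorProduct.comm k V X).toLinearMap ∘ₗ tact v x D.R).rTensor W ∘ₗ
      (assocLin D v x w).symm.toLinearMap ∘ₗ
        ((TensorProduct.comm k W X).toLinearMap ∘ₗ tact w x D.R).lTensor V := by
  have hP : (TensorProduct.assoc k X V W).symm.toLinearMap ∘ₗ
      (TensorProduct.comm k (V ⊗[k] W) X).toLinearMap ∘ₗ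
        (TensorProduct.assoc k V W X).symm.toLinearMap =
      (TensorProduct.comm k V X).toLinearMap.rTensor W ∘ₗ
        (TensorProduct.assoc k V X W).symm.toLinearMap ∘ₗ
          (TensorProduct.comm k W X).toLinearMap.lTensor V := by
    ext
    rfl
  rw [assocLin_symm_eq, assocLin_symm_eq, assocLin_symm_eq, LinearMap.lTensor_comp,
    LinearMap.rTensor_comp, lTensor_tact v w x]
  have h := congrArg (act₃ v w x) (hexagon_reverse_elem (D := D))
  simp only [map_mul, Module.End.mul_eq_comp] at h
  refine LinearMap.ext fun z => ?_
  have e := fun t z => LinearMap.congr_fun (act₃_comm_assoc_symm v w x t) z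
  have e₁ := fun t z => LinearMap.congr_fun (act₃_lTensor_comm v w x t) z
  have e₂ := fun t z => LinearMap.congr_fun (rTensor_tact_assoc_symm v x w t) z
  have e₃ := fun z => LinearMap.congr_fun h z
  have e₄ := fun z => LinearMap.congr_fun hP z
  have e₅ := fun t z => LinearMap.congr_fun (tact_dact_assoc_symm (D := D) v w x t) z
  simp only [LinearMap.comp_apply] at e e₁ e₂ e₃ e₄ e₅
  simp only [LinearMap.comp_apply, e, e₁, e₂, e₃, e₄, e₅]

end Hexagon

variable [D.IsQuasitriangular]

instance : BraidedCategory (HMod D) where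
  braiding := τ
  braiding_naturality_right X Y Z f := by
    have h := τ_naturality (𝟙 X) f
    rwa [tensorHom_id, id_tensorHom] at h
  braiding_naturality_left f Z := by
    have h := τ_naturality f (𝟙 Z)
    rwa [tensorHom_id, id_tensorHom] at h
  hexagon_forward X Y Z := hom_ext (hexagon_forward_lin X.act Y.act Z.act)
  hexagon_reverse X Y Z := hom_ext (hexagon_reverse_lin X.act Y.act Z.act)

end HMod

section Twist

variable {k H : Type u} [CommRing k] [Ring H] [Algebra k H] (D : Data k H) (F : (H ⊗[k] H)ˣ)

lemma cM_twist (t : H ⊗[k] (H ⊗[k] H)) :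
    cM (D.twist F) t = cM D (i23 k H ↑F⁻¹ * t) := by
  induction t with
  | zero => simp only [mul_zero, map_zero]
  | add s t hs ht => simp only [mul_add, map_add, hs, ht]
  | tmul a t =>
    change a ⊗ₜ contrL D.antipode (contrL D.antipode D.α ↑F⁻¹) t =
      cM D ((1 ⊗ₜ (F⁻¹).1) * (a ⊗ₜ t))
    rw [Algebra.TensorProduct.tmul_mul_tmul, one_mul, Data.contrL_contrL]
    rfl

lemma sand_cM_sandS {V W : Type u} [AddCommGroup V] [Module k V] [AddCommGroup W] [Module k W]
    (v : H →ₐ[k] Module.End k V) (w : H →ₐ[k] Module.End k W) (t : H ⊗[k] (H ⊗[k] H))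
    (s : H ⊗[k] H) (L : V →ₗ[k] W) (n : V) :
    sand v w (cM D t) (sandS D v w s L) n = sand v w (cM D (t * i12 k H s)) L n := by
  induction s using ind₂ with
  | hadd x y hx hy => simp only [map_add, LinearMap.add_apply, mul_add, hx, hy]
  | h a b =>
    induction t using ind₃ with
    | hadd x y hx hy => simp only [map_add, LinearMap.add_apply, add_mul, hx, hy]
    | h p q r =>
      rw [i12_tmul, Algebra.TensorProduct.tmul_mul_tmul, Algebra.TensorProduct.tmul_mul_tmul,
        mul_one]
      simp only [LinearMap.lTensor_tmul, contrL_tmul, sand_tmul, sandS_tmul, Data.antipode_mul,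
        map_mul, Module.End.mul_apply]

variable [D.IsQuasitriangular] [(D.twist F).IsQuasitriangular]

lemma twistμ_braiding (V W : HMod D) :
    (twistμ D F V W).hom ≫ (twistFunctor D F).map (HMod.τ V W).hom =
      (HMod.τ ((twistFunctor D F).obj V) ((twistFunctor D F).obj W)).hom ≫
        (twistμ D F W V).hom := by
  apply HMod.hom_ext
  change ((TensorProduct.comm k V.carrier W.carrier).toLinearMap ∘ₗ tact V.act W.act D.R) ∘ₗ
    tact V.act W.act (↑F⁻¹ : H ⊗[k] H) = tact W.act V.act (↑F⁻¹ : H ⊗[k] H) ∘ₗ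
      (TensorProduct.comm k V.carrier W.carrier).toLinearMap ∘ₗ tact V.act W.act (D.twist F).R
  have h : (↑F⁻¹ : H ⊗[k] H) = Algebra.TensorProduct.comm k H H
      (Algebra.TensorProduct.comm k H H ↑F⁻¹) :=
    ((Algebra.TensorProduct.comm k H H).symm_apply_apply _).symm
  have h' : ((D.twist F).R : H ⊗[k] H) = Algebra.TensorProduct.comm k H H F * D.R * ↑F⁻¹ := rfl
  have h'' : Algebra.TensorProduct.comm k H H ↑F⁻¹ * Algebra.TensorProduct.comm k H H F = 1 := by
    rw [← map_mul, F.inv_mul, map_one]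
  have hc := HMod.comm_tact V.act W.act (Algebra.TensorProduct.comm k H H ↑F⁻¹)
  rw [← h] at hc
  rw [← LinearMap.comp_assoc _ _ (tact W.act V.act _), ← hc, LinearMap.comp_assoc,
    LinearMap.comp_assoc, ← Module.End.mul_eq_comp, ← Module.End.mul_eq_comp, ← map_mul, ← map_mul,
    h', ← mul_assoc, ← mul_assoc, h'', one_mul]

instance twistFunctor_braided [D.IsCochainTwist F] : (twistFunctor D F).Braided where
  braided := twistμ_braiding D F

instance : (twistFunctor D F).Full where
  map_surjective {V W} f := by
    let V' := (twistFunctor D F).obj V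
    let W' := (twistFunctor D F).obj W
    let g : HMod.Hom V W := ⟨HMod.Hom.lin (V := V') (W := W') f,
      HMod.Hom.equivariant (V := V') (W := W') f⟩
    exact ⟨g, rfl⟩

instance : (twistFunctor D F).Faithful where
  map_injective h := HMod.hom_ext (congrArg (HMod.Hom.lin (D := D.twist F)) h)

instance : (twistFunctor D F).EssSurj where
  mem_essImage V := ⟨⟨V.carrier, V.act⟩, ⟨Iso.refl _⟩⟩

instance : (twistFunctor D F).IsEquivalence where

lemma twistγ_ev [D.IsCochainTwist F] (V W : HMod D) :
    (twistγ D F V W).hom ▷ (twistFunctor D F).obj V ≫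
      Functor.LaxMonoidal.μ (twistFunctor D F) (RightClosed.hom V W) V ≫
        (twistFunctor D F).map (RightClosed.ev V W) =
      RightClosed.ev ((twistFunctor D F).obj V) ((twistFunctor D F).obj W) := by
  apply HMod.hom_ext
  apply TensorProduct.ext'
  intro L n
  have h := uncurry_act D (hact D V.act W.act) V.act W.act LinearMap.id (fun _ => rfl)
    (↑F⁻¹ : H ⊗[k] H) D.φ (sandS D V.act W.act (↑F⁻¹ : H ⊗[k] H) L) n
  refine Eq.trans h ?_
  change _ = sand V.act W.act (cM (D.twist F) (D.twist F).φ) L n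
  have e : i23 k H ↑F⁻¹ * i23 k H F = 1 := by rw [← map_mul, F.inv_mul, map_one]
  have e' : i23 k H ↑F⁻¹ * (i23 k H F * D.idΔ F * D.φ * D.Δid ↑F⁻¹ * i12 k H ↑F⁻¹) =
      D.idΔ F * (D.φ * D.Δid ↑F⁻¹ * i12 k H ↑F⁻¹) := by
    simp only [← mul_assoc]
    rw [e, one_mul]
  rw [cM_twist, twist_φ_coe, e', cM_idΔ_mul, Data.IsCochainTwist.counit_right,
    ← Algebra.TensorProduct.one_def, one_mul]
  exact sand_cM_sandS D V.act W.act _ _ L n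

/-- The isomorphisms `γ` make the twist functor a functor of closed monoidal categories. -/
def twistClosedComparison [D.IsCochainTwist F] : ClosedComparison (twistFunctor D F) where
  iso := twistγ D F
  naturality {V V' W W'} f g := by
    apply HMod.hom_ext
    apply LinearMap.ext
    intro L
    exact (HMod.sandOp_map f g _ L).symm
  iso_ev := twistγ_ev D F

end Twist

end

end QHopf

namespace QHopf
noncomputable section

/-! ### Symmetric bimodules in a braided category -/

section TensorLemmas

variable {C : Type*} [Category C] [MonoidalCategory C] [HasCoequalizers C]
  [∀ X : C, PreservesColimitsOfSize.{0, 0} (tensorLeft X)]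
  [∀ X : C, PreservesColimitsOfSize.{0, 0} (tensorRight X)] {A : Mon C}

lemma tπ_whiskerLeft_assoc (V : Bimod A A) {W W' : Bimod A A} (f : W ⟶ W') {X : C}
    (h : (V ⊗ W').X ⟶ X) : tπ V W ≫ (V ◁ f).hom ≫ h = V.X ◁ f.hom ≫ tπ V W' ≫ h := by
  rw [← Category.assoc, tπ_whiskerLeft, Category.assoc]

lemma tπ_whiskerRight_assoc {V V' : Bimod A A} (f : V ⟶ V') (W : Bimod A A) {X : C}
    (h : (V' ⊗ W).X ⟶ X) : tπ V W ≫ (f ▷ W).hom ≫ h = f.hom ▷ W.X ≫ tπ V' W ≫ h := by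
  rw [← Category.assoc, tπ_whiskerRight, Category.assoc]

lemma tπ_associator (V W X : Bimod A A) :
    tπ V W ▷ X.X ≫ tπ (V ⊗ W) X ≫ (α_ V W X).hom.hom =
      (α_ V.X W.X X.X).hom ≫ V.X ◁ tπ W X ≫ tπ V (W ⊗ X) := by
  have h : tπ (V ⊗ W) X ≫ (α_ V W X).hom.hom = Bimod.AssociatorBimod.homAux V W X :=
    coequalizer.π_desc _ _
  rw [h]
  exact π_tensor_id_preserves_coequalizer_inv_desc _ _ _ _

lemma tπ_associator_inv (V W X : Bimod A A) :
    V.X ◁ tπ W X ≫ tπ V (W ⊗ X) ≫ (α_ V W X).inv.hom =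
      (α_ V.X W.X X.X).inv ≫ tπ V W ▷ X.X ≫ tπ (V ⊗ W) X := by
  have h : (α_ V W X).hom.hom ≫ (α_ V W X).inv.hom = 𝟙 _ :=
    congrArg Bimod.Hom.hom (α_ V W X).hom_inv_id
  rw [Iso.eq_inv_comp]
  have h' := tπ_associator V W X
  calc _ = ((α_ V.X W.X X.X).hom ≫ V.X ◁ tπ W X ≫ tπ V (W ⊗ X)) ≫ (α_ V W X).inv.hom := by
        simp only [Category.assoc]
    _ = _ := by rw [← h', Category.assoc, Category.assoc, h, Category.comp_id]

lemma tπ_associator_assoc (V W X : Bimod A A) {Y : C} (h : (V ⊗ W ⊗ X).X ⟶ Y) :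
    tπ V W ▷ X.X ≫ tπ (V ⊗ W) X ≫ (α_ V W X).hom.hom ≫ h =
      (α_ V.X W.X X.X).hom ≫ V.X ◁ tπ W X ≫ tπ V (W ⊗ X) ≫ h := by
  simpa only [Category.assoc] using congrArg (· ≫ h) (tπ_associator V W X)

lemma tπ_associator_inv_assoc (V W X : Bimod A A) {Y : C} (h : ((V ⊗ W) ⊗ X).X ⟶ Y) :
    V.X ◁ tπ W X ≫ tπ V (W ⊗ X) ≫ (α_ V W X).inv.hom ≫ h =
      (α_ V.X W.X X.X).inv ≫ tπ V W ▷ X.X ≫ tπ (V ⊗ W) X ≫ h := by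
  simpa only [Category.assoc] using congrArg (· ≫ h) (tπ_associator_inv V W X)

lemma tπ_leftUnitor (V : Bimod A A) :
    tπ (𝟙_ (Bimod A A)) V ≫ (λ_ V).hom.hom = V.actLeft := coequalizer.π_desc _ _

lemma tπ_rightUnitor (V : Bimod A A) :
    tπ V (𝟙_ (Bimod A A)) ≫ (ρ_ V).hom.hom = V.actRight := coequalizer.π_desc _ _

end TensorLemmas

section Symmetric

variable {C : Type*} [Category C] [MonoidalCategory C]

/-- The left action of a bimodule is its right action precomposed with the braiding. -/
def LeftSymmetric [BraidedCategory C] {A : Mon C} (V : Bimod A A) : Prop :=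
  (β_ A.X V.X).hom ≫ V.actRight = V.actLeft

/-- The right action of a bimodule is its left action precomposed with the braiding. -/
def RightSymmetric [BraidedCategory C] {A : Mon C} (V : Bimod A A) : Prop :=
  (β_ V.X A.X).hom ≫ V.actLeft = V.actRight

lemma leftSymmetric_reverse_iff [BraidedCategory C] {A : Mon C} (V : Bimod A A) :
    @LeftSymmetric C _ _ (reverseBraiding C) A V ↔ RightSymmetric V :=
  (Iso.inv_comp_eq (β_ V.X A.X)).trans eq_comm

lemma rightSymmetric_reverse_iff [BraidedCategory C] {A : Mon C} (V : Bimod A A) :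
    @RightSymmetric C _ _ (reverseBraiding C) A V ↔ LeftSymmetric V :=
  (Iso.inv_comp_eq (β_ A.X V.X)).trans eq_comm

section Hom

variable [BraidedCategory C] [RightClosed C] [HasEqualizers C] {A : Mon C}

open RightClosed

lemma LeftSymmetric.homA {V W : Bimod A A} (hV : LeftSymmetric V) (hW : LeftSymmetric W) :
    LeftSymmetric (homA V W) := by
  change (β_ A.X (homAX V W)).hom ≫ homAActRight V W = homAActLeft V W
  rw [← cancel_mono (homAι V W), Category.assoc, homAActRight_ι, homAActLeft_ι]
  apply RightClosed.hom_ext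
  have hL : (A.X ◁ homAι V W ≫ homActLeft V W) ▷ V.X ≫ ev V.X W.X =
      (α_ _ _ _).hom ≫ A.X ◁ (homAι V W ▷ V.X ≫ ev V.X W.X) ≫ W.actLeft := by
    rw [comp_whiskerRight, Category.assoc, homActLeft_ev]
    simp
  have hR : (homAι V W ▷ A.X ≫ homActRight V W) ▷ V.X ≫ ev V.X W.X =
      (α_ _ _ _).hom ≫ homAX V W ◁ V.actLeft ≫ homAι V W ▷ V.X ≫ ev V.X W.X := by
    rw [comp_whiskerRight, Category.assoc, homActRight_ev, whisker_exchange_assoc]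
    simp
  rw [hL, comp_whiskerRight, Category.assoc, hR, ← hV, ← hW, whiskerLeft_comp_assoc,
    homAι_condition, BraidedCategory.braiding_naturality_right_assoc,
    BraidedCategory.braiding_tensor_right_hom]
  simp only [Category.assoc, Iso.hom_inv_id_assoc]

end Hom

variable [HasCoequalizers C]
  [∀ X : C, PreservesColimitsOfSize.{0, 0} (tensorLeft X)]
  [∀ X : C, PreservesColimitsOfSize.{0, 0} (tensorRight X)] [BraidedCategory C] {A : Mon C}

open BraidedCategory

lemma LeftSymmetric.tensor {V W : Bimod A A} (hV : LeftSymmetric V) (hW : LeftSymmetric W) :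
    LeftSymmetric (V ⊗ W) := by
  change (β_ A.X (V ⊗ W).X).hom ≫ (V ⊗ W).actRight = (V ⊗ W).actLeft
  rw [← cancel_epi (A.X ◁ tπ V W), tπ_actLeft, braiding_naturality_right_assoc, tπ_actRight,
    braiding_tensor_right_hom, ← hV]
  simp only [Category.assoc, Iso.inv_hom_id_assoc, comp_whiskerRight]
  rw [← whiskerLeft_comp_assoc, hW, tπ_condition]

variable {V W : Bimod A A}

/-- The morphism `V ⊗_A W ⟶ W ⊗_A V` induced by the braiding. -/
def tBraidX (hV : RightSymmetric V) (hW : LeftSymmetric W) : (V ⊗ W).X ⟶ (W ⊗ V).X :=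
  tdesc ((β_ V.X W.X).hom ≫ tπ W V) (by
    rw [← hW, whiskerLeft_comp_assoc, braiding_naturality_right_assoc, tπ_condition,
      braiding_naturality_left_assoc, ← hV, whiskerLeft_comp_assoc, braiding_tensor_right_hom,
      braiding_tensor_left_hom]
    simp only [Category.assoc, Iso.inv_hom_id_assoc])

lemma tπ_tBraidX (hV : RightSymmetric V) (hW : LeftSymmetric W) :
    tπ V W ≫ tBraidX hV hW = (β_ V.X W.X).hom ≫ tπ W V := tπ_desc _ _

lemma tπ_tBraidX_assoc (hV : RightSymmetric V) (hW : LeftSymmetric W) {X : C}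
    (h : (W ⊗ V).X ⟶ X) : tπ V W ≫ tBraidX hV hW ≫ h = (β_ V.X W.X).hom ≫ tπ W V ≫ h := by
  rw [← Category.assoc, tπ_tBraidX, Category.assoc]

/-- The morphism of bimodules `V ⊗_A W ⟶ W ⊗_A V` induced by the braiding. -/
def tBraid (hV : RightSymmetric V) (hW : LeftSymmetric W) : V ⊗ W ⟶ W ⊗ V where
  hom := tBraidX hV hW
  left_act_hom := by
    rw [← cancel_epi (A.X ◁ tπ V W), ← whiskerLeft_comp_assoc, tπ_tBraidX,
      ← Category.assoc, tπ_actLeft, Category.assoc, Category.assoc, tπ_tBraidX,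
      whiskerLeft_comp_assoc, tπ_actLeft, ← hW, braiding_naturality_left_assoc,
      comp_whiskerRight_assoc, tπ_condition, braiding_tensor_left_hom]
    simp only [Category.assoc, Iso.inv_hom_id_assoc]
  right_act_hom := by
    rw [← cancel_epi (tπ V W ▷ A.X), ← comp_whiskerRight_assoc, tπ_tBraidX,
      ← Category.assoc, tπ_actRight, Category.assoc, Category.assoc, tπ_tBraidX,
      comp_whiskerRight_assoc, tπ_actRight, ← hV, braiding_naturality_right_assoc,
      whiskerLeft_comp_assoc, tπ_condition, braiding_tensor_right_hom]
    simp only [Category.assoc, Iso.hom_inv_id_assoc, Iso.inv_hom_id_assoc]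

/-- The isomorphism of bimodules `V ⊗_A W ≅ W ⊗_A V` induced by the braiding. -/
def tBraidIso (hV : RightSymmetric V) (hW : LeftSymmetric W) : V ⊗ W ≅ W ⊗ V where
  hom := tBraid hV hW
  inv := @tBraid C _ _ _ _ _ (reverseBraiding C) A W V
    ((rightSymmetric_reverse_iff W).mpr hW) ((leftSymmetric_reverse_iff V).mpr hV)
  hom_inv_id := by
    apply Bimod.hom_ext
    change tBraidX hV hW ≫ @tBraidX C _ _ _ _ _ (reverseBraiding C) A W V
      ((rightSymmetric_reverse_iff W).mpr hW) ((leftSymmetric_reverse_iff V).mpr hV) = 𝟙 _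
    rw [← cancel_epi (tπ V W), tπ_tBraidX_assoc, @tπ_tBraidX C _ _ _ _ _ (reverseBraiding C)]
    exact (Iso.hom_inv_id_assoc (β_ V.X W.X) _).trans (Category.comp_id _).symm
  inv_hom_id := by
    apply Bimod.hom_ext
    change @tBraidX C _ _ _ _ _ (reverseBraiding C) A W V
      ((rightSymmetric_reverse_iff W).mpr hW) ((leftSymmetric_reverse_iff V).mpr hV) ≫ tBraidX hV hW = 𝟙 _
    rw [← cancel_epi (tπ W V), @tπ_tBraidX_assoc C _ _ _ _ _ (reverseBraiding C), tπ_tBraidX]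
    exact (Iso.inv_hom_id_assoc (β_ V.X W.X) _).trans (Category.comp_id _).symm

lemma tBraid_naturality_right {V W W' : Bimod A A} (f : W ⟶ W') (hV : RightSymmetric V)
    (hW : LeftSymmetric W) (hW' : LeftSymmetric W') :
    V ◁ f ≫ tBraid hV hW' = tBraid hV hW ≫ f ▷ V := by
  apply Bimod.hom_ext
  change (V ◁ f).hom ≫ tBraidX hV hW' = tBraidX hV hW ≫ (f ▷ V).hom
  rw [← cancel_epi (tπ V W), tπ_whiskerLeft_assoc, tπ_tBraidX, tπ_tBraidX_assoc,
    tπ_whiskerRight, braiding_naturality_right_assoc]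

lemma tBraid_naturality_left {V V' W : Bimod A A} (f : V ⟶ V') (hV : RightSymmetric V)
    (hV' : RightSymmetric V') (hW : LeftSymmetric W) :
    f ▷ W ≫ tBraid hV' hW = tBraid hV hW ≫ W ◁ f := by
  apply Bimod.hom_ext
  change (f ▷ W).hom ≫ tBraidX hV' hW = tBraidX hV hW ≫ (W ◁ f).hom
  rw [← cancel_epi (tπ V W), tπ_whiskerRight_assoc, tπ_tBraidX, tπ_tBraidX_assoc,
    tπ_whiskerLeft, braiding_naturality_left_assoc]

lemma tBraid_hexagon_forward {V W X : Bimod A A} (hV : RightSymmetric V) (hW : LeftSymmetric W)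
    (hX : LeftSymmetric X) (hWX : LeftSymmetric (W ⊗ X)) :
    (α_ V W X).hom ≫ tBraid hV hWX ≫ (α_ W X V).hom =
      tBraid hV hW ▷ X ≫ (α_ W V X).hom ≫ W ◁ tBraid hV hX := by
  apply Bimod.hom_ext
  change (α_ V W X).hom.hom ≫ tBraidX hV hWX ≫ (α_ W X V).hom.hom =
      (tBraid hV hW ▷ X).hom ≫ (α_ W V X).hom.hom ≫ (W ◁ tBraid hV hX).hom
  rw [← cancel_epi (tπ (V ⊗ W) X), ← cancel_epi (tπ V W ▷ X.X), tπ_associator_assoc,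
    tπ_tBraidX_assoc, braiding_naturality_right_assoc, tπ_associator, tπ_whiskerRight_assoc,
    ← comp_whiskerRight_assoc]
  change _ = (tπ V W ≫ tBraidX hV hW) ▷ X.X ≫ _
  rw [tπ_tBraidX, comp_whiskerRight_assoc, tπ_associator_assoc, tπ_whiskerLeft,
    ← whiskerLeft_comp_assoc]
  change _ = _ ≫ _ ≫ W.X ◁ (tπ V X ≫ tBraidX hV hX) ≫ _
  rw [tπ_tBraidX, whiskerLeft_comp_assoc, braiding_tensor_right_hom]
  simp only [Category.assoc, Iso.hom_inv_id_assoc, Iso.inv_hom_id_assoc]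

lemma tBraid_hexagon_reverse {V W X : Bimod A A} (hV : RightSymmetric V) (hW : RightSymmetric W)
    (hX : LeftSymmetric X) (hVW : RightSymmetric (V ⊗ W)) :
    (α_ V W X).inv ≫ tBraid hVW hX ≫ (α_ X V W).inv =
      V ◁ tBraid hW hX ≫ (α_ V X W).inv ≫ tBraid hV hX ▷ W := by
  apply Bimod.hom_ext
  change (α_ V W X).inv.hom ≫ tBraidX hVW hX ≫ (α_ X V W).inv.hom =
      (V ◁ tBraid hW hX).hom ≫ (α_ V X W).inv.hom ≫ (tBraid hV hX ▷ W).hom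
  rw [← cancel_epi (tπ V (W ⊗ X)), ← cancel_epi (V.X ◁ tπ W X), tπ_associator_inv_assoc,
    tπ_tBraidX_assoc, braiding_naturality_left_assoc, tπ_associator_inv, tπ_whiskerLeft_assoc,
    ← whiskerLeft_comp_assoc]
  change _ = V.X ◁ (tπ W X ≫ tBraidX hW hX) ≫ _
  rw [tπ_tBraidX, whiskerLeft_comp_assoc, tπ_associator_inv_assoc, tπ_whiskerRight,
    ← comp_whiskerRight_assoc]
  change _ = _ ≫ _ ≫ (tπ V X ≫ tBraidX hV hX) ▷ W.X ≫ _
  rw [tπ_tBraidX, comp_whiskerRight_assoc, braiding_tensor_left_hom]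
  simp only [Category.assoc, Iso.hom_inv_id_assoc, Iso.inv_hom_id_assoc]

variable (A)

/-- The property of a bimodule to be symmetric with respect to the braiding. -/
def symmetricProp : ObjectProperty (Bimod A A) := fun V => LeftSymmetric V ∧ RightSymmetric V

lemma symmetricProp_tensor {V W : Bimod A A} (hV : symmetricProp A V) (hW : symmetricProp A W) :
    symmetricProp A (V ⊗ W) :=
  ⟨hV.1.tensor hW.1, (leftSymmetric_reverse_iff _).mp
    (@LeftSymmetric.tensor C _ _ _ _ _ (reverseBraiding C) A V W
      ((leftSymmetric_reverse_iff V).mpr hV.2) ((leftSymmetric_reverse_iff W).mpr hW.2))⟩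

lemma symmetricProp_isMonoidal
    (hA : (β_ A.X A.X).hom ≫ MonObj.mul = (MonObj.mul : A.X ⊗ A.X ⟶ A.X)) :
    (symmetricProp A).IsMonoidal where
  prop_unit := ⟨hA, hA⟩
  prop_tensor _ _ hV hW := symmetricProp_tensor A hV hW

lemma symmetricProp_isHomClosed [RightClosed C] [HasEqualizers C] :
    IsHomClosed (symmetricProp A) where
  prop_hom {V W} hV hW := ⟨hV.1.homA hW.1, (leftSymmetric_reverse_iff _).mp
    (@LeftSymmetric.homA C _ _ (reverseBraiding C) _ _ A V W
      ((leftSymmetric_reverse_iff V).mpr hV.2) ((leftSymmetric_reverse_iff W).mpr hW.2))⟩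

/-- The braiding on symmetric bimodules that is induced by the braiding of the base category. -/
abbrev symmetricBraided [(symmetricProp A).IsMonoidal] :
    BraidedCategory (symmetricProp A).FullSubcategory where
  braiding V W := (symmetricProp A).isoMk (X := V ⊗ W) (Y := W ⊗ V)
    (tBraidIso V.property.2 W.property.1)
  braiding_naturality_right V W W' f := ObjectProperty.hom_ext _
    (tBraid_naturality_right f.hom V.property.2 W.property.1 W'.property.1)
  braiding_naturality_left {V V'} f W := ObjectProperty.hom_ext _
    (tBraid_naturality_left f.hom V.property.2 V'.property.2 W.property.1)
  hexagon_forward V W X := ObjectProperty.hom_ext _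
    (tBraid_hexagon_forward V.property.2 W.property.1 X.property.1 (W ⊗ X).property.1)
  hexagon_reverse V W X := ObjectProperty.hom_ext _
    (tBraid_hexagon_reverse V.property.2 W.property.2 X.property.1 (V ⊗ W).property.2)

end Symmetric

end

end QHopf

namespace QHopf
noncomputable section

/-! ### The image of an algebra and of its bimodules -/

section Img

open Functor.LaxMonoidal

variable {C C' : Type*} [Category C] [MonoidalCategory C] [Category C'] [MonoidalCategory C']
  (G : C ⥤ C') [G.LaxMonoidal] (A : Mon C)

/-- `G.mapMon.obj A`, in a reducible form. -/
abbrev imgMon : Mon C' where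
  X := G.obj A.X
  mon := G.monObjObj A.X

/-- `mapBimod G A`, in a reducible form. -/
abbrev imgBimod : Bimod A A ⥤ Bimod (imgMon G A) (imgMon G A) where
  obj V :=
    { X := G.obj V.X
      actLeft := mapActLeft G V
      actRight := mapActRight G V
      one_actLeft := mapBimod_one_actLeft G V
      left_assoc := mapBimod_left_assoc G V
      actRight_one := mapBimod_actRight_one G V
      right_assoc := mapBimod_right_assoc G V
      middle_assoc := mapBimod_middle_assoc G V }
  map f :=
    { hom := G.map f.hom
      left_act_hom := mapBimod_left_act G f
      right_act_hom := mapBimod_right_act G f }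
  map_id _ := Bimod.hom_ext _ _ (G.map_id _)
  map_comp _ _ := Bimod.hom_ext _ _ (G.map_comp _ _)

end Img


/-! ### The functor on bimodules induced by a monoidal functor is monoidal -/

section MapMonoidal

open Functor.LaxMonoidal
open Functor.OplaxMonoidal (δ)

variable {C C' : Type*} [Category C] [MonoidalCategory C] [HasCoequalizers C]
  [∀ X : C, PreservesColimitsOfSize.{0, 0} (tensorLeft X)]
  [∀ X : C, PreservesColimitsOfSize.{0, 0} (tensorRight X)]
  [Category C'] [MonoidalCategory C'] [HasCoequalizers C']
  [∀ X : C', PreservesColimitsOfSize.{0, 0} (tensorLeft X)]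
  [∀ X : C', PreservesColimitsOfSize.{0, 0} (tensorRight X)]
  (G : C ⥤ C')

section Lax

variable [G.LaxMonoidal] {A : Mon C}

/-- The morphism `G V ⊗_{G A} G W ⟶ G (V ⊗_A W)`. -/
def mapμX (V W : Bimod A A) :
    ((imgBimod G A).obj V ⊗ (imgBimod G A).obj W).X ⟶ G.obj (V ⊗ W).X :=
  tdesc (V := (imgBimod G A).obj V) (W := (imgBimod G A).obj W)
    (Functor.LaxMonoidal.μ G V.X W.X ≫ G.map (tπ V W)) (by
      change mapActRight G V ▷ G.obj W.X ≫ Functor.LaxMonoidal.μ G V.X W.X ≫ G.map (tπ V W) =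
        (α_ _ _ _).hom ≫ G.obj V.X ◁ mapActLeft G W ≫
          Functor.LaxMonoidal.μ G V.X W.X ≫ G.map (tπ V W)
      rw [mapActRight, mapActLeft, comp_whiskerRight_assoc, μ_natural_left_assoc, ← G.map_comp,
        tπ_condition, G.map_comp, G.map_comp, associativity_assoc, whiskerLeft_comp_assoc,
        μ_natural_right_assoc])

lemma tπ_mapμX (V W : Bimod A A) :
    tπ ((imgBimod G A).obj V) ((imgBimod G A).obj W) ≫ mapμX G V W =
      Functor.LaxMonoidal.μ G V.X W.X ≫ G.map (tπ V W) := tπ_desc _ _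

lemma tπ_mapμX_assoc (V W : Bimod A A) {X : C'} (h : G.obj (V ⊗ W).X ⟶ X) :
    tπ ((imgBimod G A).obj V) ((imgBimod G A).obj W) ≫ mapμX G V W ≫ h =
      Functor.LaxMonoidal.μ G V.X W.X ≫ G.map (tπ V W) ≫ h := by
  rw [← Category.assoc, tπ_mapμX, Category.assoc]

/-- The morphism of bimodules `G V ⊗_{G A} G W ⟶ G (V ⊗_A W)`. -/
def mapμ (V W : Bimod A A) :
    (imgBimod G A).obj V ⊗ (imgBimod G A).obj W ⟶ (imgBimod G A).obj (V ⊗ W) where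
  hom := mapμX G V W
  left_act_hom := by
    rw [← cancel_epi (G.obj A.X ◁ tπ ((imgBimod G A).obj V) ((imgBimod G A).obj W))]
    refine (Category.assoc _ _ _).symm.trans ?_
    refine (congrArg (· ≫ mapμX G V W)
      (tπ_actLeft ((imgBimod G A).obj V) ((imgBimod G A).obj W))).trans ?_
    change (((α_ (G.obj A.X) (G.obj V.X) (G.obj W.X)).inv ≫ mapActLeft G V ▷ G.obj W.X ≫
      tπ ((imgBimod G A).obj V) ((imgBimod G A).obj W)) ≫ mapμX G V W) =
      G.obj A.X ◁ tπ ((imgBimod G A).obj V) ((imgBimod G A).obj W) ≫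
        G.obj A.X ◁ mapμX G V W ≫ mapActLeft G (V ⊗ W)
    rw [← whiskerLeft_comp_assoc, tπ_mapμX, Category.assoc, Category.assoc, tπ_mapμX, mapActLeft,
      mapActLeft, comp_whiskerRight_assoc, μ_natural_left_assoc, whiskerLeft_comp_assoc,
      μ_natural_right_assoc, ← G.map_comp, ← G.map_comp, tπ_actLeft, G.map_comp (α_ _ _ _).inv,
      associativity_inv_assoc]
  right_act_hom := by
    rw [← cancel_epi (tπ ((imgBimod G A).obj V) ((imgBimod G A).obj W) ▷ G.obj A.X)]
    refine (Category.assoc _ _ _).symm.trans ?_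
    refine (congrArg (· ≫ mapμX G V W)
      (tπ_actRight ((imgBimod G A).obj V) ((imgBimod G A).obj W))).trans ?_
    change (((α_ (G.obj V.X) (G.obj W.X) (G.obj A.X)).hom ≫ G.obj V.X ◁ mapActRight G W ≫
      tπ ((imgBimod G A).obj V) ((imgBimod G A).obj W)) ≫ mapμX G V W) =
      tπ ((imgBimod G A).obj V) ((imgBimod G A).obj W) ▷ G.obj A.X ≫
        mapμX G V W ▷ G.obj A.X ≫ mapActRight G (V ⊗ W)
    rw [← comp_whiskerRight_assoc, tπ_mapμX, Category.assoc, Category.assoc, tπ_mapμX, mapActRight,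
      mapActRight, whiskerLeft_comp_assoc, μ_natural_right_assoc, comp_whiskerRight_assoc,
      μ_natural_left_assoc, ← G.map_comp, ← G.map_comp, tπ_actRight, G.map_comp (α_ _ _ _).hom,
      associativity_assoc]

lemma mapμ_naturality_left {V V' : Bimod A A} (f : V ⟶ V') (W : Bimod A A) :
    (imgBimod G A).map f ▷ (imgBimod G A).obj W ≫ mapμ G V' W =
      mapμ G V W ≫ (imgBimod G A).map (f ▷ W) := by
  apply Bimod.hom_ext
  change ((imgBimod G A).map f ▷ (imgBimod G A).obj W).hom ≫ mapμX G V' W =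
    mapμX G V W ≫ G.map (f ▷ W).hom
  rw [← cancel_epi (tπ ((imgBimod G A).obj V) ((imgBimod G A).obj W)), tπ_whiskerRight_assoc,
    tπ_mapμX, tπ_mapμX_assoc, ← G.map_comp, tπ_whiskerRight, G.map_comp]
  exact μ_natural_left_assoc G f.hom W.X _

lemma mapμ_naturality_right (V : Bimod A A) {W W' : Bimod A A} (f : W ⟶ W') :
    (imgBimod G A).obj V ◁ (imgBimod G A).map f ≫ mapμ G V W' =
      mapμ G V W ≫ (imgBimod G A).map (V ◁ f) := by
  apply Bimod.hom_ext
  change ((imgBimod G A).obj V ◁ (imgBimod G A).map f).hom ≫ mapμX G V W' =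
    mapμX G V W ≫ G.map (V ◁ f).hom
  rw [← cancel_epi (tπ ((imgBimod G A).obj V) ((imgBimod G A).obj W)), tπ_whiskerLeft_assoc,
    tπ_mapμX, tπ_mapμX_assoc, ← G.map_comp, tπ_whiskerLeft, G.map_comp]
  exact μ_natural_right_assoc G V.X f.hom _

variable (A) in
/-- The identity as an isomorphism from the unit object to the image of the unit object. -/
def mapεIso : 𝟙_ (Bimod (imgMon G A) (imgMon G A)) ≅
    (imgBimod G A).obj (𝟙_ (Bimod A A)) :=
  Bimod.isoOfIso (Iso.refl (G.obj A.X))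
    ((Category.comp_id _).trans (by
      change _ = G.obj A.X ◁ 𝟙 (G.obj A.X) ≫ mapActLeft G (𝟙_ (Bimod A A))
      rw [whiskerLeft_id]
      exact (Category.id_comp (Functor.LaxMonoidal.μ G A.X A.X ≫ G.map MonObj.mul)).symm))
    ((Category.comp_id _).trans (by
      change _ = 𝟙 (G.obj A.X) ▷ G.obj A.X ≫ mapActRight G (𝟙_ (Bimod A A))
      rw [id_whiskerRight]
      exact (Category.id_comp (Functor.LaxMonoidal.μ G A.X A.X ≫ G.map MonObj.mul)).symm))

lemma mapμ_associativity (V W X : Bimod A A) :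
    mapμ G V W ▷ (imgBimod G A).obj X ≫ mapμ G (V ⊗ W) X ≫ (imgBimod G A).map (α_ V W X).hom =
      (α_ _ _ _).hom ≫ (imgBimod G A).obj V ◁ mapμ G W X ≫ mapμ G V (W ⊗ X) := by
  apply Bimod.hom_ext
  change (mapμ G V W ▷ (imgBimod G A).obj X).hom ≫ mapμX G (V ⊗ W) X ≫
      G.map (α_ V W X).hom.hom =
    (α_ ((imgBimod G A).obj V) ((imgBimod G A).obj W) ((imgBimod G A).obj X)).hom.hom ≫
      ((imgBimod G A).obj V ◁ mapμ G W X).hom ≫ mapμX G V (W ⊗ X)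
  rw [← cancel_epi (tπ ((imgBimod G A).obj V ⊗ (imgBimod G A).obj W) ((imgBimod G A).obj X)),
    ← cancel_epi (tπ ((imgBimod G A).obj V) ((imgBimod G A).obj W) ▷ ((imgBimod G A).obj X).X),
    tπ_associator_assoc, tπ_whiskerRight_assoc, tπ_whiskerLeft_assoc, tπ_mapμX, tπ_mapμX_assoc,
    ← comp_whiskerRight_assoc, ← whiskerLeft_comp_assoc]
  change (tπ ((imgBimod G A).obj V) ((imgBimod G A).obj W) ≫ mapμX G V W) ▷ G.obj X.X ≫ _ =
    (α_ (G.obj V.X) (G.obj W.X) (G.obj X.X)).hom ≫ G.obj V.X ◁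
      (tπ ((imgBimod G A).obj W) ((imgBimod G A).obj X) ≫ mapμX G W X) ≫ _
  rw [tπ_mapμX, tπ_mapμX, comp_whiskerRight_assoc, μ_natural_left_assoc, whiskerLeft_comp_assoc,
    μ_natural_right_assoc, ← G.map_comp, ← G.map_comp, tπ_associator, G.map_comp,
    associativity_assoc, G.map_comp]

lemma mapμ_leftUnitality (V : Bimod A A) :
    (λ_ ((imgBimod G A).obj V)).hom = (mapεIso G A).hom ▷ (imgBimod G A).obj V ≫
      mapμ G (𝟙_ _) V ≫ (imgBimod G A).map (λ_ V).hom := by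
  apply Bimod.hom_ext
  change _ = ((mapεIso G A).hom ▷ (imgBimod G A).obj V).hom ≫
    mapμX G (𝟙_ _) V ≫ G.map (λ_ V).hom.hom
  rw [← cancel_epi (tπ (𝟙_ _) ((imgBimod G A).obj V)), tπ_leftUnitor, tπ_whiskerRight_assoc,
    tπ_mapμX_assoc, ← G.map_comp, tπ_leftUnitor]
  change mapActLeft G V = 𝟙 (G.obj A.X) ▷ G.obj V.X ≫ mapActLeft G V
  rw [id_whiskerRight, Category.id_comp]

lemma mapμ_rightUnitality (V : Bimod A A) :
    (ρ_ ((imgBimod G A).obj V)).hom = (imgBimod G A).obj V ◁ (mapεIso G A).hom ≫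
      mapμ G V (𝟙_ _) ≫ (imgBimod G A).map (ρ_ V).hom := by
  apply Bimod.hom_ext
  change _ = ((imgBimod G A).obj V ◁ (mapεIso G A).hom).hom ≫
    mapμX G V (𝟙_ _) ≫ G.map (ρ_ V).hom.hom
  rw [← cancel_epi (tπ ((imgBimod G A).obj V) (𝟙_ _)), tπ_rightUnitor, tπ_whiskerLeft_assoc,
    tπ_mapμX_assoc, ← G.map_comp, tπ_rightUnitor]
  change mapActRight G V = G.obj V.X ◁ 𝟙 (G.obj A.X) ≫ mapActRight G V
  rw [whiskerLeft_id, Category.id_comp]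

end Lax

section Strong

variable [G.Monoidal] [PreservesColimitsOfShape WalkingParallelPair G] {A : Mon C}

lemma mapμX_inv_condition (V W : Bimod A A) :
    G.map (V.actRight ▷ W.X) ≫ δ G V.X W.X ≫
        tπ ((imgBimod G A).obj V) ((imgBimod G A).obj W) =
      G.map ((α_ _ _ _).hom ≫ V.X ◁ W.actLeft) ≫ δ G V.X W.X ≫
        tπ ((imgBimod G A).obj V) ((imgBimod G A).obj W) := by
  have h := tπ_condition ((imgBimod G A).obj V) ((imgBimod G A).obj W)
  change mapActRight G V ▷ G.obj W.X ≫ _ =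
    (α_ _ _ _).hom ≫ G.obj V.X ◁ mapActLeft G W ≫ _ at h
  rw [← cancel_epi (Functor.LaxMonoidal.μ G (V.X ⊗ A.X) W.X),
    ← cancel_epi (Functor.LaxMonoidal.μ G V.X A.X ▷ G.obj W.X), G.map_comp, Category.assoc,
    associativity_assoc, ← μ_natural_left_assoc, ← μ_natural_right_assoc,
    Functor.Monoidal.μ_δ_assoc, ← comp_whiskerRight_assoc,
    ← whiskerLeft_comp_assoc]
  exact h

instance isIso_mapμX (V W : Bimod A A) : IsIso (mapμX G V W) := by
  have hc := isColimitOfHasCoequalizerOfPreservesColimit G (V.actRight ▷ W.X)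
    ((α_ V.X A.X W.X).hom ≫ V.X ◁ W.actLeft)
  obtain ⟨i, hi⟩ : ∃ i : G.obj (V ⊗ W).X ⟶ ((imgBimod G A).obj V ⊗ (imgBimod G A).obj W).X,
      G.map (tπ V W) ≫ i = δ G V.X W.X ≫ tπ ((imgBimod G A).obj V) ((imgBimod G A).obj W) :=
    let l := Cofork.IsColimit.desc' hc _ (mapμX_inv_condition G V W)
    ⟨l.1, l.2⟩
  have : Epi (G.map (tπ V W)) := Cofork.IsColimit.epi hc
  refine ⟨i, ?_, ?_⟩
  · rw [← cancel_epi (tπ ((imgBimod G A).obj V) ((imgBimod G A).obj W)), tπ_mapμX_assoc, hi,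
      Functor.Monoidal.μ_δ_assoc, Category.comp_id]
  · rw [← cancel_epi (G.map (tπ V W)), ← Category.assoc, hi, Category.assoc, tπ_mapμX,
      Functor.Monoidal.δ_μ_assoc, Category.comp_id]

/-- The isomorphism of bimodules `G V ⊗_{G A} G W ≅ G (V ⊗_A W)`. -/
def mapμIso (V W : Bimod A A) :
    (imgBimod G A).obj V ⊗ (imgBimod G A).obj W ≅ (imgBimod G A).obj (V ⊗ W) :=
  Bimod.isoOfIso (@asIso _ _ _ _ (mapμX G V W) (isIso_mapμX G V W)) (mapμ G V W).left_act_hom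
    (mapμ G V W).right_act_hom

/-- A strong monoidal functor that preserves coequalizers induces a strong monoidal functor on
bimodules. -/
instance imgBimodMonoidal : (imgBimod G A).Monoidal :=
  Functor.CoreMonoidal.toMonoidal
    { εIso := mapεIso G A
      μIso := mapμIso G
      μIso_hom_natural_left f W := mapμ_naturality_left G f W
      μIso_hom_natural_right V f := mapμ_naturality_right G V f
      associativity := mapμ_associativity G
      left_unitality := mapμ_leftUnitality G
      right_unitality := mapμ_rightUnitality G }

end Strong

end MapMonoidal

/-! ### The functor on bimodules induced by a monoidal equivalence is an equivalence -/

section MapEquivalence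

open Functor.LaxMonoidal MonObj

variable {C C' : Type*} [Category C] [MonoidalCategory C] [Category C'] [MonoidalCategory C']
  (G : C ⥤ C')

instance imgBimod_faithful [G.LaxMonoidal] [G.Faithful] (A : Mon C) : (imgBimod G A).Faithful where
  map_injective {_ _} _ _ h := Bimod.hom_ext _ _ (G.map_injective (congrArg Bimod.Hom.hom h))

variable [G.Monoidal]

lemma map_injective_of_μ [G.Faithful] {X Y Z : C} {f g : X ⊗ Y ⟶ Z}
    (h : Functor.LaxMonoidal.μ G X Y ≫ G.map f = Functor.LaxMonoidal.μ G X Y ≫ G.map g) :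
    f = g :=
  G.map_injective ((cancel_epi _).mp h)

lemma map_injective_of_μ₃ [G.Faithful] {X Y Z T : C} {f g : (X ⊗ Y) ⊗ Z ⟶ T}
    (h : Functor.LaxMonoidal.μ G X Y ▷ G.obj Z ≫ Functor.LaxMonoidal.μ G (X ⊗ Y) Z ≫ G.map f =
      Functor.LaxMonoidal.μ G X Y ▷ G.obj Z ≫ Functor.LaxMonoidal.μ G (X ⊗ Y) Z ≫ G.map g) :
    f = g :=
  map_injective_of_μ G ((cancel_epi _).mp h)

instance imgBimod_full [G.Full] [G.Faithful] (A : Mon C) : (imgBimod G A).Full where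
  map_surjective {V W} f := by
    have hl : mapActLeft G V ≫ f.hom = G.obj A.X ◁ f.hom ≫ mapActLeft G W := f.left_act_hom
    have hr : mapActRight G V ≫ f.hom = f.hom ▷ G.obj A.X ≫ mapActRight G W := f.right_act_hom
    obtain ⟨g, hg⟩ := G.map_surjective (X := V.X) (Y := W.X) f.hom
    refine ⟨⟨g, ?_, ?_⟩, Bimod.hom_ext _ _ hg⟩
    · apply map_injective_of_μ G
      rw [G.map_comp, G.map_comp, ← μ_natural_right_assoc, hg]
      rwa [mapActLeft, mapActLeft, Category.assoc] at hl
    · apply map_injective_of_μ G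
      rw [G.map_comp, G.map_comp, ← μ_natural_left_assoc, hg]
      rwa [mapActRight, mapActRight, Category.assoc] at hr

section EssSurj

variable {G} [G.Full] [G.Faithful] {A : Mon C} {W : Bimod (imgMon G A) (imgMon G A)} {X : C}
  (e : G.obj X ≅ W.X) {l : A.X ⊗ X ⟶ X} {r : X ⊗ A.X ⟶ X}
  (hl : Functor.LaxMonoidal.μ G A.X X ≫ G.map l ≫ e.hom = G.obj A.X ◁ e.hom ≫ W.actLeft)
  (hr : Functor.LaxMonoidal.μ G X A.X ≫ G.map r ≫ e.hom = e.hom ▷ G.obj A.X ≫ W.actRight)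

/-- A bimodule whose actions correspond to those of a bimodule `W` over `G A` under an isomorphism
`G X ≅ W`. -/
def reflectBimod : Bimod A A where
  X := X
  actLeft := l
  actRight := r
  one_actLeft := by
    have h : (ε G ≫ G.map MonObj.one) ▷ W.X ≫ W.actLeft = (λ_ W.X).hom := W.one_actLeft
    apply G.map_injective
    rw [← cancel_mono e.hom, ← cancel_epi (Functor.LaxMonoidal.μ G (𝟙_ C) X),
      ← cancel_epi (ε G ▷ G.obj X), G.map_comp, Category.assoc, ← μ_natural_left_assoc, hl,
      ← comp_whiskerRight_assoc, ← whisker_exchange_assoc, h, ← left_unitality_assoc]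
    simp
  left_assoc := by
    have h : (Functor.LaxMonoidal.μ G A.X A.X ≫ G.map MonObj.mul) ▷ W.X ≫ W.actLeft =
      (α_ _ _ _).hom ≫ G.obj A.X ◁ W.actLeft ≫ W.actLeft := W.left_assoc
    apply map_injective_of_μ₃ G
    rw [← cancel_mono e.hom]
    simp only [G.map_comp, Category.assoc]
    rw [← μ_natural_left_assoc, hl, ← comp_whiskerRight_assoc, ← whisker_exchange_assoc, h,
      associativity_assoc, ← μ_natural_right_assoc, hl, ← whiskerLeft_comp_assoc,
      ← whiskerLeft_comp_assoc, Category.assoc, hl]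
    simp
  actRight_one := by
    have h : W.X ◁ (ε G ≫ G.map MonObj.one) ≫ W.actRight = (ρ_ W.X).hom := W.actRight_one
    apply G.map_injective
    rw [← cancel_mono e.hom, ← cancel_epi (Functor.LaxMonoidal.μ G X (𝟙_ C)),
      ← cancel_epi (G.obj X ◁ ε G), G.map_comp, Category.assoc, ← μ_natural_right_assoc, hr,
      ← whiskerLeft_comp_assoc, whisker_exchange_assoc, h, ← right_unitality_assoc]
    simp
  right_assoc := by
    have h : W.X ◁ (Functor.LaxMonoidal.μ G A.X A.X ≫ G.map MonObj.mul) ≫ W.actRight =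
      (α_ _ _ _).inv ≫ W.actRight ▷ G.obj A.X ≫ W.actRight := W.right_assoc
    rw [← cancel_epi (α_ _ _ _).hom]
    apply map_injective_of_μ₃ G
    rw [← cancel_mono e.hom]
    simp only [G.map_comp, Category.assoc, Iso.hom_inv_id_assoc]
    rw [associativity_assoc, ← μ_natural_right_assoc, hr, ← whiskerLeft_comp_assoc,
      whisker_exchange_assoc, h, ← μ_natural_left_assoc, hr, ← comp_whiskerRight_assoc,
      ← comp_whiskerRight_assoc, Category.assoc, hr]
    simp
  middle_assoc := by
    have h : W.actLeft ▷ G.obj A.X ≫ W.actRight =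
      (α_ _ _ _).hom ≫ G.obj A.X ◁ W.actRight ≫ W.actLeft := W.middle_assoc
    apply map_injective_of_μ₃ G
    rw [← cancel_mono e.hom]
    simp only [G.map_comp, Category.assoc]
    rw [← μ_natural_left_assoc, hr, ← comp_whiskerRight_assoc, ← comp_whiskerRight_assoc,
      Category.assoc, hl, associativity_assoc, ← μ_natural_right_assoc, hl,
      ← whiskerLeft_comp_assoc, ← whiskerLeft_comp_assoc, Category.assoc, hr,
      comp_whiskerRight_assoc, h]
    simp

end EssSurj

instance imgBimod_essSurj [G.IsEquivalence] (A : Mon C) : (imgBimod G A).EssSurj where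
  mem_essImage W := by
    let e := G.objObjPreimageIso W.X
    have hl : Functor.LaxMonoidal.μ G A.X (G.objPreimage W.X) ≫
        G.map (G.preimage (Functor.OplaxMonoidal.δ G _ _ ≫ G.obj A.X ◁ e.hom ≫ W.actLeft ≫ e.inv)) ≫
          e.hom = G.obj A.X ◁ e.hom ≫ W.actLeft := by
      simp
    have hr : Functor.LaxMonoidal.μ G (G.objPreimage W.X) A.X ≫
        G.map (G.preimage (Functor.OplaxMonoidal.δ G _ _ ≫ e.hom ▷ G.obj A.X ≫ W.actRight ≫ e.inv)) ≫
          e.hom = e.hom ▷ G.obj A.X ≫ W.actRight := by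
      simp
    exact ⟨reflectBimod e hl hr, ⟨Bimod.isoOfIso e ((Category.assoc _ _ _).trans hl)
      ((Category.assoc _ _ _).trans hr)⟩⟩

/-- A monoidal equivalence induces an equivalence of categories of bimodules. -/
instance imgBimod_isEquivalence [G.IsEquivalence] (A : Mon C) : (imgBimod G A).IsEquivalence where

end MapEquivalence

end

end QHopf

namespace QHopf
noncomputable section

/-! ### The functor on bimodules induced by a closed monoidal functor is closed -/

section EvLemmas

open RightClosed

variable {C : Type*} [Category C] [MonoidalCategory C] [RightClosed C] [HasEqualizers C]
  [HasCoequalizers C] [∀ X : C, PreservesColimitsOfSize.{0, 0} (tensorLeft X)]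
  [∀ X : C, PreservesColimitsOfSize.{0, 0} (tensorRight X)] {A : Mon C}

lemma bimod_homMap_ι {V V' W W' : Bimod A A} (f : V' ⟶ V) (g : W ⟶ W') :
    (RightClosed.homMap f g).hom ≫ homAι V' W' =
      homAι V W ≫ RightClosed.homMap f.hom g.hom := by
  change (homAMapX f (𝟙 W) ≫ homAMapX (𝟙 V') g) ≫ homAι V' W' = _
  rw [Category.assoc, homAMapX_ι, ← Category.assoc, homAMapX_ι, Category.assoc, ← homMap_comp]
  simp

lemma tπ_ev (V W : Bimod A A) :
    tπ (homA V W) V ≫ (ev V W).hom = homAι V W ▷ V.X ≫ ev V.X W.X := by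
  refine (tπ_uncurryAX (𝟙 (homA V W))).trans ?_
  change (𝟙 (homAX V W) ≫ homAι V W) ▷ V.X ≫ ev V.X W.X = _
  rw [Category.id_comp]

end EvLemmas

namespace ClosedComparison

open RightClosed Functor.LaxMonoidal

variable {C C' : Type*} [Category C] [MonoidalCategory C] [RightClosed C]
  [Category C'] [MonoidalCategory C'] [RightClosed C'] {G : C ⥤ C'} [G.Monoidal]
  (γ : ClosedComparison G)

lemma map_hom_ext (γ : ClosedComparison G) {Z : C'} {V W : C} {f g : Z ⟶ G.obj (hom V W)}
    (h : f ▷ G.obj V ≫ Functor.LaxMonoidal.μ G (hom V W) V ≫ G.map (ev V W) =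
      g ▷ G.obj V ≫ Functor.LaxMonoidal.μ G (hom V W) V ≫ G.map (ev V W)) : f = g := by
  rw [← cancel_mono (γ.iso V W).inv]
  apply RightClosed.hom_ext
  rw [← γ.iso_ev, ← comp_whiskerRight_assoc, ← comp_whiskerRight_assoc]
  simpa using h

variable {A : Mon C} (V W : Bimod A A)

lemma homActLeft_iso :
    homActLeft ((imgBimod G A).obj V) ((imgBimod G A).obj W) ≫ (γ.iso V.X W.X).hom =
      G.obj A.X ◁ (γ.iso V.X W.X).hom ≫ Functor.LaxMonoidal.μ G _ _ ≫ G.map (homActLeft V W) := by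
  apply γ.map_hom_ext
  have h := homActLeft_ev ((imgBimod G A).obj V) ((imgBimod G A).obj W)
  rw [comp_whiskerRight_assoc, γ.iso_ev, h, comp_whiskerRight_assoc, comp_whiskerRight_assoc,
    μ_natural_left_assoc, ← G.map_comp, homActLeft_ev, G.map_comp, associativity_assoc, G.map_comp,
    ← μ_natural_right_assoc, associator_naturality_middle_assoc, ← γ.iso_ev]
  simp [mapActLeft]

lemma homActRight_iso :
    homActRight ((imgBimod G A).obj V) ((imgBimod G A).obj W) ≫ (γ.iso V.X W.X).hom =
      (γ.iso V.X W.X).hom ▷ G.obj A.X ≫ Functor.LaxMonoidal.μ G _ _ ≫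
        G.map (homActRight V W) := by
  apply γ.map_hom_ext
  have h := homActRight_ev ((imgBimod G A).obj V) ((imgBimod G A).obj W)
  rw [comp_whiskerRight_assoc, γ.iso_ev, h, comp_whiskerRight_assoc, comp_whiskerRight_assoc,
    μ_natural_left_assoc, ← G.map_comp, homActRight_ev, G.map_comp, associativity_assoc,
    G.map_comp, ← μ_natural_right_assoc, associator_naturality_left_assoc, ← γ.iso_ev,
    whisker_exchange_assoc, ← whiskerLeft_comp_assoc]
  rfl

lemma iso_evr_ev {Z : C'} (g : Z ⟶ hom (G.obj V.X) (G.obj W.X)) :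
    Z ◁ Functor.LaxMonoidal.μ G V.X A.X ≫
      (g ≫ (γ.iso V.X W.X).hom ≫ G.map (evr V W)) ▷ G.obj (V.X ⊗ A.X) ≫
        Functor.LaxMonoidal.μ G _ _ ≫ G.map (ev _ _) =
      Z ◁ mapActRight G V ≫ g ▷ G.obj V.X ≫ ev _ _ := by
  rw [comp_whiskerRight_assoc, comp_whiskerRight_assoc, μ_natural_left_assoc, ← G.map_comp, evr,
    curry_ev, G.map_comp, ← μ_natural_right_assoc, ← whisker_exchange_assoc,
    ← whisker_exchange_assoc, γ.iso_ev, mapActRight, whiskerLeft_comp_assoc]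

lemma iso_rev_ev {Z : C'} (g : Z ⟶ hom (G.obj V.X) (G.obj W.X)) :
    Z ◁ Functor.LaxMonoidal.μ G V.X A.X ≫
      (g ≫ (γ.iso V.X W.X).hom ≫ G.map (rev V W)) ▷ G.obj (V.X ⊗ A.X) ≫
        Functor.LaxMonoidal.μ G _ _ ≫ G.map (ev _ _) =
      (α_ _ _ _).inv ≫ (g ▷ G.obj V.X ≫ ev _ _) ▷ G.obj A.X ≫ mapActRight G W := by
  rw [comp_whiskerRight_assoc, comp_whiskerRight_assoc, μ_natural_left_assoc, ← G.map_comp, rev,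
    curry_ev, G.map_comp, whisker_exchange_assoc, whisker_exchange_assoc, associativity_inv_assoc,
    G.map_comp, ← μ_natural_left_assoc, ← γ.iso_ev, mapActRight]
  simp

lemma map_equalizes_iff {Z : C'} (g : Z ⟶ hom (G.obj V.X) (G.obj W.X)) :
    g ≫ (γ.iso V.X W.X).hom ≫ G.map (evr V W) = g ≫ (γ.iso V.X W.X).hom ≫ G.map (rev V W) ↔
      Z ◁ mapActRight G V ≫ g ▷ G.obj V.X ≫ ev _ _ =
        (α_ _ _ _).inv ≫ (g ▷ G.obj V.X ≫ ev _ _) ▷ G.obj A.X ≫ mapActRight G W := by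
  rw [← iso_evr_ev, ← iso_rev_ev, cancel_epi (Z ◁ Functor.LaxMonoidal.μ G V.X A.X)]
  exact ⟨fun h => by rw [h], γ.map_hom_ext⟩

variable [HasEqualizers C] [HasEqualizers C'] [PreservesLimitsOfShape WalkingParallelPair G]

instance mono_map_homAι : Mono (G.map (homAι V W)) :=
  Fork.IsLimit.mono (isLimitOfHasEqualizerOfPreservesLimit G (evr V W) (rev V W))

lemma exists_homAX_lift : ∃ f : homAX ((imgBimod G A).obj V) ((imgBimod G A).obj W) ⟶
    G.obj (homAX V W), f ≫ G.map (homAι V W) =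
      homAι ((imgBimod G A).obj V) ((imgBimod G A).obj W) ≫ (γ.iso V.X W.X).hom :=
  let l := Fork.IsLimit.lift' (isLimitOfHasEqualizerOfPreservesLimit G (evr V W) (rev V W))
    (homAι ((imgBimod G A).obj V) ((imgBimod G A).obj W) ≫ (γ.iso V.X W.X).hom) (by
      rw [Category.assoc, Category.assoc]
      exact (γ.map_equalizes_iff V W _).mpr
        (homAι_condition ((imgBimod G A).obj V) ((imgBimod G A).obj W)))
  ⟨l.1, l.2⟩

/-- The isomorphism of underlying objects `hom_{G A}(G V, G W) ≅ G hom_A(V, W)`. -/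
def homAXIso :
    homAX ((imgBimod G A).obj V) ((imgBimod G A).obj W) ≅ G.obj (homAX V W) where
  hom := (γ.exists_homAX_lift V W).choose
  inv := homALift (V := (imgBimod G A).obj V) (W := (imgBimod G A).obj W)
    (G.map (homAι V W) ≫ (γ.iso V.X W.X).inv) ((γ.map_equalizes_iff V W _).mp (by
      simp only [Category.assoc, Iso.inv_hom_id_assoc]
      rw [← G.map_comp, ← G.map_comp]
      exact congrArg G.map (equalizer.condition _ _)))
  hom_inv_id := by
    rw [← cancel_mono (homAι _ _), Category.assoc, homALift_ι, ← Category.assoc,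
      (γ.exists_homAX_lift V W).choose_spec, Category.assoc, Iso.hom_inv_id, Category.comp_id,
      Category.id_comp]
  inv_hom_id := by
    rw [← cancel_mono (G.map (homAι V W)), Category.assoc, (γ.exists_homAX_lift V W).choose_spec,
      homALift_ι_assoc, Category.assoc, Iso.inv_hom_id, Category.comp_id, Category.id_comp]

lemma homAXIso_hom_ι : (γ.homAXIso V W).hom ≫ G.map (homAι V W) =
    homAι ((imgBimod G A).obj V) ((imgBimod G A).obj W) ≫ (γ.iso V.X W.X).hom :=
  (γ.exists_homAX_lift V W).choose_spec

lemma homAXIso_naturality {V V' W W' : Bimod A A} {f : V' ⟶ V} {g : W ⟶ W'}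
    {p : homAX ((imgBimod G A).obj V) ((imgBimod G A).obj W) ⟶
      homAX ((imgBimod G A).obj V') ((imgBimod G A).obj W')} {q : homAX V W ⟶ homAX V' W'}
    (hp : p ≫ homAι _ _ = homAι _ _ ≫ RightClosed.homMap (G.map f.hom) (G.map g.hom))
    (hq : q ≫ homAι _ _ = homAι _ _ ≫ RightClosed.homMap f.hom g.hom) :
    p ≫ (γ.homAXIso V' W').hom = (γ.homAXIso V W).hom ≫ G.map q := by
  rw [← cancel_mono (G.map (homAι V' W')), Category.assoc, homAXIso_hom_ι, ← Category.assoc, hp,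
    Category.assoc, Category.assoc, ← G.map_comp, hq, G.map_comp, γ.naturality,
    ← Category.assoc, ← homAXIso_hom_ι, Category.assoc]

lemma homAXIso_ev : (γ.homAXIso V W).hom ▷ G.obj V.X ≫ Functor.LaxMonoidal.μ G _ _ ≫
    G.map (homAι V W ▷ V.X ≫ ev V.X W.X) =
      homAι ((imgBimod G A).obj V) ((imgBimod G A).obj W) ▷ G.obj V.X ≫ ev _ _ := by
  rw [G.map_comp, ← μ_natural_left_assoc, ← comp_whiskerRight_assoc, homAXIso_hom_ι,
    comp_whiskerRight_assoc, γ.iso_ev]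

/-- The isomorphism of bimodules `hom_{G A}(G V, G W) ≅ G hom_A(V, W)`. -/
def homAIso : homA ((imgBimod G A).obj V) ((imgBimod G A).obj W) ≅
    (imgBimod G A).obj (homA V W) :=
  Bimod.isoOfIso (γ.homAXIso V W)
    (by
      change homAActLeft ((imgBimod G A).obj V) ((imgBimod G A).obj W) ≫ (γ.homAXIso V W).hom =
        G.obj A.X ◁ (γ.homAXIso V W).hom ≫ Functor.LaxMonoidal.μ G _ _ ≫ G.map (homAActLeft V W)
      rw [← cancel_mono (G.map (homAι V W))]
      simp only [Category.assoc]
      rw [homAXIso_hom_ι, ← G.map_comp, homAActLeft_ι, G.map_comp, ← μ_natural_right_assoc,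
        ← whiskerLeft_comp_assoc, homAXIso_hom_ι, ← Category.assoc, homAActLeft_ι, Category.assoc,
        homActLeft_iso, whiskerLeft_comp_assoc])
    (by
      change homAActRight ((imgBimod G A).obj V) ((imgBimod G A).obj W) ≫ (γ.homAXIso V W).hom =
        (γ.homAXIso V W).hom ▷ G.obj A.X ≫ Functor.LaxMonoidal.μ G _ _ ≫ G.map (homAActRight V W)
      rw [← cancel_mono (G.map (homAι V W))]
      simp only [Category.assoc]
      rw [homAXIso_hom_ι, ← G.map_comp, homAActRight_ι, G.map_comp, ← μ_natural_left_assoc,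
        ← comp_whiskerRight_assoc, homAXIso_hom_ι, ← Category.assoc, homAActRight_ι, Category.assoc,
        homActRight_iso, comp_whiskerRight_assoc])

variable [HasCoequalizers C]
  [∀ X : C, PreservesColimitsOfSize.{0, 0} (tensorLeft X)]
  [∀ X : C, PreservesColimitsOfSize.{0, 0} (tensorRight X)] [HasCoequalizers C']
  [∀ X : C', PreservesColimitsOfSize.{0, 0} (tensorLeft X)]
  [∀ X : C', PreservesColimitsOfSize.{0, 0} (tensorRight X)]
  [PreservesColimitsOfShape WalkingParallelPair G]

variable (A) in
/-- The comparison of internal homs for the functor on bimodules induced by `G`. -/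
def img : ClosedComparison (imgBimod G A) where
  iso V W := γ.homAIso V W
  naturality {V V' W W'} f g := by
    apply Bimod.hom_ext
    change (RightClosed.homMap ((imgBimod G A).map f) ((imgBimod G A).map g)).hom ≫
      (γ.homAXIso V' W').hom = (γ.homAXIso V W).hom ≫ G.map (RightClosed.homMap f g).hom
    exact γ.homAXIso_naturality (bimod_homMap_ι ((imgBimod G A).map f) ((imgBimod G A).map g))
      (bimod_homMap_ι f g)
  iso_ev V W := by
    apply Bimod.hom_ext
    change ((γ.homAIso V W).hom ▷ (imgBimod G A).obj V).hom ≫ mapμX G (homA V W) V ≫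
      G.map (ev V W).hom = (ev ((imgBimod G A).obj V) ((imgBimod G A).obj W)).hom
    refine (cancel_epi (tπ (homA ((imgBimod G A).obj V) ((imgBimod G A).obj W))
      ((imgBimod G A).obj V))).mp ?_
    refine .trans ?_ (tπ_ev ((imgBimod G A).obj V) ((imgBimod G A).obj W)).symm
    refine (tπ_whiskerRight_assoc _ _ _).trans ?_
    exact (congrArg (_ ≫ ·) ((tπ_mapμX_assoc G (homA V W) V _).trans
      (congrArg (_ ≫ ·) ((G.map_comp _ _).symm.trans (congrArg G.map (tπ_ev V W)))))).trans
      (γ.homAXIso_ev V W)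

end ClosedComparison

end

end QHopf

namespace QHopf
noncomputable section

section MapBimod

open Functor.LaxMonoidal

variable {C C' : Type*} [Category C] [MonoidalCategory C] [Category C'] [MonoidalCategory C']
  (G : C ⥤ C') (A : Mon C)

instance mapBimod_isEquivalence [G.Monoidal] [G.IsEquivalence] : (mapBimod G A).IsEquivalence :=
  imgBimod_isEquivalence G A

section Symmetric

variable [BraidedCategory C] [BraidedCategory C']

lemma braided_image_mul [G.LaxBraided]
    (h : (β_ A.X A.X).hom ≫ MonObj.mul = (MonObj.mul : A.X ⊗ A.X ⟶ A.X)) :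
    (β_ (G.obj A.X) (G.obj A.X)).hom ≫ Functor.LaxMonoidal.μ G A.X A.X ≫ G.map MonObj.mul =
      Functor.LaxMonoidal.μ G A.X A.X ≫ G.map (MonObj.mul : A.X ⊗ A.X ⟶ A.X) := by
  rw [← Functor.LaxBraided.braided_assoc, ← G.map_comp, h]

variable {A} [G.Braided] [G.Faithful]

lemma leftSymmetric_image_iff (V : Bimod A A) :
    LeftSymmetric ((imgBimod G A).obj V) ↔ LeftSymmetric V := by
  change (β_ (G.obj A.X) (G.obj V.X)).hom ≫ Functor.LaxMonoidal.μ G V.X A.X ≫ G.map V.actRight =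
    Functor.LaxMonoidal.μ G A.X V.X ≫ G.map V.actLeft ↔ (β_ A.X V.X).hom ≫ V.actRight = V.actLeft
  rw [← Functor.LaxBraided.braided_assoc, ← G.map_comp, cancel_epi, G.map_injective.eq_iff]

lemma rightSymmetric_image_iff (V : Bimod A A) :
    RightSymmetric ((imgBimod G A).obj V) ↔ RightSymmetric V := by
  change (β_ (G.obj V.X) (G.obj A.X)).hom ≫ Functor.LaxMonoidal.μ G A.X V.X ≫ G.map V.actLeft =
    Functor.LaxMonoidal.μ G V.X A.X ≫ G.map V.actRight ↔ (β_ V.X A.X).hom ≫ V.actLeft = V.actRight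
  rw [← Functor.LaxBraided.braided_assoc, ← G.map_comp, cancel_epi, G.map_injective.eq_iff]

lemma symmetricProp_image_iff (V : Bimod A A) :
    symmetricProp (imgMon G A) ((imgBimod G A).obj V) ↔ symmetricProp A V :=
  and_congr (leftSymmetric_image_iff G V) (rightSymmetric_image_iff G V)

end Symmetric

lemma LeftSymmetric.of_iso [BraidedCategory C] {A : Mon C} {V W : Bimod A A} (e : V ≅ W)
    (hV : LeftSymmetric V) : LeftSymmetric W := by
  have h : e.inv.hom ≫ e.hom.hom = 𝟙 _ := congrArg Bimod.Hom.hom e.inv_hom_id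
  have hl : A.X ◁ e.inv.hom ≫ V.actLeft ≫ e.hom.hom = W.actLeft := by
    rw [e.hom.left_act_hom, ← whiskerLeft_comp_assoc, h, whiskerLeft_id, Category.id_comp]
  have hr : e.inv.hom ▷ A.X ≫ V.actRight ≫ e.hom.hom = W.actRight := by
    rw [e.hom.right_act_hom, ← comp_whiskerRight_assoc, h, id_whiskerRight, Category.id_comp]
  change (β_ A.X W.X).hom ≫ W.actRight = W.actLeft
  rw [← hl, ← hr, ← BraidedCategory.braiding_naturality_right_assoc, ← hV, Category.assoc]

instance symmetricProp_isClosedUnderIsomorphisms [BraidedCategory C] {A : Mon C} :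
    (symmetricProp A).IsClosedUnderIsomorphisms where
  of_iso {V W} e hV := ⟨hV.1.of_iso e, (leftSymmetric_reverse_iff W).mp
    (@LeftSymmetric.of_iso C _ _ (reverseBraiding C) A V W e
      ((leftSymmetric_reverse_iff V).mpr hV.2))⟩

variable [HasCoequalizers C]
  [∀ X : C, PreservesColimitsOfSize.{0, 0} (tensorLeft X)]
  [∀ X : C, PreservesColimitsOfSize.{0, 0} (tensorRight X)] [HasCoequalizers C']
  [∀ X : C', PreservesColimitsOfSize.{0, 0} (tensorLeft X)]
  [∀ X : C', PreservesColimitsOfSize.{0, 0} (tensorRight X)]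

lemma mapμ_tBraid [BraidedCategory C] [BraidedCategory C'] [G.LaxBraided] {A : Mon C}
    {V W : Bimod A A} (hV : RightSymmetric V) (hW : LeftSymmetric W)
    (hV' : RightSymmetric ((imgBimod G A).obj V)) (hW' : LeftSymmetric ((imgBimod G A).obj W)) :
    mapμ G V W ≫ (imgBimod G A).map (tBraid hV hW) = tBraid hV' hW' ≫ mapμ G W V := by
  apply Bimod.hom_ext
  change mapμX G V W ≫ G.map (tBraidX hV hW) = tBraidX hV' hW' ≫ mapμX G W V
  rw [← cancel_epi (tπ ((imgBimod G A).obj V) ((imgBimod G A).obj W)), tπ_mapμX_assoc,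
    tπ_tBraidX_assoc, tπ_mapμX, ← G.map_comp, tπ_tBraidX, G.map_comp]
  exact Functor.LaxBraided.braided_assoc V.X W.X _

variable [G.Monoidal] [PreservesColimitsOfShape WalkingParallelPair G]

/-- The monoidal structure of `mapBimod G A`. -/
instance mapBimodMonoidal : (mapBimod G A).Monoidal := imgBimodMonoidal (A := A) G

/-- The comparison of internal homs for `mapBimod G A`. -/
def mapBimodClosedComparison [RightClosed C] [RightClosed C'] [HasEqualizers C] [HasEqualizers C']
    [PreservesLimitsOfShape WalkingParallelPair G] (γ : ClosedComparison G) :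
    ClosedComparison (mapBimod G A) := γ.img A

end MapBimod

/-! ### Restriction of closed monoidal functors to full subcategories -/

section Restrict

open Functor.LaxMonoidal

variable {C C' : Type*} [Category C] [Category C']
  (P : ObjectProperty C) (Q : ObjectProperty C') (G : C ⥤ C') (h : ∀ V, P V → Q (G.obj V))

lemma restrict_isEquivalence [Q.IsClosedUnderIsomorphisms] [G.IsEquivalence]
    (h' : ∀ V, Q (G.obj V) → P V) :
    (Q.lift (P.ι ⋙ G) (fun V => h V.obj V.property)).IsEquivalence where
  essSurj := ⟨fun W => ⟨⟨G.objPreimage W.obj, h' _ (Q.prop_of_iso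
    (G.objObjPreimageIso W.obj).symm W.property)⟩, ⟨Q.isoMk (G.objObjPreimageIso W.obj)⟩⟩⟩

variable [MonoidalCategory C] [MonoidalCategory C'] [P.IsMonoidal] [Q.IsMonoidal] [G.Monoidal]

/-- The restriction of a monoidal functor to full monoidal subcategories is monoidal. -/
abbrev restrictMonoidal :
    (Q.lift (P.ι ⋙ G) (fun V : P.FullSubcategory => h V.obj V.property)).Monoidal :=
  Functor.CoreMonoidal.toMonoidal
    { εIso := Q.isoMk (Functor.Monoidal.εIso G)
      μIso V W := Q.isoMk (Functor.Monoidal.μIso G V.obj W.obj)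
      μIso_hom_natural_left f W := ObjectProperty.hom_ext _
        (μ_natural_left G f.hom W.obj)
      μIso_hom_natural_right V f := ObjectProperty.hom_ext _
        (μ_natural_right G V.obj f.hom)
      associativity V W X := ObjectProperty.hom_ext _ (associativity G V.obj W.obj X.obj)
      left_unitality V := ObjectProperty.hom_ext _ (left_unitality G V.obj)
      right_unitality V := ObjectProperty.hom_ext _ (right_unitality G V.obj) }

/-- The restriction of a monoidal functor to full monoidal subcategories is braided if it is
compatible with the given braidings. -/
abbrev restrictBraided [BraidedCategory P.FullSubcategory] [BraidedCategory Q.FullSubcategory]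
    (hβ : ∀ V W : P.FullSubcategory, Functor.LaxMonoidal.μ G V.obj W.obj ≫ G.map (β_ V W).hom.hom =
      (β_ (⟨G.obj V.obj, h V.obj V.property⟩ : Q.FullSubcategory)
        ⟨G.obj W.obj, h W.obj W.property⟩).hom.hom ≫ Functor.LaxMonoidal.μ G W.obj V.obj) :
    (Q.lift (P.ι ⋙ G) (fun V : P.FullSubcategory => h V.obj V.property)).Braided where
  __ := restrictMonoidal P Q G h
  braided V W := ObjectProperty.hom_ext _ (hβ V W)

variable [RightClosed C] [RightClosed C'] [IsHomClosed P] [IsHomClosed Q]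

/-- The comparison of internal homs restricts to full closed monoidal subcategories. -/
def ClosedComparison.restrict (γ : ClosedComparison G) :
    letI := restrictMonoidal P Q G h
    ClosedComparison (Q.lift (P.ι ⋙ G) (fun V : P.FullSubcategory => h V.obj V.property)) :=
  letI := restrictMonoidal P Q G h
  { iso V W := Q.isoMk (X := RightClosed.hom ((Q.lift (P.ι ⋙ G) _).obj V)
        ((Q.lift (P.ι ⋙ G) _).obj W)) (Y := (Q.lift (P.ι ⋙ G) _).obj (RightClosed.hom V W))
        (γ.iso V.obj W.obj)
    naturality f g := ObjectProperty.hom_ext _ (γ.naturality f.hom g.hom)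
    iso_ev V W := ObjectProperty.hom_ext _ (γ.iso_ev V.obj W.obj) }

end Restrict

end

end QHopf

namespace QHopf
noncomputable section

section Twist

variable {k H : Type u} [CommRing k] [Ring H] [Algebra k H] {D : Data k H} [D.IsQuasitriangular]
  (A : Mon (HMod D))

/-- The braiding on symmetric bimodules that is induced by `τ`. -/
abbrev symBimodBraided [h : (symProp A).IsMonoidal] : BraidedCategory (SymBimod A) :=
  @symmetricBraided (HMod D) _ _ _ _ _ _ A h

lemma symBimodBraided_isInduced [(symProp A).IsMonoidal] :
    letI := symBimodBraided A
    IsInducedBraiding A :=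
  fun V W => tπ_tBraidX (C := HMod D) V.property.2 W.property.1

lemma isMonoidal_symProp (hA : IsBraidedCommutative A) : (symProp A).IsMonoidal :=
  symmetricProp_isMonoidal (C := HMod D) A hA

lemma isHomClosed_symProp : IsHomClosed (symProp A) :=
  symmetricProp_isHomClosed (C := HMod D) A

variable (F : (H ⊗[k] H)ˣ) [D.IsCochainTwist F] [(D.twist F).IsQuasitriangular]

lemma IsBraidedCommutative.twist {A : Mon (HMod D)} (hA : IsBraidedCommutative A) :
    IsBraidedCommutative (twistAlg D F A) :=
  braided_image_mul (twistFunctor D F) A hA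

variable {A}

lemma symProp_twist_iff (V : Bimod A A) :
    symProp (twistAlg D F A) ((twistBimod D F A).obj V) ↔ symProp A V :=
  symmetricProp_image_iff (twistFunctor D F) V

end Twist

end

end QHopf

theorem mainTheorem4 {k H : Type u} [CommRing k] [Ring H] [Algebra k H]
    (D : QHopf.Data k H) [D.IsQuasitriangular]
    (A : Mon (QHopf.HMod D)) (hA : QHopf.IsBraidedCommutative A)
    (F : (H ⊗[k] H)ˣ) [D.IsCochainTwist F] :
    -- `H_F` is quasitriangular and `A_F` is braided commutative
    ∃ (_ : (D.twist F).IsQuasitriangular),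
      QHopf.IsBraidedCommutative (QHopf.twistAlg D F A) ∧
    -- symmetric bimodules over `A` and over `A_F` form braided closed monoidal categories
    ∃ (_ : (QHopf.symProp A).IsMonoidal) (_ : QHopf.IsHomClosed (QHopf.symProp A))
      (_ : (QHopf.symProp (QHopf.twistAlg D F A)).IsMonoidal)
      (_ : QHopf.IsHomClosed (QHopf.symProp (QHopf.twistAlg D F A)))
      (_ : BraidedCategory (QHopf.SymBimod A))
      (_ : BraidedCategory (QHopf.SymBimod (QHopf.twistAlg D F A))),
      QHopf.IsInducedBraiding A ∧ QHopf.IsInducedBraiding (QHopf.twistAlg D F A) ∧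
    -- the twist equivalence of closed monoidal categories of bimodules
    ∃ (_ : (QHopf.twistBimod D F A).Monoidal)
      (γ : QHopf.ClosedComparison (QHopf.twistBimod D F A)),
      (QHopf.twistBimod D F A).IsEquivalence ∧
      (∀ V W : Bimod A A,
        QHopf.tπ ((QHopf.twistBimod D F A).obj V) ((QHopf.twistBimod D F A).obj W) ≫
          (Functor.LaxMonoidal.μ (QHopf.twistBimod D F A) V W).hom =
        (QHopf.twistμ D F V.X W.X).hom ≫ (QHopf.twistFunctor D F).map (QHopf.tπ V W)) ∧
      (Functor.LaxMonoidal.ε (QHopf.twistBimod D F A)).hom =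
        𝟙 ((QHopf.twistFunctor D F).obj A.X) ∧
      (∀ V W : Bimod A A,
        (γ.iso V W).hom.hom ≫ (QHopf.twistFunctor D F).map (QHopf.homAι V W) =
        QHopf.homAι ((QHopf.twistBimod D F A).obj V) ((QHopf.twistBimod D F A).obj W) ≫
          (QHopf.twistγ D F V.X W.X).hom) ∧
    -- its restriction to an equivalence of braided closed monoidal categories
    ∃ h : ∀ V : Bimod A A, QHopf.symProp A V →
        QHopf.symProp (QHopf.twistAlg D F A) ((QHopf.twistBimod D F A).obj V),
      (∀ V : Bimod A A, QHopf.symProp (QHopf.twistAlg D F A) ((QHopf.twistBimod D F A).obj V) →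
        QHopf.symProp A V) ∧
      ∃ (_ : (QHopf.twistSymBimod D F A h).Braided)
        (γS : QHopf.ClosedComparison (QHopf.twistSymBimod D F A h)),
        (QHopf.twistSymBimod D F A h).IsEquivalence ∧
        (∀ V W : QHopf.SymBimod A,
          (Functor.LaxMonoidal.μ (QHopf.twistSymBimod D F A h) V W).hom =
            Functor.LaxMonoidal.μ (QHopf.twistBimod D F A) V.obj W.obj) ∧
        (Functor.LaxMonoidal.ε (QHopf.twistSymBimod D F A h)).hom =
          Functor.LaxMonoidal.ε (QHopf.twistBimod D F A) ∧
        (∀ V W : QHopf.SymBimod A, (γS.iso V W).hom.hom = (γ.iso V.obj W.obj).hom) := by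
  have hD := D.twist_isQuasitriangular F
  have hAF := hA.twist F
  have := QHopf.isMonoidal_symProp A hA
  have := QHopf.isHomClosed_symProp A
  have := QHopf.isMonoidal_symProp (QHopf.twistAlg D F A) hAF
  have := QHopf.isHomClosed_symProp (QHopf.twistAlg D F A)
  let _ := QHopf.symBimodBraided A
  let _ := QHopf.symBimodBraided (QHopf.twistAlg D F A)
  have h : ∀ V : Bimod A A, QHopf.symProp A V →
      QHopf.symProp (QHopf.twistAlg D F A) ((QHopf.twistBimod D F A).obj V) :=
    fun V => (QHopf.symProp_twist_iff F V).mpr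
  have h' : ∀ V : Bimod A A, QHopf.symProp (QHopf.twistAlg D F A)
      ((QHopf.twistBimod D F A).obj V) → QHopf.symProp A V :=
    fun V => (QHopf.symProp_twist_iff F V).mp
  have hiso : (QHopf.symProp (QHopf.twistAlg D F A)).IsClosedUnderIsomorphisms :=
    QHopf.symmetricProp_isClosedUnderIsomorphisms
  let γ := QHopf.mapBimodClosedComparison (QHopf.twistFunctor D F) A
    (QHopf.twistClosedComparison D F)
  refine ⟨hD, hAF, ‹_›, ‹_›, ‹_›, ‹_›, ‹_›, ‹_›, QHopf.symBimodBraided_isInduced A,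
    QHopf.symBimodBraided_isInduced (QHopf.twistAlg D F A),
    QHopf.mapBimodMonoidal (QHopf.twistFunctor D F) A, γ,
    QHopf.mapBimod_isEquivalence (QHopf.twistFunctor D F) A,
    fun V W => QHopf.tπ_mapμX (QHopf.twistFunctor D F) V W, rfl,
    fun V W => QHopf.ClosedComparison.homAXIso_hom_ι (QHopf.twistClosedComparison D F) V W,
    h, h',
    QHopf.restrictBraided (QHopf.symProp A) (QHopf.symProp (QHopf.twistAlg D F A))
      (QHopf.twistBimod D F A) h (fun V W => QHopf.mapμ_tBraid (QHopf.twistFunctor D F)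
        V.property.2 W.property.1 (h _ V.property).2 (h _ W.property).1),
    γ.restrict (QHopf.symProp A) (QHopf.symProp (QHopf.twistAlg D F A))
      (QHopf.twistBimod D F A) h,
    QHopf.restrict_isEquivalence (QHopf.symProp A) (QHopf.symProp (QHopf.twistAlg D F A))
      (QHopf.twistBimod D F A) h h', fun _ _ => rfl, rfl, fun _ _ => rfl⟩
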